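/- Let $\mathcal M$ be a finite von Neumann algebra on a complex Hilbert space (that is, for every $a\in\mathcal M$, $a\neq 0$, there is a normal tracial state $\tau$ of $\mathcal M$ with $\tau(a^*a)\neq 0$). Let $T(\mathcal M)$ be the set of tracial states of $\mathcal M$, let $V={\rm lin}_{\mathbb C}T(\mathcal M)$ be its complex linear span, and assume $\dim V<\infty$. A self-similar triple for $\mathcal M$ is a triple $(k,p,\Phi)$ with $k$ a natural number, $p$ a projection in $M_k(\mathcal M)$ and $\Phi$ a $*$-isomorphism of $\mathcal M$ onto $pM_k(\mathcal M)p$. It defines a linear map $T_{(k,p,\Phi)}:V\to V$, $T_{(k,p,\Phi)}(\varphi)=({\rm Tr}_k\otimes\varphi)\circ\Phi$. Put $F^{tr}(\mathcal M)=\{T_{(k,p,\Phi)} : (k,p,\Phi)\text{ a self-similar triple}\}\subset\mathcal L(V)$. An $\mathcal M$-$\mathcal M$ equivalence bimodule is an $\mathcal M$-$\mathcal M$ bimodule $\mathcal X$ which is a right Hilbert $C^*$-module with inner product $\langle\cdot,\cdot\rangle_{\mathcal M}$ and a left Hilbert $C^*$-module with inner product ${}_{\mathcal M}\langle\cdot,\cdot\rangle$,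 each side acting by adjointable operators for the inner product of the other side, with ${}_{\mathcal M}\langle x,y\rangle z=x\langle y,z\rangle_{\mathcal M}$, such that both inner products have ultraweakly dense linear span in $\mathcal M$, and such that $m\mapsto\langle x,my\rangle_{\mathcal M}$ and $m\mapsto{}_{\mathcal M}\langle xm,y\rangle$ are ultraweakly continuous for all $x,y\in\mathcal X$. A finite right basis of $\mathcal X$ is a finite family $(\xi_i)$ with $x=\sum_i\xi_i\langle\xi_i,x\rangle_{\mathcal M}$ for all $x\in\mathcal X$. Let ${\rm Pic}(\mathcal M)$ be the set of isomorphism classes $[\mathcal X]$ of $\mathcal M$-$\mathcal M$ equivalence bimodules (isomorphisms preserve the linear structure, both actions and both inner products). Then: 1. Every $\mathcal M$-$\mathcal M$ equivalence bimodule $\mathcal X$ has a finite right basis, and $$R_{\mathcal M}([\mathcal X])(\varphi)(a)=\sum_i\varphi(\langle\xi_i,a\xi_i\rangle_{\mathcal M})\qquad(\varphi\in V,\ a\in\mathcal M),$$ where $(\xi_i)$ is any finite right basis of $\mathcal X$, is a well-defined map $R_{\mathcal M}:{\rm Pic}(\mathcal M)\to\mathcal L(V)$. 2. ${\rm Pic}(\mathcal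 M)$ is a group under the internal tensor product $[\mathcal X][\mathcal Y]=[\mathcal X\otimes_{\mathcal M}\mathcal Y]$ (which always exists), with identity $[\mathcal M]$; moreover $R_{\mathcal M}$ is multiplicative and $R_{\mathcal M}([\mathcal M])={\rm Id}_V$. 3. $F^{tr}(\mathcal M)=R_{\mathcal M}({\rm Pic}(\mathcal M))$. 4. $F^{tr}(\mathcal M)$ is a subgroup of $GL(V)$. -/

import Mathlib

open scoped ComplexOrder InnerProductSpace

universe u

noncomputable section

namespace VNPicard

variable {H : Type u} [NormedAddCommGroup H] [InnerProductSpace ℂ H] [CompleteSpace H]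

instance vnSMulMemClass : SMulMemClass (VonNeumannAlgebra H) ℂ (H →L[ℂ] H) where
  smul_mem {s} r _ ha := s.toStarSubalgebra.smul_mem ha r

instance vnIsClosed (M : VonNeumannAlgebra H) : IsClosed (M : Set (H →L[ℂ] H)) := by
  rw [← M.centralizer_centralizer]
  exact Set.isClosed_centralizer _

/-! ### Tracial states, the trace space, and finiteness -/

/-- A positive linear functional `φ` with `φ (a b) = φ (b a)` (automatically bounded). -/
structure IsPosTrace (M : VonNeumannAlgebra H) (φ : M →ₗ[ℂ] ℂ) : Prop where
  nonneg : ∀ a : M, 0 ≤ φ (star a * a)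
  comm : ∀ a b : M, φ (a * b) = φ (b * a)

/-- A tracial state: an element of `T(M)`. -/
structure IsTracialState (M : VonNeumannAlgebra H) (φ : M →ₗ[ℂ] ℂ) : Prop
    extends IsPosTrace M φ where
  map_one : φ 1 = 1

/-- `lin_ℂ T(M)`, the complex linear span of the tracial states. -/
def linT (M : VonNeumannAlgebra H) : Submodule ℂ (Module.Dual ℂ M) :=
  Submodule.span ℂ {φ | IsTracialState M φ}

/-- The ultraweak (σ-weak, weak-*) topology: the coarsest one for which all functionals
`a ↦ ∑ i, ⟪ξ i, a (η i)⟫` with square-summable sequences of vectors `ξ`, `η` are continuous. -/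
def ultraweak (M : VonNeumannAlgebra H) : TopologicalSpace M :=
  ⨅ (ξ : ℕ → H) (η : ℕ → H) (_ : Summable fun i => ‖ξ i‖ ^ 2) (_ : Summable fun i => ‖η i‖ ^ 2),
    TopologicalSpace.induced (fun a : M => ∑' i, ⟪ξ i, (a : H →L[ℂ] H) (η i)⟫_ℂ) inferInstance

/-- `M` is finite: for each nonzero positive element `a* a` there is a normal tracial state which
does not vanish at it. -/
def IsFiniteVN (M : VonNeumannAlgebra H) : Prop :=
  ∀ a : M, a ≠ 0 → ∃ τ : M →ₗ[ℂ] ℂ, IsTracialState M τ ∧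
    @Continuous M ℂ (ultraweak M) inferInstance τ ∧ τ (star a * a) ≠ 0

section helpers

variable {M : VonNeumannAlgebra H}

lemma IsPosTrace.eq_zero {ψ : M →ₗ[ℂ] ℂ} (h : IsPosTrace M ψ) (h1 : ψ 1 = 0) : ψ = 0 := by
  have key : ∀ (a : M) (z : ℂ),
      0 ≤ (starRingEnd ℂ z) * ψ a + z * ψ (star a) + ψ (star a * a) := by
    intro a z
    have := h.nonneg (z • 1 + a)
    have e : star (z • (1 : M) + a) * (z • 1 + a)
        = (starRingEnd ℂ z * z) • (1 : M) + starRingEnd ℂ z • a + z • star a + star a * a := by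
      simp [star_add, star_smul, add_mul, mul_add, smul_smul, mul_comm]
      abel
    rw [e] at this
    simpa [h1] using this
  ext a
  have h0 : ∀ z : ℂ, (starRingEnd ℂ z) * ψ a + z * ψ (star a) = 0 := by
    intro z
    set w := (starRingEnd ℂ z) * ψ a + z * ψ (star a) with hw
    have hk : ∀ t : ℝ, 0 ≤ (t : ℂ) * w + ψ (star a * a) := by
      intro t
      have := key a (t * z)
      convert this using 1
      simp [hw]
      ring
    have hre : ∀ t : ℝ, 0 ≤ t * w.re + (ψ (star a * a)).re := fun t => by
      simpa using (Complex.le_def.1 (hk t)).1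
    have him : ∀ t : ℝ, t * w.im + (ψ (star a * a)).im = 0 := fun t => by
      simpa using (Complex.le_def.1 (hk t)).2.symm
    have e1 : w.im = 0 := by
      have := him 1
      have := him 0
      linarith
    have e2 : w.re = 0 := by
      by_contra hne
      have := hre ((-(ψ (star a * a)).re - 1) / w.re)
      rw [div_mul_cancel₀ _ hne] at this
      linarith
    exact Complex.ext e2 e1
  have a1 := h0 1
  have a2 := h0 Complex.I
  simp only [map_one, one_mul, Complex.conj_I] at a1 a2
  have a3 : ψ (star a) = - ψ a := by linear_combination a1
  rw [a3] at a2
  have a4 : Complex.I * ψ a = 0 := by linear_combination (-1 / 2 : ℂ) * a2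
  simpa using a4

lemma IsPosTrace.mem_linT {ψ : M →ₗ[ℂ] ℂ} (h : IsPosTrace M ψ) : ψ ∈ linT M := by
  by_cases h1 : ψ 1 = 0
  · rw [h.eq_zero h1]; exact zero_mem _
  · have hpos : 0 ≤ ψ 1 := by simpa using h.nonneg 1
    have hs : IsTracialState M ((ψ 1)⁻¹ • ψ) :=
      { nonneg := fun a => by
          simpa using mul_nonneg (inv_nonneg.2 hpos) (h.nonneg a)
        comm := fun a b => by simp [h.comm a b]
        map_one := by simp [h1] }
    have : ψ = ψ 1 • ((ψ 1)⁻¹ • ψ) := by rw [smul_smul, mul_inv_cancel₀ h1, one_smul]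
    rw [this]
    exact Submodule.smul_mem _ _ (Submodule.subset_span hs)

/-- For a linear map `L : M → M` which pulls tracial states back to positive traces, the linear
map `φ ↦ φ ∘ L` of `lin_ℂ T(M)` into itself. -/
def pullback (L : M →ₗ[ℂ] M) (h : ∀ φ, IsTracialState M φ → IsPosTrace M (φ ∘ₗ L)) :
    Module.End ℂ (linT M) :=
  L.dualMap.restrict (p := linT M) (q := linT M) (by
    intro φ hφ
    have : linT M ≤ (linT M).comap L.dualMap :=
      Submodule.span_le.2 fun φ hφ => (h φ hφ).mem_linT
    exact this hφ)

lemma pullback_apply (L : M →ₗ[ℂ] M) (h : ∀ φ, IsTracialState M φ → IsPosTrace M (φ ∘ₗ L))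
    (φ : linT M) (a : M) : (pullback L h φ).1 a = φ.1 (L a) := rfl

lemma comm_of_mem {φ : Module.Dual ℂ M} (hφ : φ ∈ linT M) (a b : M) :
    φ (a * b) = φ (b * a) := by
  induction hφ using Submodule.span_induction with
  | mem x hx => exact hx.comm a b
  | zero => simp
  | add x y _ _ hx hy => simp [hx, hy]
  | smul c x _ hx => simp [hx]

end helpers

/-! ### Self-similar triples -/

/-- A self-similar triple `(k, p, Φ)`: `p` is a projection in `M_k(M)` and `Φ` is a
`*`-isomorphism of `M` onto the corner `p M_k(M) p`. -/
structure SelfSimilarTriple (M : VonNeumannAlgebra H) where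
  k : ℕ
  p : Matrix (Fin k) (Fin k) M
  isStarProjection : IsStarProjection p
  Φ : M →⋆ₙₐ[ℂ] Matrix (Fin k) (Fin k) M
  injective : Function.Injective Φ
  range_eq : Set.range Φ = Set.range fun x : Matrix (Fin k) (Fin k) M => p * x * p

namespace SelfSimilarTriple

variable {M : VonNeumannAlgebra H}

/-- `a ↦ ∑ i, Φ(a)_{i i}`, so that `(Tr_k ⊗ φ) ∘ Φ = φ ∘ diagSum`. -/
def diagSum (t : SelfSimilarTriple M) : M →ₗ[ℂ] M where
  toFun a := ∑ i, t.Φ a i i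
  map_add' a b := by simp [Finset.sum_add_distrib]
  map_smul' c a := by simp [Finset.smul_sum]

lemma isPosTrace (t : SelfSimilarTriple M) (φ : M →ₗ[ℂ] ℂ) (hφ : IsTracialState M φ) :
    IsPosTrace M (φ ∘ₗ t.diagSum) where
  nonneg a := by
    simp only [LinearMap.comp_apply, diagSum, LinearMap.coe_mk, AddHom.coe_mk, map_mul, map_star,
      Matrix.mul_apply, Matrix.star_apply, map_sum]
    exact Finset.sum_nonneg fun i _ => Finset.sum_nonneg fun j _ => hφ.nonneg _
  comm a b := by
    simp only [LinearMap.comp_apply, diagSum, LinearMap.coe_mk, AddHom.coe_mk, map_mul,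
      Matrix.mul_apply, map_sum]
    rw [Finset.sum_comm]
    exact Finset.sum_congr rfl fun i _ => Finset.sum_congr rfl fun j _ => hφ.comm _ _

/-- `T_{(k,p,Φ)}(φ) = (Tr_k ⊗ φ) ∘ Φ`. -/
def T (t : SelfSimilarTriple M) : Module.End ℂ (linT M) := pullback t.diagSum t.isPosTrace

lemma T_apply (t : SelfSimilarTriple M) (φ : linT M) (a : M) :
    (t.T φ).1 a = ∑ i, φ.1 (t.Φ a i i) := by
  simp [T, pullback_apply, diagSum]

end SelfSimilarTriple

/-- `F^tr(M)`. -/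
def Ftr (M : VonNeumannAlgebra H) : Set (Module.End ℂ (linT M)) :=
  Set.range fun t : SelfSimilarTriple M => t.T

/-! ### Equivalence bimodules -/

/-- An `M`-`M` equivalence bimodule. The right action of `b` on `x` is written
`MulOpposite.op b • x`; `rInner` is the right inner product (linear in the second variable), `lInner`
the left one (linear in the first variable). An element of `M` is positive iff it is of the form
`star b * b`. -/
structure EquivBimodule (M : VonNeumannAlgebra H) : Type (u + 1) where
  carrier : Type u
  [normedAddCommGroup : NormedAddCommGroup carrier]
  [normedSpace : NormedSpace ℂ carrier]
  [completeSpace : CompleteSpace carrier]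
  [leftModule : Module M carrier]
  [rightModule : Module Mᵐᵒᵖ carrier]
  [leftTower : IsScalarTower ℂ M carrier]
  [rightTower : IsScalarTower ℂ Mᵐᵒᵖ carrier]
  [smulCommClass : SMulCommClass M Mᵐᵒᵖ carrier]
  rInner : carrier → carrier → M
  lInner : carrier → carrier → M
  -- `carrier` is a right Hilbert module on which `M` acts by adjointable operators from the left
  rInner_add : ∀ x y z, rInner x (y + z) = rInner x y + rInner x z
  rInner_smul : ∀ x y (b : M), rInner x (MulOpposite.op b • y) = rInner x y * b
  star_rInner : ∀ x y, star (rInner x y) = rInner y x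
  rInner_self : ∀ x, ∃ b : M, rInner x x = star b * b
  norm_rInner : ∀ x, ‖x‖ ^ 2 = ‖rInner x x‖
  rInner_adjoint : ∀ (a : M) x y, rInner (a • x) y = rInner x (star a • y)
  -- `carrier` is a left Hilbert module on which `M` acts by adjointable operators from the right
  lInner_add : ∀ x y z, lInner (x + y) z = lInner x z + lInner y z
  lInner_smul : ∀ (a : M) x y, lInner (a • x) y = a * lInner x y
  star_lInner : ∀ x y, star (lInner x y) = lInner y x
  lInner_self : ∀ x, ∃ b : M, lInner x x = star b * b
  norm_lInner : ∀ x, ‖x‖ ^ 2 = ‖lInner x x‖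
  lInner_adjoint : ∀ x y (b : M),
    lInner (MulOpposite.op b • x) y = lInner x (MulOpposite.op (star b) • y)
  -- compatibility, fullness and normality
  lInner_smul_eq : ∀ x y z, lInner x y • z = MulOpposite.op (rInner y z) • x
  dense_rInner : @Dense M (ultraweak M)
    (Submodule.span ℂ (Set.range fun q : carrier × carrier => rInner q.1 q.2) : Set M)
  dense_lInner : @Dense M (ultraweak M)
    (Submodule.span ℂ (Set.range fun q : carrier × carrier => lInner q.1 q.2) : Set M)
  normal_left : ∀ x y, @Continuous M M (ultraweak M) (ultraweak M) fun m => rInner x (m • y)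
  normal_right : ∀ x y, @Continuous M M (ultraweak M) (ultraweak M)
    fun m => lInner (MulOpposite.op m • x) y

attribute [instance] EquivBimodule.normedAddCommGroup EquivBimodule.normedSpace
  EquivBimodule.completeSpace EquivBimodule.leftModule EquivBimodule.rightModule
  EquivBimodule.leftTower EquivBimodule.rightTower EquivBimodule.smulCommClass

namespace EquivBimodule

variable {M : VonNeumannAlgebra H}

/-- Isomorphism of equivalence bimodules. -/
structure Iso (X Y : EquivBimodule M) where
  toEquiv : X.carrier ≃ₗ[ℂ] Y.carrier
  map_left : ∀ (a : M) x, toEquiv (a • x) = a • toEquiv x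
  map_right : ∀ (b : M) x, toEquiv (MulOpposite.op b • x) = MulOpposite.op b • toEquiv x
  map_lInner : ∀ x y, Y.lInner (toEquiv x) (toEquiv y) = X.lInner x y
  map_rInner : ∀ x y, Y.rInner (toEquiv x) (toEquiv y) = X.rInner x y

instance setoid (M : VonNeumannAlgebra H) : Setoid (EquivBimodule M) where
  r X Y := Nonempty (Iso X Y)
  iseqv :=
    { refl := fun X => ⟨⟨LinearEquiv.refl ℂ _, by simp, by simp, by simp, by simp⟩⟩
      symm := by
        rintro X Y ⟨e⟩
        refine ⟨⟨e.toEquiv.symm, fun a x => ?_, fun a x => ?_, fun x y => ?_, fun x y => ?_⟩⟩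
        · rw [LinearEquiv.symm_apply_eq, e.map_left]; simp
        · rw [LinearEquiv.symm_apply_eq, e.map_right]; simp
        · rw [← e.map_lInner]; simp
        · rw [← e.map_rInner]; simp
      trans := by
        rintro X Y Z ⟨e⟩ ⟨f⟩
        refine ⟨⟨e.toEquiv.trans f.toEquiv, fun a x => ?_, fun a x => ?_, fun x y => ?_,
          fun x y => ?_⟩⟩
        · simp [e.map_left, f.map_left]
        · simp [e.map_right, f.map_right]
        · simp [e.map_lInner, f.map_lInner]
        · simp [e.map_rInner, f.map_rInner] }

/-- A finite right basis of `X`: `x = ∑ i, ξ i ⟨ξ i, x⟩` for all `x`. -/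
def IsRightBasis (X : EquivBimodule M) {n : ℕ} (ξ : Fin n → X.carrier) : Prop :=
  ∀ x, x = ∑ i, MulOpposite.op (X.rInner (ξ i) x) • ξ i

lemma rInner_zero (X : EquivBimodule M) (x : X.carrier) : X.rInner x 0 = 0 := by
  simpa using X.rInner_add x 0 0

lemma rInner_sum (X : EquivBimodule M) (x : X.carrier) {n : ℕ} (y : Fin n → X.carrier) :
    X.rInner x (∑ i, y i) = ∑ i, X.rInner x (y i) :=
  map_sum (AddMonoidHom.mk' (X.rInner x) (X.rInner_add x)) y Finset.univ

lemma rInner_csmul (X : EquivBimodule M) (x y : X.carrier) (c : ℂ) :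
    X.rInner x (c • y) = c • X.rInner x y := by
  have : c • y = MulOpposite.op (c • (1 : M)) • y := by
    rw [MulOpposite.op_smul, smul_assoc]; simp
  rw [this, X.rInner_smul]; simp

/-- `a ↦ ∑ i, ⟨ξ i, a ξ i⟩`. -/
def diagSum (X : EquivBimodule M) {n : ℕ} (ξ : Fin n → X.carrier) : M →ₗ[ℂ] M where
  toFun a := ∑ i, X.rInner (ξ i) (a • ξ i)
  map_add' a b := by simp [add_smul, X.rInner_add, Finset.sum_add_distrib]
  map_smul' c a := by simp [X.rInner_csmul, Finset.smul_sum]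

lemma diagSum_trace (X Y : EquivBimodule M) (e : Iso X Y) {m n : ℕ} {ξ : Fin m → X.carrier}
    {η : Fin n → Y.carrier} (hη : Y.IsRightBasis η) (hξ : X.IsRightBasis ξ)
    {φ : Module.Dual ℂ M} (hφ : ∀ a b : M, φ (a * b) = φ (b * a)) (a b : M) :
    φ (X.diagSum ξ (a * b)) = φ (Y.diagSum η (b * a)) := by
  have hX : ∀ i, X.rInner (ξ i) ((a * b) • ξ i) =
      ∑ j, Y.rInner (e.toEquiv (ξ i)) (a • η j) * Y.rInner (η j) (b • e.toEquiv (ξ i)) := by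
    intro i
    rw [← e.map_rInner, e.map_left, mul_smul]
    conv_lhs => rw [hη (b • e.toEquiv (ξ i)), Finset.smul_sum, rInner_sum]
    refine Finset.sum_congr rfl fun j _ => ?_
    rw [← Y.rInner_smul, smul_comm]
  have hY : ∀ j, Y.rInner (η j) ((b * a) • η j) =
      ∑ i, Y.rInner (η j) (b • e.toEquiv (ξ i)) * Y.rInner (e.toEquiv (ξ i)) (a • η j) := by
    intro j
    have h1 : a • η j = ∑ i, MulOpposite.op (Y.rInner (e.toEquiv (ξ i)) (a • η j)) •
        e.toEquiv (ξ i) := by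
      have := congrArg e.toEquiv (hξ (e.toEquiv.symm (a • η j)))
      rw [map_sum, LinearEquiv.apply_symm_apply] at this
      conv_lhs => rw [this]
      refine Finset.sum_congr rfl fun i _ => ?_
      rw [e.map_right, ← e.map_rInner, LinearEquiv.apply_symm_apply]
    rw [mul_smul]
    conv_lhs => rw [h1, Finset.smul_sum, rInner_sum]
    refine Finset.sum_congr rfl fun i _ => ?_
    rw [← Y.rInner_smul, smul_comm]
  simp only [diagSum, LinearMap.coe_mk, AddHom.coe_mk, map_sum, hX, hY]
  rw [Finset.sum_comm]
  exact Finset.sum_congr rfl fun j _ => Finset.sum_congr rfl fun i _ => hφ _ _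

/-- The identity isomorphism. -/
def Iso.refl (X : EquivBimodule M) : Iso X X :=
  ⟨LinearEquiv.refl ℂ _, by simp, by simp, by simp, by simp⟩

lemma isPosTrace (X : EquivBimodule M) {n : ℕ} {ξ : Fin n → X.carrier} (hξ : X.IsRightBasis ξ)
    (φ : M →ₗ[ℂ] ℂ) (hφ : IsTracialState M φ) : IsPosTrace M (φ ∘ₗ X.diagSum ξ) where
  nonneg a := by
    simp only [LinearMap.comp_apply, diagSum, LinearMap.coe_mk, AddHom.coe_mk, map_sum]
    refine Finset.sum_nonneg fun i _ => ?_
    rw [mul_smul, ← X.rInner_adjoint]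
    obtain ⟨b, hb⟩ := X.rInner_self (a • ξ i)
    rw [hb]
    exact hφ.nonneg b
  comm a b := diagSum_trace X X (Iso.refl X) hξ hξ hφ.comm a b

/-- `φ ↦ (a ↦ ∑ i, φ ⟨ξ i, a ξ i⟩)` for a finite right basis `ξ` of `X`. -/
def basisMap (X : EquivBimodule M) {n : ℕ} {ξ : Fin n → X.carrier} (hξ : X.IsRightBasis ξ) :
    Module.End ℂ (linT M) := pullback (X.diagSum ξ) (X.isPosTrace hξ)

lemma basisMap_eq (X Y : EquivBimodule M) (e : Iso X Y) {m n : ℕ} {ξ : Fin m → X.carrier}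
    {η : Fin n → Y.carrier} (hξ : X.IsRightBasis ξ) (hη : Y.IsRightBasis η) :
    X.basisMap hξ = Y.basisMap hη := by
  refine LinearMap.ext fun φ => Subtype.ext (LinearMap.ext fun a => ?_)
  simpa [basisMap, pullback_apply] using
    diagSum_trace X Y e hη hξ (comm_of_mem φ.2) a 1

/-- `X` has a finite right basis. -/
def HasRightBasis (X : EquivBimodule M) : Prop :=
  ∃ (n : ℕ) (ξ : Fin n → X.carrier), X.IsRightBasis ξ

lemma HasRightBasis.of_iso {X Y : EquivBimodule M} (e : Iso X Y) (h : X.HasRightBasis) :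
    Y.HasRightBasis := by
  obtain ⟨n, ξ, hξ⟩ := h
  refine ⟨n, fun i => e.toEquiv (ξ i), fun y => ?_⟩
  have := congrArg e.toEquiv (hξ (e.toEquiv.symm y))
  rw [map_sum, LinearEquiv.apply_symm_apply] at this
  conv_lhs => rw [this]
  refine Finset.sum_congr rfl fun i _ => ?_
  rw [e.map_right, ← e.map_rInner, LinearEquiv.apply_symm_apply]

open Classical in
/-- The map `R_M(X)`, computed with any finite right basis of `X` (with the junk value `0` if
there is none). -/
def R (X : EquivBimodule M) : Module.End ℂ (linT M) :=
  if h : X.HasRightBasis then X.basisMap h.choose_spec.choose_spec else 0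

lemma R_eq_of_iso {X Y : EquivBimodule M} (e : Iso X Y) : X.R = Y.R := by
  by_cases h : X.HasRightBasis
  · have h' : Y.HasRightBasis := h.of_iso e
    rw [R, R, dif_pos h, dif_pos h']
    exact basisMap_eq X Y e _ _
  · have h' : ¬ Y.HasRightBasis := fun h' => by
      obtain ⟨f⟩ := Setoid.symm (show X ≈ Y from ⟨e⟩)
      exact h (h'.of_iso f)
    rw [R, R, dif_neg h, dif_neg h']

lemma R_apply (X : EquivBimodule M) {n : ℕ} {ξ : Fin n → X.carrier} (hξ : X.IsRightBasis ξ)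
    (φ : linT M) (a : M) : (X.R φ).1 a = ∑ i, φ.1 (X.rInner (ξ i) (a • ξ i)) := by
  have h : X.HasRightBasis := ⟨n, ξ, hξ⟩
  rw [R, dif_pos h, basisMap_eq X X (Iso.refl X) _ hξ]
  simp [basisMap, pullback_apply, diagSum]

/-- `Z` is an internal tensor product `X ⊗_M Y`, with elementary tensors `t x y`. -/
structure IsInternalTensor (X Y Z : EquivBimodule M) (t : X.carrier → Y.carrier → Z.carrier) :
    Prop where
  add_left : ∀ x x' y, t (x + x') y = t x y + t x' y
  add_right : ∀ x y y', t x (y + y') = t x y + t x y'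
  balanced : ∀ x (a : M) y, t (MulOpposite.op a • x) y = t x (a • y)
  smul_left : ∀ (a : M) x y, t (a • x) y = a • t x y
  smul_right : ∀ x (b : M) y, t x (MulOpposite.op b • y) = MulOpposite.op b • t x y
  rInner_eq : ∀ x x' y y', Z.rInner (t x y) (t x' y') = Y.rInner y (X.rInner x x' • y')
  lInner_eq : ∀ x x' y y',
    Z.lInner (t x y) (t x' y') = X.lInner (MulOpposite.op (Y.lInner y y') • x) x'
  dense : Dense
    (Submodule.span ℂ (Set.range fun q : X.carrier × Y.carrier => t q.1 q.2) : Set Z.carrier)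

end EquivBimodule

section self

variable (M : VonNeumannAlgebra H)

lemma continuous_ultraweak_sandwich (x y : M) :
    @Continuous M M (ultraweak M) (ultraweak M) fun m => x * m * y := by
  refine continuous_iInf_rng.2 fun ξ => continuous_iInf_rng.2 fun η =>
    continuous_iInf_rng.2 fun hξ => continuous_iInf_rng.2 fun hη => continuous_induced_rng.2 ?_
  have bound : ∀ (z : H →L[ℂ] H) (ζ : ℕ → H), (Summable fun i => ‖ζ i‖ ^ 2) →
      Summable fun i => ‖z (ζ i)‖ ^ 2 := by
    intro z ζ hζ
    refine Summable.of_nonneg_of_le (fun i => by positivity) (fun i => ?_)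
      (hζ.mul_left (‖z‖ ^ 2))
    rw [← mul_pow]
    exact pow_le_pow_left₀ (norm_nonneg _) (z.le_opNorm _) 2
  have key : @Continuous M ℂ (ultraweak M) inferInstance fun a : M =>
      ∑' i, ⟪(star (x : H →L[ℂ] H)) (ξ i), (a : H →L[ℂ] H) ((y : H →L[ℂ] H) (η i))⟫_ℂ := by
    rw [continuous_iff_le_induced]
    exact iInf_le_of_le _ <| iInf_le_of_le _ <| iInf_le_of_le (bound _ ξ hξ) <|
      iInf_le_of_le (bound _ η hη) le_rfl
  convert key using 1
  funext a
  refine tsum_congr fun i => ?_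
  rw [ContinuousLinearMap.star_eq_adjoint, ContinuousLinearMap.adjoint_inner_left]
  rfl

/-- `M` as an `M`-`M` equivalence bimodule. -/
def EquivBimodule.self : EquivBimodule M where
  carrier := M
  rInner a b := star a * b
  lInner a b := a * star b
  rInner_add x y z := mul_add _ _ _
  rInner_smul x y b := by simp [mul_assoc]
  star_rInner x y := by simp
  rInner_self x := ⟨x, rfl⟩
  norm_rInner x := by rw [CStarRing.norm_star_mul_self, sq]
  rInner_adjoint a x y := by simp [mul_assoc]
  lInner_add x y z := add_mul _ _ _
  lInner_smul a x y := by simp [mul_assoc]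
  star_lInner x y := by simp
  lInner_self x := ⟨star x, by simp⟩
  norm_lInner x := by rw [CStarRing.norm_self_mul_star, sq]
  lInner_adjoint x y b := by simp [mul_assoc]
  lInner_smul_eq x y z := by simp [mul_assoc]
  dense_rInner a := by
    refine @subset_closure _ (ultraweak M) _ _ (Submodule.subset_span ⟨(1, a), ?_⟩)
    simp
  dense_lInner a := by
    refine @subset_closure _ (ultraweak M) _ _ (Submodule.subset_span ⟨(a, 1), ?_⟩)
    simp
  normal_left x y := by
    simpa [mul_assoc] using continuous_ultraweak_sandwich M (star x) y
  normal_right x y := by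
    simpa [mul_assoc] using continuous_ultraweak_sandwich M x (star y)

end self

/-- The underlying set of the Picard group of `M`: the isomorphism classes `[X]` of `M`-`M`
equivalence bimodules. -/
def Pic (M : VonNeumannAlgebra H) : Type (u + 1) := Quotient (EquivBimodule.setoid M)

/-- The class `[X]`. -/
def Pic.mk {M : VonNeumannAlgebra H} (X : EquivBimodule M) : Pic M :=
  Quotient.mk (EquivBimodule.setoid M) X

/-- The map `R_M`, `R_M([X])(φ)(a) = ∑ i, φ ⟨ξ i, a ξ i⟩`. -/
def picR (M : VonNeumannAlgebra H) : Pic M → Module.End ℂ (linT M) :=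
  Quotient.lift EquivBimodule.R fun _ _ ⟨e⟩ => EquivBimodule.R_eq_of_iso e

end VNPicard

end

/-!
The bridge between the two sides of the theorem is a pair of constructions. From a bimodule `X` with
a finite family `ξ` such that `∑ i, ⟨ξ i, ξ i⟩ = 1` for the left inner product, the matrices
`Φ a = (⟨ξ i, a ξ j⟩)` form a self-similar triple (`EquivBimodule.toTriple`), and the trace formulas
for the triple and for `X` are literally the same. Conversely, a triple `(k, p, Φ)` and a bimodule
`Y` give the bimodule `p Y ^ k` of columns fixed by `p`, on which `M` acts through `Φ`
(`SelfSimilarTriple.tensor`). For `Y = M` this inverts the first construction on the trace space;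
for the triple of `X` it is a model of `X ⊗ Y`, with `x ⊗ y` the column of the `⟨ξ i, x⟩ y`
(`EquivBimodule.exists_isInternalTensor`). The group laws of `Pic M` follow from the fact that two
bimodules with total families having the same left and right Gram matrices are isomorphic
(`EquivBimodule.nonempty_iso_of_gram`); the inverse is the dual bimodule. Since the vectors
`ξ i ⊗ η j` form a basis of `X ⊗ Y`, the map `R` is multiplicative, and `F^tr(M)` is the image of a
group homomorphism.

Two analytic points carry this.

* Existence of the families `ξ`. The ideal spanned by the inner products is only ultraweakly dense;
  it has to contain `1`. Finite dimension of the trace space bounds the number of orthogonal central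
  projections, so `1` is a finite sum of minimal ones. Below a minimal central projection `z`,
  comparison of projections holds, hence Dixmier averaging: averages of a self-adjoint element come
  close to multiples of `z` (`IsMinimalCentral.dixmier`). Applied inside an ideal and along a trace,
  it shows that an ideal meeting the summand of `z` contains `z`, so that dense ideals are improper
  (`eq_top_of_dense`). The same argument shows that traces are unique on each summand, so every
  trace is normal and a faithful one exists.

* Normality and fullness of `p Y ^ k`. A triple is a purely algebraic object, but `Φ` and its
  inverse are automatically ultraweakly continuous: composed with a faithful trace they give traces
  of `M`, which are normal, and a linear map which is weakly continuous in this sense is ultraweakly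
  continuous by the closed graph theorem, compactness of the balls and the Krein–Smulian theorem
  (`uwContMap_of_faithful`). The entries of `p` generate `M` as an ideal because the minimal central
  projections of the corner, being as many as those of `M`, are spread over all summands
  (`SelfSimilarTriple.entries_full`).
-/

noncomputable section

namespace VNPicard

variable {H : Type u} [NormedAddCommGroup H] [InnerProductSpace ℂ H] [CompleteSpace H]

variable {M : VonNeumannAlgebra H}

/-! ### Order and functional calculus in a von Neumann algebra -/

/-- An element commuting with the commutant lies in the algebra. -/
lemma mem_of_commute_commutant {x : H →L[ℂ] H} (h : ∀ y ∈ M.commutant, y * x = x * y) : x ∈ M := by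
  rw [← M.commutant_commutant, VonNeumannAlgebra.mem_commutant_iff]
  exact h

lemma sqrt_mem {x : H →L[ℂ] H} (hx : x ∈ M) : CFC.sqrt x ∈ M := by
  refine mem_of_commute_commutant fun y hy => ?_
  have h1 : Commute x y := VonNeumannAlgebra.mem_commutant_iff.1 hy x hx
  exact ((h1.cfcₙ_nnreal _).eq).symm

/-- For the order inherited from `B(H)`, positive elements of `M` are of the form `star b * b`. -/
instance vnStarOrderedRing : StarOrderedRing M :=
  StarOrderedRing.of_nonneg_iff' (fun h z => by gcongr) fun x => by
    constructor
    · intro hx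
      have hx' : (0 : H →L[ℂ] H) ≤ x := hx
      refine ⟨⟨CFC.sqrt (x : H →L[ℂ] H), sqrt_mem x.2⟩, Subtype.ext ?_⟩
      have h2 : IsSelfAdjoint (CFC.sqrt (x : H →L[ℂ] H)) := (CFC.sqrt_nonneg _).isSelfAdjoint
      change (x : H →L[ℂ] H) = star (CFC.sqrt (x : H →L[ℂ] H)) * CFC.sqrt (x : H →L[ℂ] H)
      rw [h2.star_eq, CFC.sqrt_mul_sqrt_self _ hx']
    · rintro ⟨s, rfl⟩
      exact star_mul_self_nonneg (s : H →L[ℂ] H)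

lemma exists_star_mul_self_iff {x : M} : (∃ b : M, x = star b * b) ↔ 0 ≤ x :=
  CStarAlgebra.nonneg_iff_eq_star_mul_self.symm

lemma IsPosTrace.map_nonneg {φ : M →ₗ[ℂ] ℂ} (h : IsPosTrace M φ) {a : M} (ha : 0 ≤ a) :
    0 ≤ φ a := by
  obtain ⟨b, rfl⟩ := exists_star_mul_self_iff.2 ha
  exact h.nonneg b

lemma IsPosTrace.mono {φ : M →ₗ[ℂ] ℂ} (h : IsPosTrace M φ) {a b : M} (hab : a ≤ b) :
    φ a ≤ φ b := by
  have := h.map_nonneg (sub_nonneg.2 hab)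
  rw [map_sub] at this
  exact sub_nonneg.1 this

lemma IsPosTrace.norm_le_of_isSelfAdjoint {φ : M →ₗ[ℂ] ℂ} (h : IsPosTrace M φ) {a : M}
    (ha : IsSelfAdjoint a) : ‖φ a‖ ≤ ‖a‖ * ‖φ 1‖ := by
  have h0 : 0 ≤ φ 1 := by simpa using h.nonneg 1
  have e : φ (algebraMap ℝ M ‖a‖) = (‖a‖ * ‖φ 1‖ : ℝ) := by
    rw [Algebra.algebraMap_eq_smul_one, ← Complex.coe_smul, map_smul, smul_eq_mul,
      Complex.ofReal_mul, ← Complex.eq_coe_norm_of_nonneg h0]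
  have h1 := h.mono (ha.le_algebraMap_norm_self)
  have h2 := h.mono (ha.neg_algebraMap_norm_le_self)
  rw [map_neg] at h2
  rw [e] at h1 h2
  rw [Complex.le_def] at h1 h2
  simp only [Complex.neg_re, Complex.neg_im, Complex.ofReal_re, Complex.ofReal_im] at h1 h2
  have e2 : φ a = ((φ a).re : ℂ) := Complex.ext rfl (by simpa using h1.2)
  rw [e2, Complex.norm_real, Real.norm_eq_abs]
  exact abs_le.2 ⟨h2.1, h1.1⟩

/-! ### The ultraweak topology -/

/-- Ultraweak continuity of a scalar-valued function. -/
def UWCont (f : M → ℂ) : Prop := @Continuous M ℂ (ultraweak M) inferInstance f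

/-- Continuity of a map `M → M` for the ultraweak topologies. -/
def UWContMap (L : M → M) : Prop := @Continuous M M (ultraweak M) (ultraweak M) L

/-- The functional `a ↦ ∑ i, ⟪ξ i, a (η i)⟫`. -/
def vecFun (ξ η : ℕ → H) (a : M) : ℂ := ∑' i, ⟪ξ i, (a : H →L[ℂ] H) (η i)⟫_ℂ

lemma uwCont_vecFun {ξ η : ℕ → H} (hξ : Summable fun i => ‖ξ i‖ ^ 2)
    (hη : Summable fun i => ‖η i‖ ^ 2) : UWCont (M := M) (vecFun ξ η) := by
  rw [UWCont, continuous_iff_le_induced]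
  exact iInf_le_of_le _ <| iInf_le_of_le _ <| iInf_le_of_le hξ <| iInf_le_of_le hη le_rfl

lemma uwContMap_iff {L : M → M} : UWContMap L ↔ ∀ ξ η : ℕ → H, (Summable fun i => ‖ξ i‖ ^ 2) →
    (Summable fun i => ‖η i‖ ^ 2) → UWCont fun a => vecFun (M := M) ξ η (L a) := by
  constructor
  · intro h ξ η hξ hη
    exact @Continuous.comp _ _ _ (ultraweak M) (ultraweak M) _ _ _ (uwCont_vecFun hξ hη) h
  · intro h
    exact continuous_iInf_rng.2 fun ξ => continuous_iInf_rng.2 fun η =>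
      continuous_iInf_rng.2 fun hξ => continuous_iInf_rng.2 fun hη =>
        continuous_induced_rng.2 (h ξ η hξ hη)

lemma UWCont.comp {f : M → ℂ} {L : M → M} (hf : UWCont f) (hL : UWContMap L) :
    UWCont fun a => f (L a) := @Continuous.comp _ _ _ (ultraweak M) (ultraweak M) _ _ _ hf hL

lemma UWContMap.comp {K L : M → M} (hK : UWContMap K) (hL : UWContMap L) :
    UWContMap fun a => K (L a) :=
  @Continuous.comp _ _ _ (ultraweak M) (ultraweak M) (ultraweak M) _ _ hK hL

lemma UWCont.add {f g : M → ℂ} (hf : UWCont f) (hg : UWCont g) : UWCont fun a => f a + g a := by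
  let := ultraweak M
  exact Continuous.add (f := f) (g := g) hf hg

lemma UWCont.const_mul {f : M → ℂ} (hf : UWCont f) (c : ℂ) : UWCont fun a => c * f a := by
  let := ultraweak M
  exact Continuous.mul (g := f) continuous_const hf

lemma UWCont.sum {ι : Type*} {s : Finset ι} {f : ι → M → ℂ} (hf : ∀ i, UWCont (f i)) :
    UWCont fun a => ∑ i ∈ s, f i a := by
  let := ultraweak M
  exact continuous_finsetSum s fun i _ => hf i

lemma uwContMap_sandwich (x y : M) : UWContMap fun m => x * m * y :=
  continuous_ultraweak_sandwich M x y

lemma uwContMap_mul_left (x : M) : UWContMap fun m => x * m := by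
  simpa using uwContMap_sandwich x 1

lemma uwContMap_mul_right (y : M) : UWContMap fun m => m * y := by
  simpa using uwContMap_sandwich 1 y

lemma summable_norm_mul_norm {E : Type*} [NormedAddCommGroup E] {ξ η : ℕ → E}
    (hξ : Summable fun i => ‖ξ i‖ ^ 2) (hη : Summable fun i => ‖η i‖ ^ 2) :
    Summable fun i => ‖ξ i‖ * ‖η i‖ := by
  refine Summable.of_nonneg_of_le (fun i => by positivity) (fun i => ?_) (hξ.add hη)
  nlinarith [sq_nonneg (‖ξ i‖ - ‖η i‖), sq_nonneg (‖ξ i‖), sq_nonneg (‖η i‖)]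

lemma norm_inner_apply_le (a : M) (x y : H) : ‖⟪x, (a : H →L[ℂ] H) y⟫_ℂ‖ ≤ ‖a‖ * (‖x‖ * ‖y‖) := by
  refine (norm_inner_le_norm _ _).trans ?_
  have := (a : H →L[ℂ] H).le_opNorm y
  calc ‖x‖ * ‖(a : H →L[ℂ] H) y‖ ≤ ‖x‖ * (‖(a : H →L[ℂ] H)‖ * ‖y‖) := by gcongr
    _ = _ := by rw [show ‖a‖ = ‖(a : H →L[ℂ] H)‖ from rfl]; ring

lemma summable_vecFun {ξ η : ℕ → H} (hξ : Summable fun i => ‖ξ i‖ ^ 2)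
    (hη : Summable fun i => ‖η i‖ ^ 2) (a : M) :
    Summable fun i => ⟪ξ i, (a : H →L[ℂ] H) (η i)⟫_ℂ :=
  Summable.of_norm_bounded ((summable_norm_mul_norm hξ hη).mul_left ‖a‖)
    fun i => norm_inner_apply_le a (ξ i) (η i)

lemma vecFun_add {ξ η : ℕ → H} (hξ : Summable fun i => ‖ξ i‖ ^ 2)
    (hη : Summable fun i => ‖η i‖ ^ 2) (a b : M) :
    vecFun ξ η (a + b) = vecFun ξ η a + vecFun ξ η b := by
  rw [vecFun, vecFun, vecFun, ← (summable_vecFun hξ hη a).tsum_add (summable_vecFun hξ hη b)]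
  exact tsum_congr fun i => by simp

lemma vecFun_smul (ξ η : ℕ → H) (c : ℂ) (a : M) :
    vecFun ξ η (c • a) = c * vecFun ξ η a := by
  rw [vecFun, vecFun, ← tsum_mul_left]
  exact tsum_congr fun i => by
    rw [show ((c • a : M) : H →L[ℂ] H) = c • (a : H →L[ℂ] H) from rfl]
    simp

lemma vecFun_star (ξ η : ℕ → H) (a : M) :
    vecFun ξ η (star a) = starRingEnd ℂ (vecFun η ξ a) := by
  rw [vecFun, vecFun, Complex.conj_tsum]
  refine tsum_congr fun i => ?_
  rw [show ((star a : M) : H →L[ℂ] H) = star (a : H →L[ℂ] H) from rfl,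
    ContinuousLinearMap.star_eq_adjoint, ContinuousLinearMap.adjoint_inner_right,
    inner_conj_symm]

lemma uwContMap_star : UWContMap fun m : M => star m := by
  refine uwContMap_iff.2 fun ξ η hξ hη => ?_
  simp_rw [vecFun_star]
  exact @Continuous.comp _ _ _ (ultraweak M) _ _ _ _ Complex.continuous_conj
    (uwCont_vecFun (M := M) hη hξ)

lemma UWContMap.add {K L : M → M} (hK : UWContMap K) (hL : UWContMap L) :
    UWContMap fun a => K a + L a := by
  refine uwContMap_iff.2 fun ξ η hξ hη => ?_
  simp_rw [vecFun_add hξ hη]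
  exact (uwContMap_iff.1 hK ξ η hξ hη).add (uwContMap_iff.1 hL ξ η hξ hη)

lemma uwContMap_const (b : M) : UWContMap fun _ : M => b :=
  @continuous_const M M (ultraweak M) (ultraweak M) b

lemma UWContMap.sum {ι : Type*} {s : Finset ι} {K : ι → M → M} (hK : ∀ i, UWContMap (K i)) :
    UWContMap fun a => ∑ i ∈ s, K i a := by
  classical
  induction s using Finset.induction_on with
  | empty => simpa using uwContMap_const 0
  | insert i s hi ih =>
    simp_rw [Finset.sum_insert hi]
    exact (hK i).add ih

lemma norm_vecFun_le {ξ η : ℕ → H} (hξ : Summable fun i => ‖ξ i‖ ^ 2)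
    (hη : Summable fun i => ‖η i‖ ^ 2) (a : M) :
    ‖vecFun ξ η a‖ ≤ (∑' i, ‖ξ i‖ * ‖η i‖) * ‖a‖ := by
  rw [mul_comm, ← tsum_mul_left]
  exact tsum_of_norm_bounded ((summable_norm_mul_norm hξ hη).mul_left ‖a‖).hasSum
    fun i => norm_inner_apply_le a (ξ i) (η i)

/-- The ultraweak topology is coarser than the norm topology. -/
lemma UWCont.continuous {f : M → ℂ} (hf : UWCont f) : Continuous f := by
  refine continuous_le_dom ?_ hf
  refine le_iInf fun ξ => le_iInf fun η => le_iInf fun hξ => le_iInf fun hη => ?_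
  rw [← continuous_iff_le_induced]
  let F : M →ₗ[ℂ] ℂ :=
    { toFun := vecFun ξ η, map_add' := vecFun_add hξ hη, map_smul' := vecFun_smul ξ η }
  exact (F.mkContinuous _ (norm_vecFun_le hξ hη)).continuous

/-- The single-vector functionals `a ↦ ⟪x, a y⟫` are ultraweakly continuous. -/
lemma uwCont_inner (x y : H) : UWCont (M := M) fun a => ⟪x, (a : H →L[ℂ] H) y⟫_ℂ := by
  have hs : ∀ z : H, Summable fun i : ℕ => ‖(Pi.single 0 z : ℕ → H) i‖ ^ 2 := fun z =>
    summable_of_ne_finset_zero (s := {0}) fun i hi => by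
      simp [Pi.single_eq_of_ne (Finset.notMem_singleton.1 hi)]
  have := uwCont_vecFun (M := M) (hs x) (hs y)
  convert this using 2 with a
  rw [vecFun, tsum_eq_single 0 fun i hi => by simp [Pi.single_eq_of_ne hi]]
  simp

/-- The closed balls of `M` are ultraweakly compact. -/
theorem isCompact_closedBall_ultraweak (r : ℝ) :
    @IsCompact M (ultraweak M) (Metric.closedBall 0 r) := by
  refine (@isCompact_iff_ultrafilter_le_nhds M (ultraweak M) _).2 fun U hU => ?_
  have hU' : ∀ᶠ a in (U : Filter M), ‖a‖ ≤ r := by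
    filter_upwards [Filter.le_principal_iff.1 hU] with a ha
    simpa using mem_closedBall_zero_iff.1 ha
  have hr : 0 ≤ r := by
    obtain ⟨a, ha⟩ := hU'.exists
    exact (norm_nonneg a).trans ha
  -- the matrix coefficients are bounded, so they converge along the ultrafilter
  have hlim : ∀ x y : H, ∃ B : ℂ, Filter.Tendsto
      (fun a : M => ⟪x, (a : H →L[ℂ] H) y⟫_ℂ) U (nhds B) := by
    intro x y
    have hc : IsCompact (Metric.closedBall (0 : ℂ) (r * (‖x‖ * ‖y‖))) := isCompact_closedBall _ _
    obtain ⟨B, -, hB⟩ := isCompact_iff_ultrafilter_le_nhds.1 hc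
      (U.map fun a : M => ⟪x, (a : H →L[ℂ] H) y⟫_ℂ) (by
        rw [Filter.le_principal_iff]
        change ∀ᶠ a : M in (U : Filter M), ⟪x, (a : H →L[ℂ] H) y⟫_ℂ ∈ Metric.closedBall (0 : ℂ) _
        filter_upwards [hU'] with a ha
        rw [mem_closedBall_zero_iff]
        exact (norm_inner_apply_le a x y).trans (by gcongr))
    exact ⟨B, hB⟩
  choose B hB using hlim
  have hBn : ∀ x y, ‖B x y‖ ≤ r * ‖x‖ * ‖y‖ := fun x y => by
    refine le_of_tendsto (hB x y).norm ?_
    filter_upwards [hU'] with a ha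
    exact (norm_inner_apply_le a x y).trans (by rw [mul_assoc]; gcongr)
  let Bl : H →L⋆[ℂ] H →L[ℂ] ℂ := LinearMap.mkContinuous₂
    (LinearMap.mk₂'ₛₗ (starRingEnd ℂ) (RingHom.id ℂ) B
      (fun x x' y => tendsto_nhds_unique (hB _ _) (by
        simpa only [inner_add_left] using (hB x y).add (hB x' y)))
      (fun c x y => tendsto_nhds_unique (hB _ _) (by
        simpa only [inner_smul_left, smul_eq_mul] using (hB x y).const_mul (starRingEnd ℂ c)))
      (fun x y y' => tendsto_nhds_unique (hB _ _) (by
        simpa only [map_add, inner_add_right] using (hB x y).add (hB x y')))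
      (fun c x y => tendsto_nhds_unique (hB _ _) (by
        simpa only [map_smul, inner_smul_right, smul_eq_mul, RingHom.id_apply] using
          (hB x y).const_mul c))) r hBn
  -- the operator with `⟪x, T y⟫ = B x y`
  let T : H →L[ℂ] H := ContinuousLinearMap.adjoint (InnerProductSpace.continuousLinearMapOfBilin Bl)
  have hT : ∀ x y, ⟪x, T y⟫_ℂ = B x y := fun x y => by
    rw [ContinuousLinearMap.adjoint_inner_right,
      InnerProductSpace.continuousLinearMapOfBilin_apply]
    rfl
  have hTn : ‖T‖ ≤ r := by
    refine T.opNorm_le_bound hr fun y => ?_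
    by_cases h0 : T y = 0
    · rw [h0, norm_zero]; positivity
    have h1 := hBn (T y) y
    rw [← hT, inner_self_eq_norm_sq_to_K] at h1
    have h2 : ‖T y‖ * ‖T y‖ ≤ ‖T y‖ * (r * ‖y‖) := by
      have : ‖((‖T y‖ : ℂ)) ^ 2‖ = ‖T y‖ ^ 2 := by simp
      have h1' : ‖T y‖ ^ 2 ≤ r * ‖T y‖ * ‖y‖ := this ▸ h1
      nlinarith
    exact le_of_mul_le_mul_left h2 (norm_pos_iff.2 h0)
  have hTM : T ∈ M := by
    refine mem_of_commute_commutant fun c hc => ?_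
    refine ContinuousLinearMap.ext fun y => ext_inner_left ℂ fun x => ?_
    change ⟪x, c (T y)⟫_ℂ = ⟪x, T (c y)⟫_ℂ
    rw [← ContinuousLinearMap.adjoint_inner_left, hT, hT]
    refine tendsto_nhds_unique (hB _ _) ((hB x (c y)).congr fun a => ?_)
    rw [ContinuousLinearMap.adjoint_inner_left]
    have := VonNeumannAlgebra.mem_commutant_iff.1 hc a a.2
    exact congrArg (fun S : H →L[ℂ] H => ⟪x, S y⟫_ℂ) this
  refine ⟨⟨T, hTM⟩, mem_closedBall_zero_iff.2 hTn, ?_⟩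
  unfold ultraweak
  simp only [nhds_iInf, nhds_induced, le_iInf_iff]
  intro ξ η hξ hη
  refine Filter.tendsto_iff_comap.1 ?_
  refine tendsto_tsum_of_dominated_convergence ((summable_norm_mul_norm hξ hη).mul_left r)
    (fun i => ?_) ?_
  · simpa only [hT] using hB (ξ i) (η i)
  · filter_upwards [hU'] with a ha i
    exact (norm_inner_apply_le a (ξ i) (η i)).trans (by gcongr)

/-! ### Comparison of projections -/

lemma isStarProjection_nonneg {e : M} (he : IsStarProjection e) : 0 ≤ e := by
  have : star e * e = e := by rw [he.isSelfAdjoint.star_eq, he.isIdempotentElem.eq]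
  exact this ▸ star_mul_self_nonneg e

lemma isStarProjection_le_one {e : M} (he : IsStarProjection e) : e ≤ 1 :=
  sub_nonneg.1 (isStarProjection_nonneg he.one_sub)

/-- `a ↦ (⟪x, a y⟫)_{x, y}`, which identifies the ultraweakly compact subsets of `M` with compact
sets in a locally convex space. -/
def matrixCoeff (M : VonNeumannAlgebra H) : M →ₗ[ℝ] (H → H → ℂ) where
  toFun a x y := ⟪x, (a : H →L[ℂ] H) y⟫_ℂ
  map_add' a b := by ext; simp
  map_smul' c a := by
    ext x y
    change ⟪x, ((c • (a : H →L[ℂ] H)) y : H)⟫_ℂ = c • ⟪x, (a : H →L[ℂ] H) y⟫_ℂ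
    rw [smul_apply, inner_smul_right_eq_smul]

lemma matrixCoeff_injective : Function.Injective (matrixCoeff M) := fun a b h => by
  refine Subtype.ext (ContinuousLinearMap.ext fun y => ext_inner_left ℂ fun x => ?_)
  exact congrFun (congrFun h x) y

lemma continuous_matrixCoeff :
    @Continuous M (H → H → ℂ) (ultraweak M) inferInstance (matrixCoeff M) := by
  let := ultraweak M
  exact continuous_pi fun x => continuous_pi fun y => uwCont_inner x y

lemma isClosed_eq_ultraweak {K L : M → M} (hK : UWContMap K) (hL : UWContMap L) :
    @IsClosed M (ultraweak M) {a | K a = L a} := by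
  have : {a | K a = L a} = {a | matrixCoeff M (K a) = matrixCoeff M (L a)} := by
    ext a; exact matrixCoeff_injective.eq_iff.symm
  rw [this]
  let := ultraweak M
  exact isClosed_eq (continuous_matrixCoeff.comp hK) (continuous_matrixCoeff.comp hL)

/-- A convex form of the Krein–Milman theorem: a nonempty ultraweakly compact set has a point
which is not the midpoint of a nontrivial segment. -/
lemma exists_extreme_ultraweak {K : Set M} (hK : @IsCompact M (ultraweak M) K) (hne : K.Nonempty) :
    ∃ v ∈ K, ∀ d, v + d ∈ K → v - d ∈ K → d = 0 := by
  have hc : IsCompact (matrixCoeff M '' K) :=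
    @IsCompact.image _ _ (ultraweak M) _ _ _ hK continuous_matrixCoeff
  obtain ⟨_, ⟨v, hv, rfl⟩, hext⟩ := hc.extremePoints_nonempty (hne.image _)
  refine ⟨v, hv, fun d h1 h2 => ?_⟩
  have h3 := hext (Set.mem_image_of_mem _ h1) (Set.mem_image_of_mem _ h2) (by
    refine ⟨1 / 2, 1 / 2, by norm_num, by norm_num, by norm_num, ?_⟩
    rw [map_add, map_sub]
    module)
  have h4 : v + d = v := matrixCoeff_injective h3
  simpa using h4

lemma norm_le_of_star_mul_self_le {a : M} {r : ℝ} (hr : 0 ≤ r)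
    (h : star a * a ≤ algebraMap ℝ M (r ^ 2)) : ‖a‖ ≤ r := by
  have h1 := (CStarAlgebra.norm_le_iff_le_algebraMap (star a * a) (by positivity)
    (star_mul_self_nonneg a)).2 h
  rw [CStarRing.norm_star_mul_self] at h1
  nlinarith [norm_nonneg a]

/-- With `s = 1 - v* v`, both `v (1 + s / 2)` and `v (1 - s / 2)` are contractions if `v` is; the
estimates are multiplied by two. At an extreme point of the unit ball this forces `v s = 0`. -/
lemma norm_perturb_contraction {v : M} (hv1 : ‖v‖ ≤ 1) :
    ‖(2 : M) * v + v * (1 - star v * v)‖ ≤ 2 ∧ ‖(2 : M) * v - v * (1 - star v * v)‖ ≤ 2 := by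
  have hc0 : 0 ≤ star v * v := star_mul_self_nonneg v
  have hcn : ‖star v * v‖ ≤ 1 := by
    rw [CStarRing.norm_star_mul_self]; nlinarith [norm_nonneg v]
  have hc1 : star v * v ≤ 1 := (CStarAlgebra.norm_le_one_iff_of_nonneg _ hc0).1 hcn
  obtain ⟨s, hs⟩ : ∃ s, s = 1 - star v * v := ⟨_, rfl⟩
  have hs0 : 0 ≤ s := hs ▸ sub_nonneg.2 hc1
  have hss : star s = s := hs0.isSelfAdjoint.star_eq
  have hc : star v * v = 1 - s := by simp [hs]
  have h1norm : ‖(1 : M)‖ ≤ 1 :=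
    (CStarAlgebra.norm_le_one_iff_of_nonneg (1 : M) zero_le_one).2 le_rfl
  rw [← hs]
  constructor
  · refine norm_le_of_star_mul_self_le (by norm_num) ?_
    have e1 : star ((2 : M) * v + v * s) * ((2 : M) * v + v * s)
        = (2 + s) * (star v * v) * (2 + s) := by
      simp only [star_add, star_mul, star_ofNat, hss]; noncomm_ring
    have e2 : algebraMap ℝ M (2 ^ 2) - (2 + s) * (1 - s) * (2 + s)
        = s * s + s * s + s * s + s * s * s := by
      rw [show algebraMap ℝ M (2 ^ 2) = (1 + 1) * (1 + 1) by rw [map_pow, map_ofNat]; norm_num,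
        show (2 : M) = 1 + 1 by norm_num]
      noncomm_ring
    rw [e1, hc, ← sub_nonneg, e2]
    have p2 : 0 ≤ s * s := by simpa [hss] using star_mul_self_nonneg s
    have p3 : 0 ≤ s * s * s := by simpa [hss] using star_left_conjugate_nonneg hs0 s
    exact add_nonneg (add_nonneg (add_nonneg p2 p2) p2) p3
  · have : (2 : M) * v - v * s = v * (1 + star v * v) := by rw [hs]; noncomm_ring
    rw [this]
    calc ‖v * (1 + star v * v)‖ ≤ ‖v‖ * ‖1 + star v * v‖ := norm_mul_le _ _
      _ ≤ 1 * (1 + 1) := by gcongr; exact (norm_add_le _ _).trans (add_le_add h1norm hcn)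
      _ = 2 := by norm_num

/-- If `w` is a contraction supported on a projection `q` with `v* v + q ≤ 1`, and the ranges of `v`
and `w` are orthogonal, then `v + w` is a contraction. -/
lemma norm_add_le_one_of_orthogonal {v w q : M} (hq : IsStarProjection q)
    (hle : star v * v + q ≤ 1) (hwq : w * q = w) (hvw : star v * w = 0) (hw : ‖w‖ ≤ 1) :
    ‖v + w‖ ≤ 1 := by
  have hwv : star w * v = 0 := by simpa using congrArg star hvw
  refine norm_le_of_star_mul_self_le zero_le_one ?_
  have e1 : star (v + w) * (v + w) = star v * v + star w * w := by
    rw [star_add, add_mul, mul_add, mul_add, hvw, hwv, add_zero, zero_add]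
  have e2 : star w * w ≤ q := by
    have e3 : star w * w = star q * (star w * w) * q := by
      rw [mul_assoc, mul_assoc, hwq, ← mul_assoc, ← star_mul, hwq]
    rw [e3]
    refine (CStarAlgebra.star_left_conjugate_le_norm_smul
      (hb := (star_mul_self_nonneg _).isSelfAdjoint)).trans ?_
    rw [CStarRing.norm_star_mul_self, hq.isSelfAdjoint.star_eq, hq.isIdempotentElem.eq]
    exact smul_le_of_le_one_left (isStarProjection_nonneg hq) (by nlinarith [norm_nonneg w])
  rw [e1, one_pow, map_one]
  exact (add_le_add_right e2 _).trans hle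

/-- Between two projections there is a maximal partial isometry: an extreme point of the unit ball
of `f M e`. -/
theorem exists_maximal_partialIsometry {e f : M} (he : IsStarProjection e)
    (hf : IsStarProjection f) : ∃ v : M, f * v = v ∧ v * e = v ∧ IsIdempotentElem (star v * v) ∧
      ∀ y, (f - v * star v) * y * (e - star v * v) = 0 := by
  let K : Set M := Metric.closedBall 0 1 ∩ ({x | f * x = x} ∩ {x | x * e = x})
  have hid : UWContMap fun m : M => m := by simpa using uwContMap_mul_left (1 : M)
  have hK : @IsCompact M (ultraweak M) K :=
    @IsCompact.inter_right M (ultraweak M) _ _ (isCompact_closedBall_ultraweak 1)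
      (@IsClosed.inter M _ _ (ultraweak M) (isClosed_eq_ultraweak (uwContMap_mul_left f) hid)
      (isClosed_eq_ultraweak (uwContMap_mul_right e) hid))
  obtain ⟨v, ⟨hv1, hfv, hve⟩, hext⟩ := exists_extreme_ultraweak hK ⟨0, by simp [K]⟩
  rw [mem_closedBall_zero_iff] at hv1
  change f * v = v at hfv
  change v * e = v at hve
  have hmem : ∀ {d : M}, f * d = d → d * e = d → ‖v + d‖ ≤ 1 → ‖v - d‖ ≤ 1 → d = 0 := by
    intro d h1 h2 h3 h4
    refine hext d ⟨by simpa using h3, ?_, ?_⟩ ⟨by simpa using h4, ?_, ?_⟩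
    · exact (mul_add _ _ _).trans (by rw [hfv, h1])
    · exact (add_mul _ _ _).trans (by rw [hve, h2])
    · exact (mul_sub _ _ _).trans (by rw [hfv, h1])
    · exact (sub_mul _ _ _).trans (by rw [hve, h2])
  have hev : e * star v = star v := by
    simpa [he.isSelfAdjoint.star_eq] using congrArg star hve
  obtain ⟨c, hc⟩ : ∃ c, c = star v * v := ⟨_, rfl⟩
  have hcs : star c = c := by rw [hc]; simp
  have hce : c * e = c := by rw [hc, mul_assoc, hve]
  have hec : e * c = c := by rw [hc, ← mul_assoc, hev]
  have hvs : v * (1 - c) = 0 := by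
    obtain ⟨hn1, hn2⟩ := norm_perturb_contraction hv1
    rw [← hc] at hn1 hn2
    have h0 : (1 / 2 : ℝ) • (v * (1 - c)) = 0 := by
      have half : ∀ x : M, ‖x‖ ≤ 2 → ‖(1 / 2 : ℝ) • x‖ ≤ 1 := fun x hx => by
        rw [norm_smul, Real.norm_eq_abs, abs_of_pos (by norm_num)]; linarith
      refine hmem ?_ ?_ ?_ ?_
      · rw [mul_smul_comm, ← mul_assoc, hfv]
      · rw [smul_mul_assoc, mul_assoc, sub_mul, hce, one_mul, mul_sub, hve, mul_sub, mul_one]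
      · convert half _ hn1 using 2
        rw [two_mul]; module
      · convert half _ hn2 using 2
        rw [two_mul]; module
    simpa using h0
  have hvc : v * c = v := by
    rw [mul_sub, mul_one, sub_eq_zero] at hvs; exact hvs.symm
  have hcc : c * c = c := by
    nth_rw 1 [hc]; rw [mul_assoc, hvc, ← hc]
  refine ⟨v, hfv, hve, by rw [← hc]; exact hcc, fun y => ?_⟩
  rw [← hc]
  obtain ⟨q, hq⟩ : ∃ q, q = e - c := ⟨_, rfl⟩
  have hqp : IsStarProjection q := by
    refine ⟨?_, ?_⟩
    · rw [IsIdempotentElem, hq, sub_mul, mul_sub, mul_sub, he.isIdempotentElem.eq, hce, hec, hcc]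
      abel
    · rw [IsSelfAdjoint, hq, star_sub, he.isSelfAdjoint.star_eq, hcs]
  rw [← hq]
  obtain ⟨w, hw⟩ : ∃ w, w = (f - v * star v) * y * q := ⟨_, rfl⟩
  have hwq : w * q = w := by rw [hw, mul_assoc, hqp.isIdempotentElem.eq]
  have hvw : star v * w = 0 := by
    have h1 : star v * f = star v := by
      simpa [hf.isSelfAdjoint.star_eq] using congrArg star hfv
    have h3 : c * star v = star v := by simpa [hcs] using congrArg star hvc
    rw [hw, ← mul_assoc, ← mul_assoc, mul_sub, h1, ← mul_assoc, ← hc, h3, sub_self, zero_mul,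
      zero_mul]
  obtain ⟨t, ht, htw⟩ : ∃ t : ℝ, t ≠ 0 ∧ ‖t • w‖ ≤ 1 := by
    refine ⟨(‖w‖ + 1)⁻¹, by positivity, ?_⟩
    rw [norm_smul, norm_inv, Real.norm_eq_abs, abs_of_pos (by positivity)]
    exact inv_mul_le_one_of_le₀ (by linarith) (by positivity)
  have hbound : ∀ r : ℝ, ‖r • w‖ ≤ 1 → ‖v + r • w‖ ≤ 1 := fun r hr =>
    norm_add_le_one_of_orthogonal hqp (by
      rw [← hc, hq, add_sub_cancel]; exact isStarProjection_le_one he)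
      (by rw [smul_mul_assoc, hwq]) (by rw [mul_smul_comm, hvw, smul_zero]) hr
  rw [← hw]
  have := hmem (d := t • w) ?_ ?_ (hbound t htw) ?_
  · simpa [ht] using this
  · rw [mul_smul_comm, hw, ← mul_assoc, ← mul_assoc, mul_sub, hf.isIdempotentElem.eq, ← mul_assoc,
      hfv]
  · rw [smul_mul_assoc, hw, mul_assoc, hq, sub_mul e c e, he.isIdempotentElem.eq, hce]
  · rw [sub_eq_add_neg, ← neg_smul]
    exact hbound (-t) (by simpa using htw)

/-! ### Minimal central projections -/

/-- The orthogonal projection onto the closed span of `S`. -/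
def closedSpanProj (S : Set H) : H →L[ℂ] H :=
  haveI : CompleteSpace (Submodule.span ℂ S).topologicalClosure :=
    (Submodule.isClosed_topologicalClosure _).completeSpace_coe
  (Submodule.span ℂ S).topologicalClosure.starProjection

lemma isStarProjection_closedSpanProj (S : Set H) : IsStarProjection (closedSpanProj S) :=
  isStarProjection_starProjection

lemma range_closedSpanProj (S : Set H) :
    (closedSpanProj S).range = (Submodule.span ℂ S).topologicalClosure :=
  Submodule.range_starProjection _

lemma closedSpanProj_apply {S : Set H} {x : H} (hx : x ∈ S) : closedSpanProj S x = x := by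
  have : CompleteSpace (Submodule.span ℂ S).topologicalClosure :=
    (Submodule.isClosed_topologicalClosure _).completeSpace_coe
  exact Submodule.starProjection_eq_self_iff.2
    (Submodule.le_topologicalClosure _ (Submodule.subset_span hx))

lemma mul_closedSpanProj {S : Set H} {x y : H →L[ℂ] H} (h : ∀ s ∈ S, x s = y s) :
    x * closedSpanProj S = y * closedSpanProj S := by
  have h2 : (Submodule.span ℂ S).topologicalClosure ≤
      LinearMap.ker ((x - y : H →L[ℂ] H) : H →ₗ[ℂ] H) :=
    Submodule.topologicalClosure_minimal _
      (Submodule.span_le.2 fun s hs => by simp [h s hs]) (x - y).isClosed_ker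
  ext z
  have h3 := h2 (range_closedSpanProj S ▸ LinearMap.mem_range_self _ z)
  simpa [sub_eq_zero] using h3

lemma closedSpanProj_mem {S : Set H} (W : VonNeumannAlgebra H)
    (hS : ∀ y ∈ W.commutant, ∀ s ∈ S, y s ∈ S) : closedSpanProj S ∈ W := by
  refine mem_of_commute_commutant fun y hy => ?_
  have h1 : ∀ y ∈ W.commutant, y * closedSpanProj S
      = closedSpanProj S * y * closedSpanProj S := fun y hy =>
    mul_closedSpanProj fun s hs => (closedSpanProj_apply (hS y hy s hs)).symm
  have h2 := congrArg star (h1 (star y) (star_mem hy))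
  simp only [star_mul, star_star, (isStarProjection_closedSpanProj S).isSelfAdjoint.star_eq] at h2
  exact (h1 y hy).trans ((mul_assoc _ _ _).trans h2.symm)

/-- A minimal nonzero central projection of `M`. -/
structure IsMinimalCentral (z : M) : Prop where
  isStarProjection : IsStarProjection z
  comm : ∀ a, z * a = a * z
  ne_zero : z ≠ 0
  eq_zero_or_eq : ∀ q : M, IsStarProjection q → (∀ a, q * a = a * q) → z * q = q → q = 0 ∨ q = z

/-- The summand of `M` cut out by a minimal central projection is a prime ring. -/
lemma IsMinimalCentral.prime {z : M} (hz : IsMinimalCentral z) {a b : M}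
    (h : ∀ m, a * m * b = 0) : z * a = 0 ∨ z * b = 0 := by
  let S : Set H := {x | ∃ (m : M) (y : H), x = (m : H →L[ℂ] H) ((b : H →L[ℂ] H) y)}
  let q₀ := closedSpanProj S
  have hq : q₀ ∈ M := by
    refine closedSpanProj_mem M ?_
    rintro c hc _ ⟨m, y, rfl⟩
    refine ⟨m, c y, ?_⟩
    have h1 := VonNeumannAlgebra.mem_commutant_iff.1 hc _ m.2
    have h2 := VonNeumannAlgebra.mem_commutant_iff.1 hc _ b.2
    have e1 := congrArg (fun T : H →L[ℂ] H => T ((b : H →L[ℂ] H) y)) h1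
    have e2 := congrArg (fun T : H →L[ℂ] H => (m : H →L[ℂ] H) (T y)) h2
    exact (e2.trans e1).symm
  have hq' : q₀ ∈ M.commutant := by
    refine closedSpanProj_mem M.commutant ?_
    rw [M.commutant_commutant]
    rintro c hc _ ⟨m, y, rfl⟩
    exact ⟨⟨c, hc⟩ * m, y, rfl⟩
  let q : M := ⟨q₀, hq⟩
  have hqp : IsStarProjection q := by
    have := isStarProjection_closedSpanProj S
    exact ⟨Subtype.ext this.isIdempotentElem, Subtype.ext this.isSelfAdjoint⟩
  have hqc : ∀ a, q * a = a * q := fun a =>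
    Subtype.ext (VonNeumannAlgebra.mem_commutant_iff.1 hq' a a.2).symm
  have hqb : q * b = b := Subtype.ext (ContinuousLinearMap.ext fun y =>
    closedSpanProj_apply ⟨1, y, rfl⟩)
  have haq : a * q = 0 := by
    refine Subtype.ext ?_
    change (a : H →L[ℂ] H) * closedSpanProj S = 0
    rw [← zero_mul (closedSpanProj S)]
    refine mul_closedSpanProj ?_
    rintro _ ⟨m, y, rfl⟩
    exact congrArg (fun T : M => (T : H →L[ℂ] H) y) (h m)
  have hz' := hz.isStarProjection
  have h1 : z * z = z := hz'.isIdempotentElem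
  have h2 : IsStarProjection (z * q) := by
    refine ⟨?_, ?_⟩
    · rw [IsIdempotentElem, mul_assoc, ← mul_assoc q z q, hqc z, mul_assoc z q q,
        hqp.isIdempotentElem.eq, ← mul_assoc, h1]
    · rw [IsSelfAdjoint, star_mul, hqp.isSelfAdjoint.star_eq, hz'.isSelfAdjoint.star_eq, hqc]
  rcases hz.eq_zero_or_eq (z * q) h2 (fun c => by rw [mul_assoc, hqc, ← mul_assoc, hz.comm,
    mul_assoc]) (by rw [← mul_assoc, h1]) with h3 | h3
  · right
    rw [← hqb, ← mul_assoc, h3, zero_mul]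
  · left
    rw [← h3, mul_assoc, hqc, haq, mul_zero]

/-- Comparison theorem below a minimal central projection. -/
lemma IsMinimalCentral.comparison {z e f : M} (hz : IsMinimalCentral z) (he : IsStarProjection e)
    (hf : IsStarProjection f) (hze : z * e = e) (hzf : z * f = f) :
    (∃ v : M, star v * v = e ∧ f * v = v) ∨ ∃ v : M, star v * v = f ∧ e * v = v := by
  obtain ⟨v, hfv, hve, -, h⟩ := exists_maximal_partialIsometry he hf
  have hzv : z * v = v := by rw [← hfv, ← mul_assoc, hzf]
  rcases hz.prime h with h1 | h1
  · right
    refine ⟨star v, ?_, ?_⟩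
    · rw [mul_sub, hzf, ← mul_assoc, hzv, sub_eq_zero] at h1
      rw [star_star, h1]
    · simpa [he.isSelfAdjoint.star_eq] using congrArg star hve
  · left
    refine ⟨v, ?_, hfv⟩
    rw [mul_sub, hze, ← mul_assoc, hz.comm, mul_assoc, hzv, sub_eq_zero] at h1
    exact h1.symm

/-! ### Averaging -/

/-- The range projection of a self-adjoint element. -/
lemma exists_range_projection (b : M) : ∃ e : M, IsStarProjection e ∧ e * b = b ∧
    ∀ x y : M, x * b = y * b → x * e = y * e := by
  let S : Set H := Set.range (b : H →L[ℂ] H)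
  have heM : closedSpanProj S ∈ M := by
    refine closedSpanProj_mem M ?_
    rintro y hy _ ⟨x, rfl⟩
    exact ⟨y x, congrArg (fun T : H →L[ℂ] H => T x)
      (VonNeumannAlgebra.mem_commutant_iff.1 hy _ b.2)⟩
  have hS := isStarProjection_closedSpanProj S
  refine ⟨⟨closedSpanProj S, heM⟩, ⟨Subtype.ext hS.isIdempotentElem, Subtype.ext hS.isSelfAdjoint⟩,
    Subtype.ext (ContinuousLinearMap.ext fun y => closedSpanProj_apply ⟨y, rfl⟩), ?_⟩
  refine fun x y hx => Subtype.ext (mul_closedSpanProj ?_)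
  rintro _ ⟨y, rfl⟩
  exact congrArg (fun T : M => (T : H →L[ℂ] H) y) hx

/-- Jordan decomposition, inside the left annihilator of `1 - z`. -/
lemma exists_posPart_negPart {z d : M} (hd : IsSelfAdjoint d) (hzd : z * d = d) :
    ∃ b c : M, 0 ≤ b ∧ 0 ≤ c ∧ b - c = d ∧ c * b = 0 ∧ z * b = b ∧ z * c = c := by
  obtain ⟨b, hb⟩ : ∃ b, b = d⁺ := ⟨_, rfl⟩
  obtain ⟨c, hc⟩ : ∃ c, c = d⁻ := ⟨_, rfl⟩
  have hb0 : 0 ≤ b := hb ▸ CFC.posPart_nonneg d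
  have hc0 : 0 ≤ c := hc ▸ CFC.negPart_nonneg d
  have hbc : b - c = d := by rw [hb, hc]; exact CFC.posPart_sub_negPart d hd
  have hcb : c * b = 0 := by rw [hb, hc]; exact CFC.negPart_mul_posPart d
  have hzb : z * b = b := by
    have h1 : (1 - z) * (b * b) = 0 := by
      have : b * b = d * b := by rw [← hbc, sub_mul, hcb, sub_zero]
      rw [this, ← mul_assoc, sub_mul, hzd, one_mul, sub_self, zero_mul]
    have h2 : ((1 - z) * b) * star ((1 - z) * b) = 0 := by
      rw [star_mul, ← mul_assoc, hb0.isSelfAdjoint.star_eq, mul_assoc (1 - z) b b, h1, zero_mul]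
    have h3 := CStarRing.mul_star_self_eq_zero_iff _ |>.1 h2
    rw [sub_mul, one_mul, sub_eq_zero] at h3
    exact h3.symm
  have hzc' : z * c = c := by
    have : c = b - d := by rw [← hbc]; abel
    rw [this, mul_sub, hzb, hzd]
  exact ⟨b, c, hb0, hc0, hbc, hcb, hzb, hzc'⟩

/-- Spectral cut of a self-adjoint element at the level `μ`: `e` is the range projection of
`(a - μ z)⁺`. -/
lemma exists_spectral_cut {z a : M} (hz : IsStarProjection z) (hzc : ∀ a, z * a = a * z) {m μ l : ℝ}
    (hml : m • z ≤ a) (hal : a ≤ l • z) (hza : z * a = a) : ∃ e f : M, IsStarProjection e ∧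
      IsStarProjection f ∧ e + f = z ∧ e * f = 0 ∧ a ≤ l • e + μ • f ∧ μ • e + m • f ≤ a := by
  have hzs : IsSelfAdjoint z := hz.isSelfAdjoint
  have hzz : z * z = z := hz.isIdempotentElem
  have hsa : ∀ r : ℝ, IsSelfAdjoint (r • z) := fun r => (IsSelfAdjoint.all r).smul hzs
  have ha : IsSelfAdjoint a := by
    have := (sub_nonneg.2 hml).isSelfAdjoint.add (hsa m)
    rwa [sub_add_cancel] at this
  obtain ⟨d, hd⟩ : ∃ d, d = a - μ • z := ⟨_, rfl⟩
  have hds : IsSelfAdjoint d := hd ▸ ha.sub (hsa μ)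
  have hzd : z * d = d := by rw [hd, mul_sub, hza, mul_smul_comm, hzz]
  obtain ⟨b, c, hb0, hc0, hbc, hcb, hzb, hzc'⟩ := exists_posPart_negPart hds hzd
  have hbs : star b = b := hb0.isSelfAdjoint.star_eq
  have hcs : star c = c := hc0.isSelfAdjoint.star_eq
  obtain ⟨e, hep, heb, hkill⟩ := exists_range_projection b
  have hce : c * e = 0 := by
    have := hkill c 0 (by rw [hcb, zero_mul])
    rwa [zero_mul] at this
  have hze : z * e = e := by
    have := hkill z 1 (by rw [hzb, one_mul])
    rwa [one_mul] at this
  have hes : star e = e := hep.isSelfAdjoint.star_eq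
  have hee : e * e = e := hep.isIdempotentElem
  have hez : e * z = e := by rw [← hzc, hze]
  have hbe : b * e = b := by
    have := congrArg star heb
    rwa [star_mul, hes, hbs] at this
  have hec : e * c = 0 := by
    have := congrArg star hce
    rwa [star_mul, hes, hcs, star_zero] at this
  obtain ⟨f, hf⟩ : ∃ f, f = z - e := ⟨_, rfl⟩
  have hfp : IsStarProjection f := by
    refine ⟨?_, ?_⟩
    · rw [IsIdempotentElem, hf, sub_mul, mul_sub, mul_sub, hzz, hze, hez, hee]; abel
    · rw [hf]; exact hzs.sub hep.isSelfAdjoint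
  have hfs : star f = f := hfp.isSelfAdjoint.star_eq
  have hff : f * f = f := hfp.isIdempotentElem
  have hfc : f * c = c := by rw [hf, sub_mul, hzc', hec, sub_zero]
  have hcf : c * f = c := by
    have := congrArg star hfc
    rwa [star_mul, hfs, hcs] at this
  have hfb : f * b = 0 := by rw [hf, sub_mul, hzb, heb, sub_self]
  have hfz : f * z = f := by rw [hf, sub_mul, hzz, hez]
  have hzf : z = e + f := by rw [hf]; abel
  have hadd : a = μ • (e + f) + (b - c) := by rw [hbc, hd, ← hzf]; abel
  have hb1 : b ≤ (l - μ) • e := by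
    have h1 : star e * d * e ≤ star e * ((l - μ) • z) * e :=
      star_left_conjugate_le_conjugate (by rw [hd, sub_smul]; exact sub_le_sub_right hal _) e
    have h2 : star e * d * e = b := by
      rw [hes, ← hbc, mul_sub, heb, hec, sub_zero, hbe]
    have h3 : star e * ((l - μ) • z) * e = (l - μ) • e := by
      rw [hes, mul_smul_comm, smul_mul_assoc, hez, hee]
    rwa [h2, h3] at h1
  have hc1 : c ≤ (μ - m) • f := by
    have h1 : star f * ((m - μ) • z) * f ≤ star f * d * f :=
      star_left_conjugate_le_conjugate (by rw [hd, sub_smul]; exact sub_le_sub_right hml _) f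
    have h2 : star f * d * f = -c := by
      rw [hfs, ← hbc, mul_sub, hfb, hfc, zero_sub, neg_mul, hcf]
    have h3 : star f * ((m - μ) • z) * f = -((μ - m) • f) := by
      rw [hfs, mul_smul_comm, smul_mul_assoc, hfz, hff, ← neg_smul, neg_sub]
    rw [h2, h3] at h1
    exact neg_le_neg_iff.1 h1
  refine ⟨e, f, hep, hfp, hzf.symm, by rw [hf, mul_sub, hez, hee, sub_self], ?_, ?_⟩
  · calc a = μ • (e + f) + (b - c) := hadd
      _ ≤ μ • (e + f) + (l - μ) • e := add_le_add_right ((sub_le_self _ hc0).trans hb1) _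
      _ = l • e + μ • f := by module
  · calc μ • e + m • f = μ • (e + f) + -((μ - m) • f) := by module
      _ ≤ μ • (e + f) + (b - c) := by
        refine add_le_add_right ?_ _
        rw [sub_eq_add_neg b c]
        exact le_add_of_nonneg_of_le hb0 (neg_le_neg hc1)
      _ = a := hadd.symm

/-- If `e` is equivalent to a subprojection of `f`, a symmetry exchanging the two moves the large
spectral part `e` of `a` onto a place where `a` is small, so averaging lowers the upper bound. -/
lemma exists_symmetry_average_le {z e f a v : M} (hzc : ∀ a, z * a = a * z)
    (he : IsStarProjection e) (hf : IsStarProjection f) (hef : e + f = z) (hef0 : e * f = 0)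
    (hve : star v * v = e) (hfv : f * v = v) {l μ : ℝ} (hμl : μ ≤ l)
    (ha : a ≤ l • e + μ • f) :
    ∃ u : M, star u = u ∧ u * u = 1 ∧ a + u * a * u ≤ (l + μ) • z := by
  have hes : star e = e := he.isSelfAdjoint.star_eq
  have hee : e * e = e := he.isIdempotentElem
  have hfs : star f = f := hf.isSelfAdjoint.star_eq
  have hev : e * v = 0 := by rw [← hfv, ← mul_assoc, hef0, zero_mul]
  have hv_e : v * e = v := by
    have : star (v - v * e) * (v - v * e) = 0 := by
      have h1 : star (v - v * e) * (v - v * e)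
          = star v * v - star v * v * e - e * (star v * v) + e * (star v * v) * e := by
        rw [star_sub, star_mul, hes]; noncomm_ring
      rw [h1, hve, hee, hee]; abel
    have h3 := CStarRing.star_mul_self_eq_zero_iff _ |>.1 this
    exact (sub_eq_zero.1 h3).symm
  have hvv : v * v = 0 :=
    calc v * v = v * e * v := by rw [hv_e]
      _ = 0 := by rw [mul_assoc, hev, mul_zero]
  have hsvsv : star v * star v = 0 := by simpa using congrArg star hvv
  have hsve : star v * e = 0 := by simpa [hes] using congrArg star hev
  have hesv : e * star v = star v := by simpa [hes] using congrArg star hv_e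
  obtain ⟨g, hg⟩ : ∃ g, g = v * star v := ⟨_, rfl⟩
  have hgs : star g = g := by rw [hg]; simp
  have hgv : g * v = v := by rw [hg, mul_assoc, hve, hv_e]
  have hvg : v * g = 0 := by rw [hg, ← mul_assoc, hvv, zero_mul]
  have hgg : g * g = g := by nth_rw 2 [hg]; rw [← mul_assoc, hgv, ← hg]
  have hge : g * e = 0 := by rw [hg, mul_assoc, hsve, mul_zero]
  have heg : e * g = 0 := by simpa [hes, hgs] using congrArg star hge
  have hfg : f * g = g := by rw [hg, ← mul_assoc, hfv]
  have hgf : g * f = g := by simpa [hfs, hgs] using congrArg star hfg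
  have hsvg : star v * g = star v := by simpa [hgs] using congrArg star hgv
  have hgsv : g * star v = 0 := by simpa [hgs] using congrArg star hvg
  obtain ⟨r, hr⟩ : ∃ r, r = 1 - e - g := ⟨_, rfl⟩
  have hvr : v * r = 0 := by rw [hr, mul_sub, mul_sub, hv_e, hvg]; simp
  have hrv : r * v = 0 := by rw [hr, sub_mul, sub_mul, hev, hgv]; simp
  have hsvr : star v * r = 0 := by rw [hr, mul_sub, mul_sub, hsve, hsvg]; simp
  have hrsv : r * star v = 0 := by rw [hr, sub_mul, sub_mul, hesv, hgsv]; simp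
  have hre : r * e = 0 := by rw [hr, sub_mul, sub_mul, hee, hge]; simp
  have hrr : r * r = r := by
    nth_rw 2 [hr]
    have hrg : r * g = 0 := by rw [hr, sub_mul, sub_mul, heg, hgg]; simp
    rw [mul_sub, mul_sub, hre, hrg]; simp
  have hrs : star r = r := by rw [hr]; simp [hes, hgs]
  obtain ⟨u, hu⟩ : ∃ u, u = v + star v + r := ⟨_, rfl⟩
  have hus : star u = u := by rw [hu, star_add, star_add, star_star, hrs]; abel
  have huu : u * u = 1 := by
    have : u * u = v * v + v * star v + v * r + (star v * v + star v * star v + star v * r)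
        + (r * v + r * star v + r * r) := by rw [hu]; noncomm_ring
    rw [this, hvv, ← hg, hvr, hve, hsvsv, hsvr, hrv, hrsv, hrr, hr]; abel
  have hueu : u * e * u = g := by
    have h1 : u * e = v := by
      rw [hu, add_mul, add_mul, hv_e, hsve, hre, add_zero, add_zero]
    rw [h1, hu, mul_add, mul_add, hvv, ← hg, hvr, zero_add, add_zero]
  have hufu : u * f * u = z - g := by
    have : f = z - e := by rw [← hef]; abel
    rw [this, mul_sub, sub_mul, hueu, ← hzc, mul_assoc, huu, mul_one]
  refine ⟨u, hus, huu, ?_⟩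
  have h1 : u * a * u ≤ l • g + μ • (z - g) := by
    have := star_left_conjugate_le_conjugate ha u
    rw [hus, mul_add, add_mul, mul_smul_comm, mul_smul_comm, smul_mul_assoc, smul_mul_assoc, hueu,
      hufu] at this
    exact this
  have h2 : 0 ≤ f - g := by
    refine isStarProjection_nonneg ⟨?_, ?_⟩
    · rw [IsIdempotentElem, sub_mul, mul_sub, mul_sub, hf.isIdempotentElem.eq, hfg, hgf, hgg]; abel
    · rw [IsSelfAdjoint, star_sub, hfs, hgs]
  have h3 : 0 ≤ (l - μ) • (f - g) := smul_nonneg (sub_nonneg.2 hμl) h2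
  calc a + u * a * u ≤ (l • e + μ • f) + (l • g + μ • (z - g)) := add_le_add ha h1
    _ ≤ (l • e + μ • f) + (l • g + μ • (z - g)) + (l - μ) • (f - g) := le_add_of_nonneg_right h3
    _ = (l + μ) • z := by rw [← hef]; module

/-- `P` is stable under averaging over the two-element group generated by a symmetry `u`. -/
def AverageStable (P : M → Prop) : Prop :=
  ∀ a u : M, star u = u → u * u = 1 → P a → P ((1 / 2 : ℝ) • (a + u * a * u))

/-- One averaging step: cut `a` at the middle `μ` of its spectral interval `[m, l]` and compare the
two spectral projections. Whichever embeds into the other, an average moves one end of the interval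
a quarter of the way. -/
lemma IsMinimalCentral.average_step {z a : M} (hz : IsMinimalCentral z) {P : M → Prop}
    (hP : AverageStable P) (ha : P a) (hza : z * a = a) {m l : ℝ} (hml : m ≤ l) (h1 : m • z ≤ a)
    (h2 : a ≤ l • z) : ∃ (b : M) (m' l' : ℝ), P b ∧ z * b = b ∧ m' ≤ l' ∧ m' • z ≤ b ∧ b ≤ l' • z ∧
      l' - m' = 3 / 4 * (l - m) := by
  obtain ⟨e, f, he, hf, hef, hef0, hae, hfa⟩ :=
    exists_spectral_cut (μ := (m + l) / 2) hz.isStarProjection hz.comm h1 h2 hza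
  have hee : e * e = e := he.isIdempotentElem
  have hff : f * f = f := hf.isIdempotentElem
  have hfe0 : f * e = 0 := by
    simpa [he.isSelfAdjoint.star_eq, hf.isSelfAdjoint.star_eq] using congrArg star hef0
  have hze : z * e = e := by rw [← hef, add_mul, hee, hfe0, add_zero]
  have hzf : z * f = f := by rw [← hef, add_mul, hff, hef0, zero_add]
  have hconj : ∀ (u : M) (r : ℝ), u * u = 1 → u * (r • z) * u = r • z := fun u r huu => by
    rw [mul_smul_comm, smul_mul_assoc, ← hz.comm, mul_assoc, huu, mul_one]
  have hzav : ∀ u : M, z * ((1 / 2 : ℝ) • (a + u * a * u)) = (1 / 2 : ℝ) • (a + u * a * u) := by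
    intro u
    rw [mul_smul_comm, mul_add, hza, ← mul_assoc, ← mul_assoc, hz.comm u, mul_assoc u z a, hza]
  have hhalf : ∀ {x y : M}, x ≤ y → (1 / 2 : ℝ) • x ≤ (1 / 2 : ℝ) • y := fun h =>
    smul_le_smul_of_nonneg_left h (by norm_num)
  rcases hz.comparison he hf hze hzf with ⟨v, hv1, hv2⟩ | ⟨v, hv1, hv2⟩
  · obtain ⟨u, hus, huu, hu⟩ := exists_symmetry_average_le (l := l) (μ := (m + l) / 2) hz.comm he hf
      hef hef0 hv1 hv2 (by linarith) hae
    refine ⟨_, m, (3 * l + m) / 4, hP a u hus huu ha, hzav u, by linarith, ?_, ?_, by ring⟩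
    · have h3 := star_left_conjugate_le_conjugate h1 u
      rw [hus, hconj u m huu] at h3
      calc m • z = (1 / 2 : ℝ) • (m • z + m • z) := by module
        _ ≤ _ := hhalf (add_le_add h1 h3)
    · exact (hhalf hu).trans_eq (by module)
  · obtain ⟨u, hus, huu, hu⟩ := exists_symmetry_average_le (a := -a) (l := -m) (μ := -((m + l) / 2))
      hz.comm hf he (by rw [add_comm, hef]) hfe0 hv1 hv2 (by linarith) (by
        exact (neg_le_neg hfa).trans_eq (by module))
    refine ⟨_, (3 * m + l) / 4, l, hP a u hus huu ha, hzav u, by linarith, ?_, ?_, by ring⟩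
    · rw [mul_neg, neg_mul] at hu
      calc ((3 * m + l) / 4) • z = (1 / 2 : ℝ) • -((-m + -((m + l) / 2)) • z) := by module
        _ ≤ (1 / 2 : ℝ) • -(-a + -(u * a * u)) := hhalf (neg_le_neg hu)
        _ = _ := by module
    · have h3 := star_left_conjugate_le_conjugate h2 u
      rw [hus, hconj u l huu] at h3
      exact (hhalf (add_le_add h2 h3)).trans_eq (by module)

/-- Dixmier averaging below a minimal central projection `z`: averages of a self-adjoint element
come arbitrarily close in norm to a multiple of `z`. -/
theorem IsMinimalCentral.dixmier {z a : M} (hz : IsMinimalCentral z) {P : M → Prop}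
    (hP : AverageStable P) (ha : P a) (has : IsSelfAdjoint a) (hza : z * a = a) {ε : ℝ}
    (hε : 0 < ε) : ∃ (b : M) (r : ℝ), P b ∧ z * b = b ∧ IsSelfAdjoint b ∧ ‖b - r • z‖ ≤ ε := by
  have hzs : star z = z := hz.isStarProjection.isSelfAdjoint.star_eq
  have hzz : z * z = z := hz.isStarProjection.isIdempotentElem
  have hcomp : ∀ r : ℝ, star z * algebraMap ℝ M r * z = r • z := fun r => by
    rw [hzs, Algebra.algebraMap_eq_smul_one, mul_smul_comm, mul_one, smul_mul_assoc, hzz]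
  have hzaz : star z * a * z = a := by rw [hzs, hza, ← hz.comm, hza]
  have key : ∀ n : ℕ, ∃ (b : M) (m l : ℝ), P b ∧ z * b = b ∧ m ≤ l ∧ m • z ≤ b ∧ b ≤ l • z ∧
      l - m = (3 / 4) ^ n * (2 * ‖a‖) := by
    intro n
    induction n with
    | zero =>
      refine ⟨a, -‖a‖, ‖a‖, ha, hza, by linarith [norm_nonneg a], ?_, ?_, by ring⟩
      · have := star_left_conjugate_le_conjugate has.neg_algebraMap_norm_le_self z
        rwa [hzaz, ← map_neg, hcomp] at this
      · have := star_left_conjugate_le_conjugate has.le_algebraMap_norm_self z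
        rwa [hzaz, hcomp] at this
    | succ n ih =>
      obtain ⟨b, m, l, hb, hzb, hml, h1, h2, h3⟩ := ih
      obtain ⟨b', m', l', hb', hzb', hml', h1', h2', h3'⟩ := hz.average_step hP hb hzb hml h1 h2
      exact ⟨b', m', l', hb', hzb', hml', h1', h2', by rw [h3', h3, pow_succ]; ring⟩
  obtain ⟨n, hn⟩ := exists_pow_lt_of_lt_one (y := 3 / 4) (x := ε / (2 * ‖a‖ + 1)) (by positivity)
    (by norm_num)
  obtain ⟨b, m, l, hb, hzb, hml, h1, h2, h3⟩ := key n
  have h0 : 0 ≤ b - m • z := sub_nonneg.2 h1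
  refine ⟨b, m, hb, hzb, ?_, ?_⟩
  · have := h0.isSelfAdjoint.add
      ((IsSelfAdjoint.all m).smul hz.isStarProjection.isSelfAdjoint)
    rwa [sub_add_cancel] at this
  · have h4 : b - m • z ≤ algebraMap ℝ M (l - m) := by
      rw [Algebra.algebraMap_eq_smul_one]
      calc b - m • z ≤ l • z - m • z := by gcongr
        _ = (l - m) • z := by rw [sub_smul]
        _ ≤ (l - m) • (1 : M) :=
          smul_le_smul_of_nonneg_left (isStarProjection_le_one hz.isStarProjection)
            (sub_nonneg.2 hml)
    have h5 := (CStarAlgebra.norm_le_iff_le_algebraMap _ (sub_nonneg.2 hml) h0).2 h4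
    refine h5.trans ?_
    rw [h3]
    have h6 : (3 / 4 : ℝ) ^ n * (2 * ‖a‖ + 1) < ε := (lt_div_iff₀ (by positivity)).1 hn
    have : (0 : ℝ) ≤ (3 / 4) ^ n := by positivity
    nlinarith

/-! ### Central decomposition -/

/-- The trace `φ (z ·)` cut down by a central projection. -/
lemma IsPosTrace.cut {φ : M →ₗ[ℂ] ℂ} (h : IsPosTrace M φ) {z : M} (hz : IsStarProjection z)
    (hzc : ∀ a, z * a = a * z) : IsPosTrace M (φ ∘ₗ LinearMap.mulLeft ℂ z) where
  nonneg a := by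
    have : z * (star a * a) = star (z * a) * (z * a) := by
      rw [star_mul, hz.isSelfAdjoint.star_eq, mul_assoc, ← mul_assoc z z, hz.isIdempotentElem.eq,
        ← mul_assoc, hzc, mul_assoc]
    simpa [this] using h.nonneg (z * a)
  comm a b := by
    simp only [LinearMap.comp_apply, LinearMap.mulLeft_apply]
    rw [← mul_assoc, h.comm, ← mul_assoc, ← hzc, mul_assoc]

/-- A finite set of nonzero, mutually orthogonal central projections. -/
structure IsCentralFamily (S : Finset M) : Prop where
  isStarProjection : ∀ z ∈ S, IsStarProjection z
  comm : ∀ z ∈ S, ∀ a, z * a = a * z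
  ne_zero : ∀ z ∈ S, z ≠ 0
  orthogonal : ∀ z ∈ S, ∀ w ∈ S, z ≠ w → z * w = 0

/-- Orthogonal central projections carry linearly independent traces. -/
lemma IsCentralFamily.card_le (hfin : IsFiniteVN M) [FiniteDimensional ℂ (linT M)] {S : Finset M}
    (hS : IsCentralFamily S) : S.card ≤ Module.finrank ℂ (linT M) := by
  choose! τ hτ _ hτ0 using hfin
  let φ : S → linT M := fun z =>
    ⟨_, ((hτ z (hS.ne_zero z z.2)).cut (hS.isStarProjection z z.2) (hS.comm z z.2)).mem_linT⟩
  have hφ : LinearIndependent ℂ φ := by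
    rw [Fintype.linearIndependent_iff]
    intro g hg w
    have h1 := congrArg (fun ψ : linT M => ψ.1 w) hg
    simp only [Submodule.coe_sum, Submodule.coe_smul, LinearMap.sum_apply, LinearMap.smul_apply,
      Submodule.coe_zero, LinearMap.zero_apply, φ, LinearMap.comp_apply, LinearMap.mulLeft_apply,
      smul_eq_mul] at h1
    rw [Finset.sum_eq_single w] at h1
    · have h2 := hτ0 w (hS.ne_zero w w.2)
      rw [(hS.isStarProjection w w.2).isSelfAdjoint.star_eq] at h2
      exact (mul_eq_zero.1 h1).resolve_right h2
    · intro z _ hzw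
      rw [hS.orthogonal z z.2 w w.2 (fun h => hzw (Subtype.ext h)), map_zero, mul_zero]
    · simp
  simpa using hφ.fintype_card_le_finrank

lemma IsCentralFamily.insert [DecidableEq M] {S : Finset M} (hS : IsCentralFamily S) {q : M}
    (hq : IsStarProjection q) (hqc : ∀ a, q * a = a * q) (hq0 : q ≠ 0)
    (hqS : ∀ z ∈ S, q * z = 0) : IsCentralFamily (insert q S) ∧ q ∉ S := by
  refine ⟨⟨?_, ?_, ?_, ?_⟩, fun h => hq0 ?_⟩
  · rw [Finset.forall_mem_insert]; exact ⟨hq, hS.isStarProjection⟩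
  · rw [Finset.forall_mem_insert]; exact ⟨hqc, hS.comm⟩
  · rw [Finset.forall_mem_insert]; exact ⟨hq0, hS.ne_zero⟩
  · intro z hz w hw hzw
    rcases Finset.mem_insert.1 hz with rfl | hz' <;> rcases Finset.mem_insert.1 hw with rfl | hw'
    · exact absurd rfl hzw
    · exact hqS w hw'
    · rw [← hqc]; exact hqS z hz'
    · exact hS.orthogonal z hz' w hw' hzw
  · rw [← hq.isIdempotentElem.eq]; exact hqS q h

lemma isStarProjection_sub {z q : M} (hz : IsStarProjection z) (hq : IsStarProjection q)
    (hqc : ∀ a, q * a = a * q) (hzq : z * q = q) : IsStarProjection (z - q) := by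
  refine ⟨?_, hz.isSelfAdjoint.sub hq.isSelfAdjoint⟩
  rw [IsIdempotentElem, sub_mul, mul_sub, mul_sub, hz.isIdempotentElem.eq, hq.isIdempotentElem.eq,
    hqc z, hzq]
  abel

/-- The unit of `M` is a finite sum of minimal central projections. -/
theorem exists_minimal_central_decomposition (hfin : IsFiniteVN M)
    [FiniteDimensional ℂ (linT M)] : ∃ S : Finset M, (∀ z ∈ S, IsMinimalCentral z) ∧
      (∀ z ∈ S, ∀ w ∈ S, z ≠ w → z * w = 0) ∧ ∑ z ∈ S, z = 1 := by
  classical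
  -- a family of the largest possible size
  obtain ⟨S, hS, hmax⟩ : ∃ S : Finset M, IsCentralFamily S ∧
      ∀ T : Finset M, IsCentralFamily T → T.card ≤ S.card := by
    have hne : {n | ∃ S : Finset M, IsCentralFamily S ∧ S.card = n}.Nonempty :=
      ⟨0, ∅, ⟨by simp, by simp, by simp, by simp⟩, rfl⟩
    have hbd : BddAbove {n | ∃ S : Finset M, IsCentralFamily S ∧ S.card = n} :=
      ⟨Module.finrank ℂ (linT M), by rintro _ ⟨S, hS, rfl⟩; exact hS.card_le hfin⟩
    obtain ⟨S, hS, hSn⟩ := Nat.sSup_mem hne hbd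
    exact ⟨S, hS, fun T hT => hSn ▸ le_csSup hbd ⟨T, hT, rfl⟩⟩
  refine ⟨S, fun z hz => ⟨hS.isStarProjection z hz, hS.comm z hz, hS.ne_zero z hz, ?_⟩,
    hS.orthogonal, ?_⟩
  · intro q hq hqc hzq
    by_contra! hcon
    -- otherwise `z` could be split
    have hE : IsCentralFamily (S.erase z) :=
      ⟨fun w hw => hS.isStarProjection w (Finset.mem_of_mem_erase hw),
        fun w hw => hS.comm w (Finset.mem_of_mem_erase hw),
        fun w hw => hS.ne_zero w (Finset.mem_of_mem_erase hw),
        fun w hw v hv => hS.orthogonal w (Finset.mem_of_mem_erase hw) v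
          (Finset.mem_of_mem_erase hv)⟩
    have hq_orth : ∀ w ∈ S.erase z, q * w = 0 := fun w hw => by
      rw [← hzq, hS.comm z hz, mul_assoc, hS.orthogonal z hz w (Finset.mem_of_mem_erase hw)
        (Finset.ne_of_mem_erase hw).symm, mul_zero]
    obtain ⟨h1, h1'⟩ := hE.insert hq hqc hcon.1 hq_orth
    obtain ⟨h2, h2'⟩ := h1.insert (q := z - q)
      (isStarProjection_sub (hS.isStarProjection z hz) hq hqc hzq)
      (fun a => by rw [sub_mul, mul_sub, hS.comm z hz, hqc])
      (fun h => hcon.2 (sub_eq_zero.1 h).symm) (fun w hw => by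
        rcases Finset.mem_insert.1 hw with rfl | hw
        · rw [sub_mul, hzq, hq.isIdempotentElem.eq, sub_self]
        · rw [sub_mul, hq_orth w hw, hS.orthogonal z hz w (Finset.mem_of_mem_erase hw)
            (Finset.ne_of_mem_erase hw).symm, sub_zero])
    have := hmax _ h2
    rw [Finset.card_insert_of_notMem h2', Finset.card_insert_of_notMem h1',
      Finset.card_erase_of_mem hz] at this
    have := Finset.card_pos.2 ⟨z, hz⟩
    omega
  · by_contra hcon
    have hmul : ∀ w ∈ S, (∑ z ∈ S, z) * w = w := fun w hw => by
      rw [Finset.sum_mul, Finset.sum_eq_single w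
        (fun z hz hzw => hS.orthogonal z hz w hw hzw) (fun h => absurd hw h)]
      exact (hS.isStarProjection w hw).isIdempotentElem.eq
    have hproj : IsStarProjection (∑ z ∈ S, z) := by
      refine ⟨?_, ?_⟩
      · rw [IsIdempotentElem]
        nth_rw 2 [← Finset.sum_congr rfl fun z _ => rfl]
        rw [Finset.mul_sum]
        exact Finset.sum_congr rfl hmul
      · rw [IsSelfAdjoint, star_sum]
        exact Finset.sum_congr rfl fun z hz => (hS.isStarProjection z hz).isSelfAdjoint.star_eq
    have hc : ∀ a, (∑ z ∈ S, z) * a = a * ∑ z ∈ S, z := fun a => by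
      rw [Finset.sum_mul, Finset.mul_sum]
      exact Finset.sum_congr rfl fun z hz => hS.comm z hz a
    obtain ⟨h1, h1'⟩ := hS.insert (q := 1 - ∑ z ∈ S, z) hproj.one_sub
      (fun a => by rw [sub_mul, mul_sub, hc]; simp) (fun h => hcon (sub_eq_zero.1 h).symm)
      (fun w hw => by rw [sub_mul, hmul w hw, one_mul, sub_self])
    have := hmax _ h1
    rw [Finset.card_insert_of_notMem h1'] at this
    omega

/-! ### Ideals and traces -/

lemma IsPosTrace.averageStable {φ : M →ₗ[ℂ] ℂ} (h : IsPosTrace M φ) (c : ℂ) :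
    AverageStable fun b => φ b = c := by
  intro a u _ huu ha
  have : φ (u * a * u) = φ a := by rw [h.comm, ← mul_assoc, huu, one_mul]
  rw [← Complex.coe_smul, map_smul, map_add, this, ha, smul_eq_mul]
  push_cast; ring

lemma AverageStable.and {P Q : M → Prop} (hP : AverageStable P) (hQ : AverageStable Q) :
    AverageStable fun b => P b ∧ Q b :=
  fun a u h1 h2 h3 => ⟨hP a u h1 h2 h3.1, hQ a u h1 h2 h3.2⟩

lemma IsPosTrace.norm_sub_le {φ : M →ₗ[ℂ] ℂ} (h : IsPosTrace M φ) {z b : M}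
    (hz : IsStarProjection z) (hb : IsSelfAdjoint b) {r ε : ℝ} (hr : ‖b - r • z‖ ≤ ε) :
    ‖φ b - r * φ z‖ ≤ ε * ‖φ 1‖ := by
  have h1 := h.norm_le_of_isSelfAdjoint (hb.sub ((IsSelfAdjoint.all r).smul hz.isSelfAdjoint))
  rw [← Complex.coe_smul, map_sub, map_smul, smul_eq_mul] at h1
  exact h1.trans (by gcongr; rwa [Complex.coe_smul])

/-- Traces are proportional on the summand cut out by a minimal central projection: averaging does
not change their values and ends near a multiple of `z`. -/
theorem IsMinimalCentral.trace_unique {z : M} (hz : IsMinimalCentral z) {φ ψ : M →ₗ[ℂ] ℂ}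
    (hφ : IsPosTrace M φ) (hψ : IsPosTrace M ψ) (a : M) :
    φ (z * a) * ψ z = φ z * ψ (z * a) := by
  have key : ∀ a : M, IsSelfAdjoint a → φ (z * a) * ψ z = φ z * ψ (z * a) := by
    intro a ha
    have hzp := hz.isStarProjection
    have hs : IsSelfAdjoint (z * a) := by
      rw [IsSelfAdjoint, star_mul, ha.star_eq, hzp.isSelfAdjoint.star_eq, hz.comm]
    rw [← sub_eq_zero, ← norm_le_zero_iff]
    refine le_of_forall_pos_le_add fun δ hδ => ?_
    obtain ⟨C, hC⟩ : ∃ C, C = ‖φ 1‖ * ‖ψ z‖ + ‖φ z‖ * ‖ψ 1‖ := ⟨_, rfl⟩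
    have hC0 : 0 ≤ C := by rw [hC]; positivity
    obtain ⟨b, r, ⟨hb1, hb2⟩, -, hbs, hbr⟩ := hz.dixmier
      (P := fun b => φ b = φ (z * a) ∧ ψ b = ψ (z * a))
      ((hφ.averageStable _).and (hψ.averageStable _)) ⟨rfl, rfl⟩ hs
      (by rw [← mul_assoc, hzp.isIdempotentElem.eq]) (ε := δ / (C + 1)) (by positivity)
    have h1 := hφ.norm_sub_le hzp hbs hbr
    have h2 := hψ.norm_sub_le hzp hbs hbr
    rw [← hb1, ← hb2]
    calc ‖φ b * ψ z - φ z * ψ b‖ = ‖(φ b - r * φ z) * ψ z - φ z * (ψ b - r * ψ z)‖ := by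
          congr 1; ring
      _ ≤ ‖φ b - r * φ z‖ * ‖ψ z‖ + ‖φ z‖ * ‖ψ b - r * ψ z‖ := by
          refine (norm_sub_le _ _).trans ?_
          rw [norm_mul, norm_mul]
      _ ≤ δ / (C + 1) * ‖φ 1‖ * ‖ψ z‖ + ‖φ z‖ * (δ / (C + 1) * ‖ψ 1‖) := by gcongr
      _ = δ / (C + 1) * C := by rw [hC]; ring
      _ ≤ 0 + δ := by
          rw [zero_add, div_mul_eq_mul_div, div_le_iff₀ (by positivity)]; nlinarith
  have h1 := key _ (realPart a).2
  have h2 := key _ (imaginaryPart a).2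
  rw [← realPart_add_I_smul_imaginaryPart a]
  simp only [mul_add, map_add, mul_smul_comm, map_smul, smul_eq_mul]
  linear_combination h1 + Complex.I * h2

/-- A two-sided ideal which meets the summand of a minimal central projection `z` contains `z`. An
average of a positive element of the ideal is close to `r z`, and `r ≠ 0` since a trace which does
not vanish at the element is preserved by averaging. -/
theorem IsMinimalCentral.mem_ideal (hfin : IsFiniteVN M) {z : M} (hz : IsMinimalCentral z)
    {J : Submodule ℂ M} (hl : ∀ a, ∀ x ∈ J, a * x ∈ J) (hr : ∀ a, ∀ x ∈ J, x * a ∈ J) {x : M}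
    (hx : x ∈ J) (hzx : z * x ≠ 0) : z ∈ J := by
  obtain ⟨τ, hτ, -, h0⟩ := hfin _ hzx
  have hzp := hz.isStarProjection
  have hzz : z * z = z := hzp.isIdempotentElem
  obtain ⟨a, ha⟩ : ∃ a, a = star (z * x) * (z * x) := ⟨_, rfl⟩
  rw [← ha] at h0
  have hzs : z * star (z * x) = star (z * x) := by
    rw [star_mul, hzp.isSelfAdjoint.star_eq, hz.comm, mul_assoc, hzz]
  have hzn : ‖z‖ ≤ 1 :=
    (CStarAlgebra.norm_le_one_iff_of_nonneg z (isStarProjection_nonneg hzp)).2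
      (isStarProjection_le_one hzp)
  have hJ : AverageStable fun b => b ∈ J := fun b u _ _ hb => by
    rw [← Complex.coe_smul]
    exact J.smul_mem _ (J.add_mem hb (hr _ _ (hl _ _ hb)))
  obtain ⟨b, r, ⟨hbJ, hb⟩, hzb, hbs, hbr⟩ := hz.dixmier (P := fun b => b ∈ J ∧ τ b = τ a)
    (hJ.and (hτ.averageStable _)) ⟨ha ▸ hl _ _ (hl _ _ hx), rfl⟩
    (ha ▸ IsSelfAdjoint.star_mul_self _) (by rw [ha, ← mul_assoc, hzs]) (ε := ‖τ a‖ / 3)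
    (by positivity)
  have h1 := hτ.norm_sub_le hzp hbs hbr
  have h2 := hτ.norm_le_of_isSelfAdjoint hzp.isSelfAdjoint
  rw [hτ.map_one, norm_one, mul_one] at h1 h2
  have h0' : 0 < ‖τ a‖ := norm_pos_iff.2 h0
  have h3 : ‖τ a‖ / 3 < |r| := by
    have h4 : ‖τ b‖ ≤ ‖τ b - r * τ z‖ + ‖(r : ℂ) * τ z‖ := by
      simpa using norm_add_le (τ b - r * τ z) (r * τ z)
    rw [norm_mul, Complex.norm_real, Real.norm_eq_abs, hb] at h4
    have h5 : |r| * ‖τ z‖ ≤ |r| * 1 := by gcongr; exact h2.trans hzn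
    rw [hb] at h1
    linarith
  have hr0 : r ≠ 0 := by
    rintro rfl
    rw [abs_zero] at h3; linarith
  -- `r⁻¹ b` is at distance less than one from `z`, so `1 - z + r⁻¹ b` is invertible
  obtain ⟨c, hc⟩ : ∃ c, c = r⁻¹ • b := ⟨_, rfl⟩
  have hcz : ‖z - c‖ < 1 := by
    have : z - c = -(r⁻¹ • (b - r • z)) := by
      rw [smul_sub, smul_smul, inv_mul_cancel₀ hr0, one_smul, hc, neg_sub]
    rw [this, norm_neg, norm_smul, norm_inv, Real.norm_eq_abs,
      inv_mul_lt_iff₀ (abs_pos.2 hr0), mul_one]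
    exact hbr.trans_lt h3
  obtain ⟨w, hw⟩ := isUnit_one_sub_of_norm_lt_one hcz
  have hzc : z * c = c := by rw [hc, mul_smul_comm, hzb]
  have hzw : z * (w : M) = c := by
    rw [hw, mul_sub, mul_one, mul_sub, hzz, hzc]; abel
  have : z = c * (w⁻¹ : Mˣ) := by rw [← hzw, mul_assoc, Units.mul_inv, mul_one]
  rw [this]
  refine hr _ _ ?_
  rw [hc, ← Complex.coe_smul]
  exact J.smul_mem _ hbJ

/-- Every trace is normal: on each minimal central summand it is a multiple of a normal one. -/
theorem uwCont_of_mem_linT (hfin : IsFiniteVN M) [FiniteDimensional ℂ (linT M)]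
    {φ : Module.Dual ℂ M} (hφ : φ ∈ linT M) : UWCont φ := by
  obtain ⟨S, hS, -, hS1⟩ := exists_minimal_central_decomposition hfin
  choose! τ hτ hτc hτ0 using hfin
  induction hφ using Submodule.span_induction with
  | mem φ hφ =>
    have e : ∀ a, φ a = ∑ z : S, φ z / τ z z * τ z (z * a) := by
      intro a
      calc φ a = φ ((∑ z ∈ S, z) * a) := by rw [hS1, one_mul]
        _ = ∑ z ∈ S, φ (z * a) := by rw [Finset.sum_mul, map_sum]
        _ = ∑ z : S, φ (z * a) := (Finset.sum_coe_sort S fun z => φ (z * a)).symm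
        _ = _ := by
          refine Finset.sum_congr rfl fun z _ => ?_
          have hz := hS z z.2
          have h0 := hτ0 z hz.ne_zero
          rw [hz.isStarProjection.isSelfAdjoint.star_eq, hz.isStarProjection.isIdempotentElem.eq]
            at h0
          have := hz.trace_unique hφ.toIsPosTrace (hτ z hz.ne_zero).toIsPosTrace a
          field_simp
          exact this
    have : (φ : M → ℂ) = fun a => ∑ z : S, φ z / τ z z * τ z (z * a) := funext e
    rw [this]
    exact UWCont.sum fun z => UWCont.const_mul
      (UWCont.comp (hτc z (hS z z.2).ne_zero) (uwContMap_mul_left (z : M))) _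
  | zero =>
    let := ultraweak M
    exact continuous_const
  | add φ ψ _ _ h1 h2 => exact h1.add h2
  | smul c φ _ h => exact h.const_mul c

/-- A sum of one nonzero trace for each minimal central summand is faithful: by uniqueness, a
positive element of the summand which it kills is killed by all traces. -/
theorem exists_faithful_trace (hfin : IsFiniteVN M) [FiniteDimensional ℂ (linT M)] :
    ∃ τ : M →ₗ[ℂ] ℂ, IsPosTrace M τ ∧ ∀ x, τ (star x * x) = 0 → x = 0 := by
  obtain ⟨S, hS, -, hS1⟩ := exists_minimal_central_decomposition hfin
  have hfin' := hfin
  choose! τ hτ hτc hτ0 using hfin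
  have hcut : ∀ z : S, IsPosTrace M (τ z ∘ₗ LinearMap.mulLeft ℂ (z : M)) := fun z =>
    (hτ z (hS z z.2).ne_zero).toIsPosTrace.cut (hS z z.2).isStarProjection (hS z z.2).comm
  refine ⟨∑ z : S, τ z ∘ₗ LinearMap.mulLeft ℂ (z : M), ⟨fun a => ?_, fun a b => ?_⟩, fun x hx => ?_⟩
  · rw [LinearMap.sum_apply]
    exact Finset.sum_nonneg fun z _ => (hcut z).nonneg a
  · rw [LinearMap.sum_apply, LinearMap.sum_apply]
    exact Finset.sum_congr rfl fun z _ => (hcut z).comm a b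
  · rw [LinearMap.sum_apply, Finset.sum_eq_zero_iff_of_nonneg fun z _ => (hcut z).nonneg x] at hx
    have h0 : ∀ z ∈ S, z * x = 0 := by
      intro z hz
      by_contra hne
      obtain ⟨ψ, hψ, -, hψ0⟩ := hfin' _ hne
      have hzm := hS z hz
      have hzs := hzm.isStarProjection.isSelfAdjoint.star_eq
      have hzz : z * z = z := hzm.isStarProjection.isIdempotentElem
      have e : star (z * x) * (z * x) = z * (star x * x) := by
        rw [star_mul, hzs, mul_assoc, ← mul_assoc z z, hzz, ← mul_assoc, ← hzm.comm, mul_assoc]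
      rw [e] at hψ0
      have h1 := hzm.trace_unique hψ.toIsPosTrace (hτ z hzm.ne_zero).toIsPosTrace (star x * x)
      have h2 : τ z (z * (star x * x)) = 0 := hx ⟨z, hz⟩ (Finset.mem_univ _)
      have h3 := hτ0 z hzm.ne_zero
      rw [hzs, hzz] at h3
      rw [h2, mul_zero] at h1
      exact (mul_ne_zero hψ0 h3) h1
    rw [← one_mul x, ← hS1, Finset.sum_mul]
    exact Finset.sum_eq_zero h0

/-! ### Functionals which are ultraweakly continuous on balls -/

/-- A functional dominated by the supremum of a null family `s` is an `ℓ¹` combination of `s`: this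
is the duality of `c₀` and `ℓ¹` together with the Hahn–Banach theorem. -/
theorem exists_summable_coeff {ι E : Type*} [AddCommGroup E] [Module ℂ E] (s : ι → E →ₗ[ℂ] ℂ)
    (g : E →ₗ[ℂ] ℂ) (h0 : ∀ x, Filter.Tendsto (fun p => s p x) Filter.cofinite (nhds 0))
    (hg : ∀ x, (∀ p, ‖s p x‖ ≤ 1) → ‖g x‖ ≤ 1) :
    ∃ c : ι → ℂ, (Summable fun p => ‖c p‖) ∧ ∀ x, HasSum (fun p => c p * s p x) (g x) := by
  classical
  have hmem : ∀ x, Memℓp (fun p => s p x) ⊤ := fun x =>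
    memℓp_infty_iff.2 (by simpa using (h0 x).norm.bddAbove_range_of_cofinite)
  let S : E →ₗ[ℂ] lp (fun _ : ι => ℂ) ⊤ :=
    { toFun := fun x => ⟨fun p => s p x, hmem x⟩
      map_add' := fun x y => by ext p; exact map_add (s p) x y
      map_smul' := fun c x => by ext p; exact map_smul (s p) c x }
  have hS : ∀ x p, S x p = s p x := fun _ _ => rfl
  have hgS : ∀ x, ‖g x‖ ≤ ‖S x‖ := by
    intro x
    refine le_of_forall_gt_imp_ge_of_dense fun t ht => ?_
    have ht0 : 0 < t := (norm_nonneg _).trans_lt ht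
    have h1 := hg (((t⁻¹ : ℝ) : ℂ) • x) fun p => by
      rw [map_smul, norm_smul, Complex.norm_real, norm_inv, Real.norm_eq_abs, abs_of_pos ht0]
      refine inv_mul_le_one_of_le₀ ?_ ht0.le
      exact (lp.norm_apply_le_norm ENNReal.top_ne_zero (S x) p).trans ht.le
    rw [map_smul, norm_smul, Complex.norm_real, norm_inv, Real.norm_eq_abs, abs_of_pos ht0,
      inv_mul_le_iff₀ ht0, mul_one] at h1
    exact h1
  have hker : LinearMap.ker S ≤ LinearMap.ker g := fun x hx => by
    have := hgS x
    rw [LinearMap.mem_ker.1 hx, norm_zero, norm_le_zero_iff] at this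
    exact this
  let f₀ : LinearMap.range S →ₗ[ℂ] ℂ :=
    (LinearMap.ker S).liftQ g hker ∘ₗ (LinearMap.quotKerEquivRange S).symm.toLinearMap
  have hf₀ : ∀ x, f₀ ⟨S x, LinearMap.mem_range_self S x⟩ = g x := fun x => by
    have : (LinearMap.quotKerEquivRange S).symm ⟨S x, LinearMap.mem_range_self S x⟩ =
        (LinearMap.ker S).mkQ x := by
      rw [LinearEquiv.symm_apply_eq]; rfl
    simp only [f₀, LinearMap.comp_apply, LinearEquiv.coe_coe, this]
    simp
  have hbound : ∀ y, ‖f₀ y‖ ≤ 1 * ‖y‖ := by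
    rintro ⟨_, x, rfl⟩
    rw [hf₀, one_mul]
    exact hgS x
  obtain ⟨Γ, hΓ, -⟩ := exists_extension_norm_eq _ (f₀.mkContinuous 1 hbound)
  have hΓS : ∀ x, Γ (S x) = g x := fun x =>
    (hΓ ⟨S x, LinearMap.mem_range_self S x⟩).trans (hf₀ x)
  let e : ι → lp (fun _ : ι => ℂ) ⊤ := fun p => lp.single ⊤ p 1
  have he : ∀ (F : Finset ι) (θ : ι → ℂ) q, (∑ p ∈ F, θ p • e p) q = if q ∈ F then θ q else 0 := by
    intro F θ q
    rw [lp.coeFn_sum, Finset.sum_apply]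
    simp only [lp.coeFn_smul, Pi.smul_apply, e, lp.coeFn_single, smul_eq_mul]
    simp [Pi.single_apply]
  have hΓe : ∀ (F : Finset ι) (θ : ι → ℂ),
      Γ (∑ p ∈ F, θ p • e p) = ∑ p ∈ F, Γ (e p) * θ p := fun F θ => by
    rw [map_sum]
    exact Finset.sum_congr rfl fun p _ => by rw [map_smul, smul_eq_mul, mul_comm]
  refine ⟨fun p => Γ (e p), ?_, fun x => ?_⟩
  · refine summable_of_sum_le (c := ‖Γ‖) (fun _ => norm_nonneg _) fun F => ?_
    -- test against the phases of the coefficients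
    let θ : ι → ℂ := fun p => starRingEnd ℂ (Γ (e p)) / ‖Γ (e p)‖
    have hθ : ∀ p, Γ (e p) * θ p = ‖Γ (e p)‖ := fun p => by
      by_cases h : Γ (e p) = 0
      · simp [h]
      · have h' : (‖Γ (e p)‖ : ℂ) ≠ 0 := by simpa using h
        simp only [θ]
        rw [← mul_div_assoc, Complex.mul_conj, Complex.normSq_eq_norm_sq, div_eq_iff h']
        push_cast; ring
    have hθ1 : ∀ p, ‖θ p‖ ≤ 1 := fun p => by
      simp only [θ, norm_div, RCLike.norm_conj, Complex.norm_real, norm_norm]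
      exact div_self_le_one _
    have h1 : ‖∑ p ∈ F, θ p • e p‖ ≤ 1 := lp.norm_le_of_forall_le zero_le_one fun q => by
      rw [he]; split_ifs
      · exact hθ1 q
      · simp
    have h2 : ‖Γ (∑ p ∈ F, θ p • e p)‖ = ∑ p ∈ F, ‖Γ (e p)‖ := by
      rw [hΓe, Finset.sum_congr rfl fun p _ => hθ p, ← Complex.ofReal_sum, Complex.norm_real,
        Real.norm_of_nonneg (Finset.sum_nonneg fun _ _ => norm_nonneg _)]
    rw [← h2]
    exact (Γ.le_opNorm _).trans (mul_le_of_le_one_right (norm_nonneg _) h1)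
  · rw [HasSum, SummationFilter.unconditional_filter, Metric.tendsto_atTop]
    intro ε hε
    obtain ⟨δ, hδ, hδε⟩ : ∃ δ > 0, ‖Γ‖ * δ < ε := by
      refine ⟨ε / (‖Γ‖ + 1), by positivity, ?_⟩
      rw [mul_div_assoc', div_lt_iff₀ (by positivity)]; nlinarith
    have hfin : {p | ¬ ‖s p x‖ < δ}.Finite := by
      have := (Metric.tendsto_nhds.1 (h0 x)) δ hδ
      simpa [Filter.eventually_cofinite] using this
    refine ⟨hfin.toFinset, fun F hF => ?_⟩
    have h1 : ‖∑ p ∈ F, s p x • e p - S x‖ ≤ δ := lp.norm_le_of_forall_le hδ.le fun q => by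
      rw [lp.coeFn_sub, Pi.sub_apply, he, hS]
      split_ifs with hq
      · simpa using hδ.le
      · have : ‖s q x‖ < δ := by
          by_contra hcon
          exact hq (hF (hfin.mem_toFinset.2 hcon))
        simpa using this.le
    rw [dist_eq_norm, ← hΓe F (fun p => s p x), ← hΓS, ← map_sub]
    exact ((Γ.le_opNorm _).trans (by gcongr)).trans_lt hδε

/-- The rank one functional `a ↦ ⟪p.1, a p.2⟫`. -/
def rankOne (M : VonNeumannAlgebra H) (p : H × H) : M →ₗ[ℂ] ℂ where
  toFun a := ⟪p.1, (a : H →L[ℂ] H) p.2⟫_ℂ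
  map_add' a b := by simp
  map_smul' c a := by
    change ⟪p.1, ((c • (a : H →L[ℂ] H)) p.2 : H)⟫_ℂ = c • ⟪p.1, (a : H →L[ℂ] H) p.2⟫_ℂ
    rw [smul_apply, inner_smul_right, smul_eq_mul]

lemma norm_rankOne_le (p : H × H) (a : M) : ‖rankOne M p a‖ ≤ ‖a‖ * (‖p.1‖ * ‖p.2‖) :=
  norm_inner_apply_le a p.1 p.2

/-- The ball of radius `n` is the polar of the rank one functionals of norm at most `1 / n`. -/
lemma norm_le_of_rankOne_le {n : ℝ} (hn : 0 ≤ n) {a : M}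
    (h : ∀ p : H × H, n * ‖p.1‖ ^ 2 ≤ 1 → n * ‖p.2‖ ^ 2 ≤ 1 → ‖rankOne M p a‖ ≤ 1) : ‖a‖ ≤ n := by
  refine le_of_forall_pos_le_add fun δ hδ => ?_
  refine (a : H →L[ℂ] H).opNorm_le_bound (by linarith) fun k => ?_
  by_cases h0 : (a : H →L[ℂ] H) k = 0
  · rw [h0, norm_zero]; positivity
  have hk0 : k ≠ 0 := by rintro rfl; simp at h0
  have hpos : 0 < n + δ := by linarith
  obtain ⟨t, ht0, ht⟩ : ∃ t : ℝ, 0 < t ∧ t ^ 2 * (n + δ) = 1 := by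
    refine ⟨(√(n + δ))⁻¹, by positivity, ?_⟩
    rw [inv_pow, Real.sq_sqrt hpos.le, inv_mul_cancel₀ hpos.ne']
  have hsmall : ∀ v : H, v ≠ 0 → n * ‖((t * ‖v‖⁻¹ : ℝ) : ℂ) • v‖ ^ 2 ≤ 1 := fun v hv => by
    have hv' : ‖v‖ ≠ 0 := norm_ne_zero_iff.2 hv
    rw [norm_smul, Complex.norm_real, Real.norm_of_nonneg (by positivity), mul_assoc,
      inv_mul_cancel₀ hv', mul_one]
    nlinarith [sq_nonneg t]
  have h1 := h (((t * ‖(a : H →L[ℂ] H) k‖⁻¹ : ℝ) : ℂ) • (a : H →L[ℂ] H) k,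
    ((t * ‖k‖⁻¹ : ℝ) : ℂ) • k) (hsmall _ h0) (hsmall _ hk0)
  have h2 : 0 < ‖(a : H →L[ℂ] H) k‖ := norm_pos_iff.2 h0
  have h3 : 0 < ‖k‖ := norm_pos_iff.2 hk0
  simp only [rankOne, LinearMap.coe_mk, AddHom.coe_mk, map_smul, inner_smul_left, inner_smul_right,
    Complex.conj_ofReal, inner_self_eq_norm_sq_to_K, norm_mul, Complex.norm_real, norm_pow,
    Complex.coe_algebraMap, norm_norm, norm_inv, Real.norm_of_nonneg ht0.le] at h1
  have h4 : t * ‖k‖⁻¹ * (t * ‖(a : H →L[ℂ] H) k‖⁻¹ * ‖(a : H →L[ℂ] H) k‖ ^ 2)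
      = ‖(a : H →L[ℂ] H) k‖ / ((n + δ) * ‖k‖) := by
    field_simp
    exact ht
  have h5 : ‖(a : H →L[ℂ] H) k‖ / ((n + δ) * ‖k‖) ≤ 1 := by
    rw [← h4]; convert h1 using 1
  rwa [div_le_one (by positivity)] at h5

/-- The polar, among rank one functionals, of a finite set. -/
def finPolar (M : VonNeumannAlgebra H) (G : Finset (H × H)) : Set M :=
  {x | ∀ p ∈ G, ‖rankOne M p x‖ ≤ 1}

/-- One step of the Banach–Dieudonné construction. -/
lemma exists_finset_extend [DecidableEq (H × H)] {g : M →ₗ[ℂ] ℂ}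
    (hg : ∀ r, @ContinuousOn M ℂ (ultraweak M) _ g (Metric.closedBall 0 r)) (n : ℕ)
    {G : Finset (H × H)} (hG : ∀ x, ‖x‖ ≤ n → x ∈ finPolar M G → ‖g x‖ < 1) :
    ∃ F : Finset (H × H), (∀ p ∈ F, n * ‖p.1‖ ^ 2 ≤ 1 ∧ n * ‖p.2‖ ^ 2 ≤ 1) ∧
      ∀ x, ‖x‖ ≤ (n + 1 : ℕ) → x ∈ finPolar M (G ∪ F) → ‖g x‖ < 1 := by
  let I : Set (H × H) := {p | n * ‖p.1‖ ^ 2 ≤ 1 ∧ n * ‖p.2‖ ^ 2 ≤ 1}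
  have hD : ∀ p : H × H, @IsClosed M (ultraweak M) {x | ‖rankOne M p x‖ ≤ 1} := fun p => by
    let := ultraweak M
    exact isClosed_le (uwCont_inner p.1 p.2).norm continuous_const
  have hball := isCompact_closedBall_ultraweak (M := M) ((n + 1 : ℕ) : ℝ)
  have hfP : @IsClosed M (ultraweak M) (finPolar M G) := by
    let := ultraweak M
    have : finPolar M G = ⋂ p ∈ G, {x | ‖rankOne M p x‖ ≤ 1} := by
      ext x; simp [finPolar]
    rw [this]
    exact isClosed_biInter fun p _ => hD p
  let K : Set M := (Metric.closedBall 0 ((n + 1 : ℕ) : ℝ) ∩ {x | 1 ≤ ‖g x‖}) ∩ finPolar M G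
  have hK : @IsCompact M (ultraweak M) K := by
    let := ultraweak M
    have hclosed : IsClosed (Metric.closedBall (0 : M) ((n + 1 : ℕ) : ℝ)) := by
      have : T2Space M := .of_injective_continuous matrixCoeff_injective continuous_matrixCoeff
      exact hball.isClosed
    have h1 : IsClosed (Metric.closedBall (0 : M) ((n + 1 : ℕ) : ℝ) ∩ {x | 1 ≤ ‖g x‖}) :=
      (hg _).norm.preimage_isClosed_of_isClosed hclosed isClosed_Ici
    exact hball.of_isClosed_subset (h1.inter hfP) fun x hx => hx.1.1
  obtain ⟨u, hu⟩ := @IsCompact.elim_finite_subfamily_closed M (ultraweak M) K I hK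
    (fun p => {x | ‖rankOne M p x‖ ≤ 1}) (fun p => hD p) (by
      refine Set.eq_empty_of_forall_notMem fun x hx => ?_
      obtain ⟨⟨⟨-, hx1⟩, hx2⟩, hx3⟩ := hx
      have : ‖x‖ ≤ n := norm_le_of_rankOne_le (Nat.cast_nonneg n) fun p h1 h2 =>
        Set.mem_iInter.1 hx3 ⟨p, h1, h2⟩
      exact absurd (hG x this hx2) (not_lt.2 hx1))
  refine ⟨u.map ⟨Subtype.val, Subtype.val_injective⟩, ?_, fun x hx hxp => ?_⟩
  · intro p hp
    obtain ⟨q, -, rfl⟩ := Finset.mem_map.1 hp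
    exact q.2
  · by_contra hcon
    have : x ∈ K ∩ ⋂ i ∈ u, {x | ‖rankOne M i x‖ ≤ 1} := by
      refine ⟨⟨⟨mem_closedBall_zero_iff.2 hx, not_lt.1 hcon⟩, fun p hp =>
        hxp p (Finset.mem_union_left _ hp)⟩, Set.mem_iInter₂.2 fun i hi =>
        hxp i (Finset.mem_union_right _ (Finset.mem_map_of_mem _ hi))⟩
    rw [hu] at this
    exact this

/-- The Banach–Dieudonné construction: the unit ball of `g` contains the polar of a null sequence
of rank one functionals, enumerated here by an increasing sequence of finite sets. -/
lemma exists_null_family {g : M →ₗ[ℂ] ℂ}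
    (hg : ∀ r, @ContinuousOn M ℂ (ultraweak M) _ g (Metric.closedBall 0 r)) :
    ∃ G : ℕ → Finset (H × H),
      (∀ n m, ∀ p ∈ G m, p ∉ G n → n * ‖p.1‖ ^ 2 ≤ 1 ∧ n * ‖p.2‖ ^ 2 ≤ 1) ∧
      ∀ x, (∀ n, x ∈ finPolar M (G n)) → ‖g x‖ < 1 := by
  classical
  choose F hF1 hF2 using fun (n : ℕ) (G : {G : Finset (H × H) //
    ∀ x, ‖x‖ ≤ n → x ∈ finPolar M G → ‖g x‖ < 1}) => exists_finset_extend hg n G.2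
  let G : (n : ℕ) → {G : Finset (H × H) // ∀ x, ‖x‖ ≤ n → x ∈ finPolar M G → ‖g x‖ < 1} :=
    fun n => Nat.rec ⟨∅, fun x hx _ => by
      have : x = 0 := by simpa using hx
      simp [this]⟩ (fun n G => ⟨G.1 ∪ F n G, hF2 n G⟩) n
  have hsucc : ∀ n, (G (n + 1)).1 = (G n).1 ∪ F n (G n) := fun n => rfl
  have hmono : Monotone fun n => (G n).1 :=
    monotone_nat_of_le_succ fun n => by rw [hsucc]; exact Finset.subset_union_left
  refine ⟨fun n => (G n).1, fun n m p hp hpn => ?_, fun x hx => ?_⟩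
  · induction m with
    | zero => exact absurd hp (Finset.notMem_empty p)
    | succ m ih =>
      have hp' : p ∈ (G m).1 ∪ F m (G m) := hp
      rcases Finset.mem_union.1 hp' with h | h
      · exact ih h
      · have hnm : n ≤ m := by
          by_contra hlt
          exact hpn (hmono (show m + 1 ≤ n by omega) hp)
        have hnm' : (n : ℝ) ≤ m := Nat.cast_le.2 hnm
        obtain ⟨h1, h2⟩ := hF1 m (G m) p h
        exact ⟨(by gcongr : (n : ℝ) * ‖p.1‖ ^ 2 ≤ m * ‖p.1‖ ^ 2).trans h1,
          (by gcongr : (n : ℝ) * ‖p.2‖ ^ 2 ≤ m * ‖p.2‖ ^ 2).trans h2⟩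
  · obtain ⟨n, hn⟩ := exists_nat_ge ‖x‖
    exact (G n).2 x hn (hx n)

/-- An absolutely convergent sum of rank one functionals of bounded vectors is ultraweakly
continuous. -/
lemma uwCont_of_hasSum {ι : Type*} [Countable ι] {p : ι → H × H} {c : ι → ℂ} {B : ℝ}
    (hc : Summable fun i => ‖c i‖) (hp1 : ∀ i, ‖(p i).1‖ ^ 2 ≤ B) (hp2 : ∀ i, ‖(p i).2‖ ^ 2 ≤ B)
    {g : M → ℂ} (hg : ∀ x, HasSum (fun i => c i * rankOne M (p i) x) (g x)) : UWCont g := by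
  obtain ⟨e, he⟩ := Countable.exists_injective_nat ι
  let ξ₀ : ι → H := fun i => ((√‖c i‖ : ℝ) : ℂ) • (p i).1
  let η₀ : ι → H := fun i => (c i / ((√‖c i‖ : ℝ) : ℂ)) • (p i).2
  have hn : ∀ i, ‖c i / ((√‖c i‖ : ℝ) : ℂ)‖ ^ 2 = ‖c i‖ := fun i => by
    rw [norm_div, Complex.norm_real, Real.norm_of_nonneg (Real.sqrt_nonneg _), div_pow,
      Real.sq_sqrt (norm_nonneg _), sq, mul_self_div_self]
  have hξ₀ : Summable fun i => ‖ξ₀ i‖ ^ 2 := by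
    refine Summable.of_nonneg_of_le (fun _ => by positivity) (fun i => ?_) (hc.mul_right B)
    rw [norm_smul, mul_pow, Complex.norm_real, Real.norm_of_nonneg (Real.sqrt_nonneg _),
      Real.sq_sqrt (norm_nonneg _)]
    exact mul_le_mul_of_nonneg_left (hp1 i) (norm_nonneg _)
  have hη₀ : Summable fun i => ‖η₀ i‖ ^ 2 := by
    refine Summable.of_nonneg_of_le (fun _ => by positivity) (fun i => ?_) (hc.mul_right B)
    rw [norm_smul, mul_pow, hn]
    exact mul_le_mul_of_nonneg_left (hp2 i) (norm_nonneg _)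
  have hext : ∀ f : ι → H, (fun n => ‖Function.extend e f 0 n‖ ^ 2) =
      Function.extend e (fun i => ‖f i‖ ^ 2) 0 := fun f => by
    funext n
    by_cases h : ∃ i, e i = n
    · obtain ⟨i, rfl⟩ := h
      rw [he.extend_apply, he.extend_apply]
    · rw [Function.extend_apply' _ _ _ h, Function.extend_apply' _ _ _ h]; simp
  have hξ : Summable fun n => ‖Function.extend e ξ₀ 0 n‖ ^ 2 := by
    rw [hext]; exact (summable_extend_zero he).2 hξ₀
  have hη : Summable fun n => ‖Function.extend e η₀ 0 n‖ ^ 2 := by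
    rw [hext]; exact (summable_extend_zero he).2 hη₀
  have : g = vecFun (Function.extend e ξ₀ 0) (Function.extend e η₀ 0) := by
    funext x
    rw [vecFun, ← he.tsum_eq (f := fun n => ⟪Function.extend e ξ₀ 0 n,
      (x : H →L[ℂ] H) (Function.extend e η₀ 0 n)⟫_ℂ), ← (hg x).tsum_eq]
    · refine tsum_congr fun i => ?_
      rw [he.extend_apply, he.extend_apply]
      simp only [ξ₀, η₀, map_smul, inner_smul_left, inner_smul_right, Complex.conj_ofReal, rankOne,
        LinearMap.coe_mk, AddHom.coe_mk]
      by_cases h : c i = 0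
      · simp [h]
      · have : ((√‖c i‖ : ℝ) : ℂ) ≠ 0 := by
          simpa using h
        field_simp
    · intro n hn'
      by_contra h
      refine hn' ?_
      have h' : ¬ ∃ i, e i = n := fun ⟨i, hi⟩ => h ⟨i, hi⟩
      change ⟪Function.extend e ξ₀ 0 n, (x : H →L[ℂ] H) (Function.extend e η₀ 0 n)⟫_ℂ = 0
      rw [Function.extend_apply' _ _ _ h']; simp
  rw [this]
  exact uwCont_vecFun hξ hη

/-- Krein–Smulian theorem for functionals: a linear functional which is ultraweakly continuous on
balls is ultraweakly continuous. -/
theorem uwCont_of_continuousOn_ball {g : M →ₗ[ℂ] ℂ}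
    (hg : ∀ r, @ContinuousOn M ℂ (ultraweak M) _ g (Metric.closedBall 0 r)) : UWCont g := by
  obtain ⟨G, hG1, hG2⟩ := exists_null_family hg
  let A : Set (H × H) := ⋃ n, (G n : Set (H × H))
  have hA : A.Countable := Set.countable_iUnion fun n => (G n).finite_toSet.countable
  have hcount : Countable A := hA.to_subtype
  have hbd : ∃ B : ℝ, ∀ p : A, ‖p.1.1‖ ^ 2 ≤ B ∧ ‖p.1.2‖ ^ 2 ≤ B := by
    refine ⟨1 + ∑ p ∈ G 1, (‖p.1‖ ^ 2 + ‖p.2‖ ^ 2), fun ⟨p, hp⟩ => ?_⟩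
    obtain ⟨m, hm⟩ := Set.mem_iUnion.1 hp
    have h0 : ∀ p : H × H, 0 ≤ ‖p.1‖ ^ 2 + ‖p.2‖ ^ 2 := fun p => by positivity
    by_cases h : p ∈ G 1
    · have := Finset.single_le_sum (fun q _ => h0 q) h
      constructor <;> nlinarith [sq_nonneg ‖p.1‖, sq_nonneg ‖p.2‖]
    · have h1 := hG1 1 m p hm h
      have h2 : 0 ≤ ∑ p ∈ G 1, (‖p.1‖ ^ 2 + ‖p.2‖ ^ 2) := Finset.sum_nonneg fun q _ => h0 q
      simp only [Nat.cast_one, one_mul] at h1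
      exact ⟨by linarith [h1.1], by linarith [h1.2]⟩
  obtain ⟨B, hB⟩ := hbd
  obtain ⟨c, hc, hcg⟩ := exists_summable_coeff (fun p : A => rankOne M p.1) g (fun x => by
    rw [Metric.tendsto_nhds]
    intro ε hε
    rw [Filter.eventually_cofinite]
    obtain ⟨n, hn⟩ := exists_nat_gt (‖x‖ / ε)
    refine Set.Finite.subset ((G n).finite_toSet.preimage Subtype.val_injective.injOn)
      fun p hp => ?_
    by_contra hpn
    obtain ⟨m, hm⟩ := Set.mem_iUnion.1 p.2
    obtain ⟨h1, h2⟩ := hG1 n m p.1 hm hpn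
    refine hp ?_
    rw [dist_zero_right]
    have hn0 : (0 : ℝ) < n := (by positivity : 0 ≤ ‖x‖ / ε).trans_lt hn
    have h3 := norm_rankOne_le p.1 x
    have h4 : n * (‖p.1.1‖ * ‖p.1.2‖) ≤ 1 := by
      nlinarith [sq_nonneg (‖p.1.1‖ - ‖p.1.2‖)]
    rw [div_lt_iff₀ hε] at hn
    have h5 : n * ‖rankOne M p.1 x‖ < n * ε := by
      calc n * ‖rankOne M p.1 x‖ ≤ n * (‖x‖ * (‖p.1.1‖ * ‖p.1.2‖)) := by gcongr
        _ = ‖x‖ * (n * (‖p.1.1‖ * ‖p.1.2‖)) := by ring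
        _ ≤ ‖x‖ * 1 := by gcongr
        _ < n * ε := by rw [mul_one]; exact hn
    exact lt_of_mul_lt_mul_left h5 hn0.le)
    (fun x hx => (hG2 x fun n p hp => hx ⟨p, Set.mem_iUnion.2 ⟨n, hp⟩⟩).le)
  exact uwCont_of_hasSum (p := fun p : A => p.1) hc (fun p => (hB p).1) (fun p => (hB p).2) hcg

/-- A linear map `L : M → M` is ultraweakly continuous as soon as the functionals `σ (c L ·)` are,
for one faithful normal functional `σ`. On balls, which are compact, these functionals determine
the ultraweak topology. -/
theorem uwContMap_of_faithful {L : M →ₗ[ℂ] M} {σ : M →ₗ[ℂ] ℂ} (hσ : UWCont σ)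
    (hfaith : ∀ x, σ (star x * x) = 0 → x = 0) (hL : ∀ c, UWCont fun m => σ (c * L m)) :
    UWContMap L := by
  have hsep : ∀ a b : M, (∀ c, σ (c * a) = σ (c * b)) → a = b := fun a b h => by
    rw [← sub_eq_zero]
    refine hfaith _ ?_
    rw [mul_sub, map_sub, h, sub_self]
  have hσc : ∀ c, UWCont fun m => σ (c * m) := fun c => hσ.comp (uwContMap_mul_left c)
  have hcont : Continuous L := by
    refine L.continuous_of_seq_closed_graph fun u x y hu hy => hsep _ _ fun c => ?_
    have h1 := ((hσc c).continuous.tendsto y).comp hy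
    have h2 := ((hL c).continuous.tendsto x).comp hu
    exact tendsto_nhds_unique h1 h2
  let L' : M →L[ℂ] M := ⟨L, hcont⟩
  refine uwContMap_iff.2 fun ξ η hξ hη => ?_
  let f : M →ₗ[ℂ] ℂ :=
    { toFun := vecFun ξ η, map_add' := vecFun_add hξ hη, map_smul' := vecFun_smul ξ η }
  refine uwCont_of_continuousOn_ball (g := f ∘ₗ L) fun r => ?_
  let := ultraweak M
  have hball : IsCompact (Metric.closedBall (0 : M) (‖L'‖ * r)) := isCompact_closedBall_ultraweak _
  have hLon : ContinuousOn L (Metric.closedBall 0 r) := by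
    intro x _
    refine hball.le_nhds_of_unique_clusterPt ?_ fun b _ hb => hsep _ _ fun c => ?_
    · refine Filter.mem_map.2 (Filter.mem_of_superset self_mem_nhdsWithin fun y hy => ?_)
      rw [mem_closedBall_zero_iff] at hy
      exact mem_closedBall_zero_iff.2 ((L'.le_opNorm y).trans (by gcongr))
    · have hne : (nhds b ⊓ Filter.map L (nhdsWithin x (Metric.closedBall 0 r))).NeBot := hb
      have h1 : Filter.Tendsto (fun m => σ (c * m))
          (nhds b ⊓ Filter.map L (nhdsWithin x (Metric.closedBall 0 r))) (nhds (σ (c * b))) :=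
        (Continuous.tendsto (hσc c) b).mono_left inf_le_left
      have h2 : Filter.Tendsto (fun m => σ (c * m))
          (nhds b ⊓ Filter.map L (nhdsWithin x (Metric.closedBall 0 r))) (nhds (σ (c * L x))) :=
        Filter.Tendsto.mono_left (Filter.tendsto_map'_iff.2
          ((Continuous.tendsto (hL c) x).mono_left nhdsWithin_le_nhds)) inf_le_right
      exact tendsto_nhds_unique h1 h2
  exact Continuous.comp_continuousOn (g := vecFun ξ η) (f := L) (uwCont_vecFun (M := M) hξ hη) hLon

/-! ### Full ideals and frames -/

/-- An ideal which meets every minimal central summand is everything. -/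
lemma eq_top_of_meets (hfin : IsFiniteVN M) {S : Finset M} (hS : ∀ z ∈ S, IsMinimalCentral z)
    (hS1 : ∑ z ∈ S, z = 1) {J : Submodule ℂ M} (hl : ∀ a, ∀ x ∈ J, a * x ∈ J)
    (hr : ∀ a, ∀ x ∈ J, x * a ∈ J) (h : ∀ z ∈ S, ∃ x ∈ J, z * x ≠ 0) : J = ⊤ := by
  have h1 : (1 : M) ∈ J := by
    rw [← hS1]
    refine J.sum_mem fun z hz => ?_
    obtain ⟨x, hx, hzx⟩ := h z hz
    exact (hS z hz).mem_ideal hfin hl hr hx hzx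
  exact eq_top_iff.2 fun a _ => by simpa using hl a 1 h1

/-- An ultraweakly dense two-sided ideal is everything. This is where finiteness of `M` and of the
dimension of the trace space enter. -/
theorem eq_top_of_dense (hfin : IsFiniteVN M) [FiniteDimensional ℂ (linT M)] {J : Submodule ℂ M}
    (hl : ∀ a, ∀ x ∈ J, a * x ∈ J) (hr : ∀ a, ∀ x ∈ J, x * a ∈ J)
    (hd : @Dense M (ultraweak M) J) : J = ⊤ := by
  obtain ⟨S, hS, -, hS1⟩ := exists_minimal_central_decomposition hfin
  refine eq_top_of_meets hfin hS hS1 hl hr fun z hz => ?_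
  by_contra! hcon
  have hcl : @IsClosed M (ultraweak M) {x | z * x = 0} :=
    isClosed_eq_ultraweak (uwContMap_mul_left z) (uwContMap_const 0)
  have h1 : (1 : M) ∈ {x | z * x = 0} :=
    Set.mem_of_subset_of_mem (@closure_minimal M (ultraweak M) _ _ hcon hcl) (hd 1)
  exact (hS z hz).ne_zero (by simpa using h1)

/-- If the values of an `M`-valued positive sesquilinear form span an improper ideal, then
`∑ i, L (ξ i) (ξ i) = 1` for some finite family: polarize, and divide by the square root of the
resulting invertible sum. -/
theorem exists_frame {E : Type*} [AddCommGroup E] [Module M E] {L : E → E → M}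
    (hadd : ∀ x y z, L (x + y) z = L x z + L y z) (hsmul : ∀ (a : M) x y, L (a • x) y = a * L x y)
    (hstar : ∀ x y, star (L x y) = L y x) (hpos : ∀ x, 0 ≤ L x x)
    (h1 : (1 : M) ∈ Submodule.span ℂ (Set.range fun q : E × E => L q.1 q.2)) :
    ∃ (n : ℕ) (ξ : Fin n → E), ∑ i, L (ξ i) (ξ i) = 1 := by
  obtain ⟨n, c, g, hg⟩ := (Submodule.mem_span_set' (R := ℂ)).1 h1
  choose q hq using fun i => (g i).2
  let x : Fin n → E := fun i => (c i • (1 : M)) • (q i).1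
  let y : Fin n → E := fun i => (q i).2
  have hxy : ∑ i, L (x i) (y i) = 1 := by
    rw [← hg]
    refine Finset.sum_congr rfl fun i _ => ?_
    simp only [x, y, hsmul, smul_mul_assoc, one_mul]
    exact congrArg (c i • ·) (hq i)
  have hyx : ∑ i, L (y i) (x i) = 1 := by
    have := congrArg star hxy
    rw [star_sum, star_one] at this
    rw [← this]
    exact Finset.sum_congr rfl fun i _ => (hstar _ _).symm
  have hneg : ∀ u v w, L (u - v) w = L u w - L v w := fun u v w => by
    rw [eq_sub_iff_add_eq, ← hadd, sub_add_cancel]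
  have hsub : ∀ u v, L (u - v) (u - v) = L u u - L u v - L v u + L v v := fun u v => by
    rw [hneg, ← hstar, hneg, ← hstar (u - v) v, hneg, star_sub, star_sub, hstar, hstar, hstar,
      hstar]
    abel
  obtain ⟨h, hh⟩ : ∃ h, h = ∑ i, (L (x i) (x i) + L (y i) (y i)) := ⟨_, rfl⟩
  -- `2 ≤ h`, since `0 ≤ ∑ i, L (x i - y i) (x i - y i)`; only `1 ≤ h` is needed
  have hle : 1 ≤ h := by
    have : 0 ≤ ∑ i, L (x i - y i) (x i - y i) := Finset.sum_nonneg fun i _ => hpos _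
    simp only [hsub, Finset.sum_add_distrib, Finset.sum_sub_distrib, hxy, hyx] at this
    rw [Finset.sum_add_distrib] at hh
    have e : h - (1 + 1) = ∑ i, L (x i) (x i) - 1 - 1 + ∑ i, L (y i) (y i) := by rw [hh]; abel
    rw [← e, sub_nonneg] at this
    exact (le_add_of_nonneg_left zero_le_one).trans this
  have hsp : IsStrictlyPositive h := IsStrictlyPositive.of_le isStrictlyPositive_one hle
  obtain ⟨r, hr⟩ : ∃ r, r = h ^ (-(1 / 2) : ℝ) := ⟨_, rfl⟩
  have hrs : star r = r := by
    rw [hr]; exact (CFC.rpow_nonneg).isSelfAdjoint.star_eq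
  have hrh : r * h * r = 1 := hr ▸ CFC.conjugate_rpow_neg_one_half h hsp
  have hconj : ∀ z, L (r • z) (r • z) = r * L z z * r := fun z => by
    rw [hsmul, ← hstar, hsmul, star_mul, hstar, hrs, ← mul_assoc]
  refine ⟨n + n, fun i => Sum.elim (fun j => r • x j) (fun j => r • y j)
    (finSumFinEquiv.symm i), ?_⟩
  rw [Equiv.sum_comp finSumFinEquiv.symm (fun s => L (Sum.elim (fun j => r • x j)
    (fun j => r • y j) s) (Sum.elim (fun j => r • x j) (fun j => r • y j) s)),
    Fintype.sum_sum_type]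
  simp only [Sum.elim_inl, Sum.elim_inr, hconj]
  rw [← hrh, hh, ← Finset.sum_add_distrib, Finset.mul_sum, Finset.sum_mul]
  exact Finset.sum_congr rfl fun i _ => by rw [mul_add, add_mul]

/-! ### Self-similar triples: normality and fullness -/

lemma trace_mul_comm_of_trace {k : ℕ} {φ : M →ₗ[ℂ] ℂ} (hφ : ∀ a b, φ (a * b) = φ (b * a))
    (x y : Matrix (Fin k) (Fin k) M) : φ (x * y).trace = φ (y * x).trace := by
  simp only [Matrix.trace, Matrix.diag_apply, Matrix.mul_apply, map_sum]
  rw [Finset.sum_comm]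
  exact Finset.sum_congr rfl fun i _ => Finset.sum_congr rfl fun j _ => hφ _ _

namespace SelfSimilarTriple

variable (t : SelfSimilarTriple M)

lemma exists_Φ_eq (x : Matrix (Fin t.k) (Fin t.k) M) : ∃ a, t.Φ a = t.p * x * t.p := by
  have : t.p * x * t.p ∈ Set.range t.Φ := t.range_eq ▸ ⟨x, rfl⟩
  exact this

lemma p_mul_Φ (a : M) : t.p * t.Φ a = t.Φ a := by
  have : t.Φ a ∈ Set.range fun x : Matrix (Fin t.k) (Fin t.k) M => t.p * x * t.p :=
    t.range_eq ▸ ⟨a, rfl⟩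
  obtain ⟨x, hx⟩ := this
  rw [← hx]
  simp only [← mul_assoc, t.isStarProjection.isIdempotentElem.eq]

lemma Φ_mul_p (a : M) : t.Φ a * t.p = t.Φ a := by
  have h := congrArg star (t.p_mul_Φ (star a))
  rwa [star_mul, ← map_star, star_star, t.isStarProjection.isSelfAdjoint.star_eq] at h

lemma Φ_one : t.Φ 1 = t.p := by
  obtain ⟨a, ha⟩ := t.exists_Φ_eq 1
  rw [mul_one, t.isStarProjection.isIdempotentElem.eq] at ha
  have h1 : t.Φ 1 * t.p = t.p := by rw [← ha, ← map_mul, one_mul]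
  rw [← h1, t.Φ_mul_p]

/-- The compression to the corner followed by the inverse of `Φ`. -/
def inv : Matrix (Fin t.k) (Fin t.k) M →ₗ[ℂ] M where
  toFun x := (t.exists_Φ_eq x).choose
  map_add' x y := t.injective (by
    rw [map_add, (t.exists_Φ_eq _).choose_spec, (t.exists_Φ_eq _).choose_spec,
      (t.exists_Φ_eq _).choose_spec, mul_add, add_mul])
  map_smul' c x := t.injective (by
    rw [map_smul, (t.exists_Φ_eq _).choose_spec, (t.exists_Φ_eq _).choose_spec, mul_smul_comm,
      smul_mul_assoc, RingHom.id_apply])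

lemma Φ_inv (x : Matrix (Fin t.k) (Fin t.k) M) : t.Φ (t.inv x) = t.p * x * t.p :=
  (t.exists_Φ_eq x).choose_spec

lemma inv_Φ (a : M) : t.inv (t.Φ a) = a :=
  t.injective (by rw [t.Φ_inv, t.p_mul_Φ, t.Φ_mul_p])

/-- A minimal central summand which sees `Φ w` does not see `Φ (1 - w)`. -/
lemma mul_Φ_one_sub_eq_zero {z w : M} (hz : IsMinimalCentral z) (hw : ∀ a, w * a = a * w)
    (hww : w * w = w) {i j : Fin t.k} (h : z * t.Φ w i j ≠ 0) (r s : Fin t.k) :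
    z * t.Φ (1 - w) r s = 0 := by
  refine (hz.prime (a := t.Φ w i j) (b := t.Φ (1 - w) r s) fun m => ?_).resolve_left h
  have e1 : t.Φ w * Matrix.single j r m * t.Φ (1 - w) = 0 := by
    have h2 : t.Φ w * Matrix.single j r m * t.Φ (1 - w) =
        t.Φ (w * t.inv (Matrix.single j r m) * (1 - w)) := by
      rw [map_mul, map_mul, t.Φ_inv]
      nth_rw 1 [← t.Φ_mul_p w, ← t.p_mul_Φ (1 - w)]
      simp only [mul_assoc]
    rw [h2, hw, mul_assoc, mul_sub, mul_one, hww, sub_self, mul_zero, map_zero]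
  have e2 : (t.Φ w * (Matrix.single j r m * t.Φ (1 - w))) i s = 0 := by
    rw [← Matrix.mul_assoc, e1, Matrix.zero_apply]
  rw [Matrix.mul_apply] at e2
  rw [mul_assoc, ← e2, Finset.sum_eq_single j]
  · rw [Matrix.single_mul_apply_same]
  · intro b _ hb
    rw [Matrix.single_mul_apply_of_ne _ _ _ _ _ hb, mul_zero]
  · simp

variable [FiniteDimensional ℂ (linT M)]

/-- `Φ` is normal: tested against a faithful trace `τ`, its matrix entries become the trace
`T τ`, which is normal. -/
lemma uwContMap_Φ (hfin : IsFiniteVN M) (i j : Fin t.k) : UWContMap fun m => t.Φ m i j := by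
  obtain ⟨τ, hτ, hfaith⟩ := exists_faithful_trace hfin
  let L : M →ₗ[ℂ] M :=
    { toFun := fun m => t.Φ m i j
      map_add' := fun a b => by rw [map_add]; rfl
      map_smul' := fun c a => by rw [map_smul]; rfl }
  refine uwContMap_of_faithful (L := L) (uwCont_of_mem_linT hfin hτ.mem_linT) hfaith fun c => ?_
  obtain ⟨a, ha⟩ : ∃ a, a = t.inv (Matrix.single j i c) := ⟨_, rfl⟩
  have key : ∀ m, τ (c * L m) = (t.T ⟨τ, hτ.mem_linT⟩).1 (a * m) := by
    intro m
    rw [t.T_apply]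
    have e1 : t.Φ (a * m) = t.p * (Matrix.single j i c * t.Φ m) := by
      rw [map_mul, ha, t.Φ_inv, mul_assoc, t.p_mul_Φ, mul_assoc]
    have e2 : ∑ i, τ (t.Φ (a * m) i i) = τ (t.Φ (a * m)).trace := by
      rw [Matrix.trace, map_sum]; rfl
    rw [e2, e1, trace_mul_comm_of_trace hτ.comm, mul_assoc, t.Φ_mul_p,
      Matrix.trace_single_mul]
    rfl
  simp_rw [key]
  exact (uwCont_of_mem_linT hfin (t.T ⟨τ, hτ.mem_linT⟩).2).comp (uwContMap_mul_left a)

/-- The inverse of `Φ` is normal. -/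
lemma uwContMap_inv_single (hfin : IsFiniteVN M) (i j : Fin t.k) :
    UWContMap fun m => t.inv (Matrix.single i j m) := by
  obtain ⟨τ, hτ, hfaith⟩ := exists_faithful_trace hfin
  let L : M →ₗ[ℂ] M := t.inv ∘ₗ Matrix.singleLinearMap ℂ i j
  have hT : ∀ x, (t.T ⟨τ, hτ.mem_linT⟩).1 x = τ (t.Φ x).trace := fun x => by
    rw [t.T_apply, Matrix.trace, map_sum]; rfl
  refine uwContMap_of_faithful (L := L) (σ := (t.T ⟨τ, hτ.mem_linT⟩).1)
    (uwCont_of_mem_linT hfin (t.T ⟨τ, hτ.mem_linT⟩).2) (fun x hx => ?_) fun c => ?_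
  · rw [t.T_apply, Finset.sum_eq_zero_iff_of_nonneg] at hx
    · refine t.injective ?_
      rw [map_zero]
      ext1 r s
      have h1 := hx s (Finset.mem_univ s)
      simp only [map_mul, map_star, Matrix.mul_apply, Matrix.star_apply, map_sum] at h1
      rw [Finset.sum_eq_zero_iff_of_nonneg fun r _ => hτ.nonneg _] at h1
      exact hfaith _ (h1 r (Finset.mem_univ r))
    · intro s _
      simp only [map_mul, map_star, Matrix.mul_apply, Matrix.star_apply, map_sum]
      exact Finset.sum_nonneg fun r _ => hτ.nonneg _
  · have key : ∀ m, (t.T ⟨τ, hτ.mem_linT⟩).1 (c * L m) = τ (t.Φ c j i * m) := by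
      intro m
      rw [hT, map_mul]
      change τ (t.Φ c * t.Φ (t.inv (Matrix.single i j m))).trace = _
      rw [t.Φ_inv, ← mul_assoc, ← mul_assoc, t.Φ_mul_p, trace_mul_comm_of_trace hτ.comm,
        ← mul_assoc, t.p_mul_Φ, Matrix.trace_mul_single]
      rfl
    simp_rw [key]
    exact (uwCont_of_mem_linT hfin hτ.mem_linT).comp (uwContMap_mul_left _)

/-- The corner is full: the entries of `p` generate `M` as an ideal. There are as many minimal
central projections in the corner as in `M`, so the corner meets every minimal summand. -/
theorem entries_full (hfin : IsFiniteVN M) {J : Submodule ℂ M} (hl : ∀ a, ∀ x ∈ J, a * x ∈ J)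
    (hr : ∀ a, ∀ x ∈ J, x * a ∈ J) (hp : ∀ i j, t.p i j ∈ J) : J = ⊤ := by
  obtain ⟨S, hS, horth, hS1⟩ := exists_minimal_central_decomposition hfin
  have hex : ∀ w : S, ∃ z : S, ∃ i j, (z : M) * t.Φ w i j ≠ 0 := by
    intro w
    by_contra! hcon
    refine (hS w w.2).ne_zero (t.injective ?_)
    rw [map_zero]
    ext1 i j
    rw [← one_mul (t.Φ w i j), ← hS1, Finset.sum_mul]
    exact Finset.sum_eq_zero fun z hz => hcon ⟨z, hz⟩ i j
  -- each minimal central `w` is sent to a summand `s w` which sees `Φ w`; distinct `w` go to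
  -- distinct summands, so every summand is reached
  choose s i j hs using hex
  have hinj : Function.Injective s := by
    intro w w' hww
    by_contra hne
    refine hs w' ?_
    have h1 : (w' : M) = (1 - w) * w' := by
      rw [sub_mul, one_mul, horth w w.2 w' w'.2 (fun h => hne (Subtype.ext h)), sub_zero]
    rw [h1, map_mul, Matrix.mul_apply, Finset.mul_sum]
    refine Finset.sum_eq_zero fun r _ => ?_
    rw [← mul_assoc, ← hww, t.mul_Φ_one_sub_eq_zero (hS (s w) (s w).2) (hS w w.2).comm
      (hS w w.2).isStarProjection.isIdempotentElem (hs w), zero_mul]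
  have hsurj := Finite.injective_iff_surjective.1 hinj
  refine eq_top_of_meets hfin hS hS1 hl hr fun z hz => ?_
  obtain ⟨w, hw⟩ := hsurj ⟨z, hz⟩
  have h1 := hs w
  rw [hw, ← t.p_mul_Φ, Matrix.mul_apply] at h1
  by_contra! hcon
  refine h1 ?_
  rw [Finset.mul_sum]
  exact Finset.sum_eq_zero fun r _ => by rw [← mul_assoc, hcon _ (hp _ _), zero_mul]

end SelfSimilarTriple

/-! ### Inner products with values in `M` -/

/-- Cauchy–Schwarz inequality for an `M`-valued inner product. -/
lemma norm_inner_mul_le {E : Type*} [AddCommGroup E] [Module Mᵐᵒᵖ E] {r : E → E → M}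
    (hadd : ∀ x y z, r x (y + z) = r x y + r x z)
    (hsmul : ∀ x y (b : M), r x (MulOpposite.op b • y) = r x y * b)
    (hstar : ∀ x y, star (r x y) = r y x) (hpos : ∀ x, 0 ≤ r x x) (x y : E) :
    ‖r x y‖ ^ 2 ≤ ‖r x x‖ * ‖r y y‖ := by
  obtain ⟨b, hb⟩ : ∃ b, b = r x y := ⟨_, rfl⟩
  have hb' : r y x = star b := by rw [hb, hstar]
  have hsub : ∀ u v w, r u (v - w) = r u v - r u w := fun u v w => by
    rw [eq_sub_iff_add_eq, ← hadd, sub_add_cancel]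
  have hsubl : ∀ u v w, r (v - w) u = r v u - r w u := fun u v w => by
    rw [← hstar, hsub, star_sub, hstar, hstar]
  have hsmull : ∀ u v (c : M), r (MulOpposite.op c • u) v = star c * r u v := fun u v c => by
    rw [← hstar, hsmul, star_mul, hstar]
  rw [← hb]
  refine le_of_forall_pos_le_add fun δ hδ => ?_
  -- the summand with `δ` keeps `A` positive when `r x x = 0`
  obtain ⟨A, hA⟩ : ∃ A, A = ‖r x x‖ + δ / (‖r y y‖ + 1) := ⟨_, rfl⟩
  have hA1 : ‖r x x‖ ≤ A := by rw [hA]; exact le_add_of_nonneg_right (by positivity)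
  have hA0 : 0 < A := by rw [hA]; positivity
  -- expand `0 ≤ r (y - x w) (y - x w)` with `w = A⁻¹ r(x, y)`
  have h1 : star b * b ≤ A • r y y := by
    have h2 := hpos (y - MulOpposite.op (A⁻¹ • b) • x)
    have e : r (y - MulOpposite.op (A⁻¹ • b) • x) (y - MulOpposite.op (A⁻¹ • b) • x)
        = r y y - A⁻¹ • (star b * b) - A⁻¹ • (star b * b) +
          A⁻¹ • A⁻¹ • (star b * r x x * b) := by
      simp only [hsub, hsmul, hsubl, hsmull, ← hb, hb', star_smul, star_trivial, smul_mul_assoc,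
        mul_smul_comm, smul_sub, sub_mul, mul_assoc]
      abel
    rw [e] at h2
    have h3 : A⁻¹ • A⁻¹ • (star b * r x x * b) ≤ A⁻¹ • (star b * b) := by
      refine smul_le_smul_of_nonneg_left ?_ (by positivity)
      rw [inv_smul_le_iff_of_pos hA0]
      exact (CStarAlgebra.star_left_conjugate_le_norm_smul (hb := (hpos x).isSelfAdjoint)).trans
        (smul_le_smul_of_nonneg_right hA1 (star_mul_self_nonneg b))
    have h4 : A⁻¹ • (star b * b) ≤ r y y := by
      rw [← sub_nonneg]
      refine h2.trans ?_
      have := add_le_add_right h3 (r y y - A⁻¹ • (star b * b) - A⁻¹ • (star b * b))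
      exact this.trans_eq (by abel)
    exact (inv_smul_le_iff_of_pos hA0).1 h4
  have h5 := CStarAlgebra.norm_le_norm_of_nonneg_of_le (ha := star_mul_self_nonneg b) h1
  rw [CStarRing.norm_star_mul_self, norm_smul, Real.norm_of_nonneg hA0.le] at h5
  calc ‖b‖ ^ 2 ≤ A * ‖r y y‖ := by rw [sq]; exact h5
    _ = ‖r x x‖ * ‖r y y‖ + δ * (‖r y y‖ / (‖r y y‖ + 1)) := by rw [hA]; ring
    _ ≤ ‖r x x‖ * ‖r y y‖ + δ * 1 := by
      gcongr
      rw [div_le_one (by positivity)]; linarith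
    _ = _ := by rw [mul_one]

namespace EquivBimodule

lemma rInner_add_left (X : EquivBimodule M) (x y z : X.carrier) :
    X.rInner (x + y) z = X.rInner x z + X.rInner y z := by
  rw [← X.star_rInner, X.rInner_add, star_add, X.star_rInner, X.star_rInner]

lemma rInner_smul_left (X : EquivBimodule M) (x y : X.carrier) (b : M) :
    X.rInner (MulOpposite.op b • x) y = star b * X.rInner x y := by
  rw [← X.star_rInner, X.rInner_smul, star_mul, X.star_rInner]

lemma rInner_csmul_left (X : EquivBimodule M) (x y : X.carrier) (c : ℂ) :
    X.rInner (c • x) y = starRingEnd ℂ c • X.rInner x y := by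
  rw [← X.star_rInner, X.rInner_csmul, star_smul, X.star_rInner]; rfl

lemma lInner_add_right (X : EquivBimodule M) (x y z : X.carrier) :
    X.lInner x (y + z) = X.lInner x y + X.lInner x z := by
  rw [← X.star_lInner, X.lInner_add, star_add, X.star_lInner, X.star_lInner]

lemma lInner_smul_right (X : EquivBimodule M) (x y : X.carrier) (a : M) :
    X.lInner x (a • y) = X.lInner x y * star a := by
  rw [← X.star_lInner, X.lInner_smul, star_mul, X.star_lInner]

lemma csmul_eq_smul (X : EquivBimodule M) (c : ℂ) (x : X.carrier) : c • x = (c • (1 : M)) • x := by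
  rw [smul_assoc, one_smul]

lemma csmul_eq_op_smul (X : EquivBimodule M) (c : ℂ) (x : X.carrier) :
    c • x = MulOpposite.op (c • (1 : M)) • x := by
  rw [MulOpposite.op_smul, smul_assoc]; simp

/-- The underlying set of the dual bimodule of `X`, as a separate type which does not inherit the
scalar actions of `X`. -/
def DualCarrier (X : EquivBimodule M) : Type u := X.carrier

namespace DualCarrier

variable (X : EquivBimodule M)

instance : NormedAddCommGroup X.DualCarrier := X.normedAddCommGroup

instance : CompleteSpace X.DualCarrier := X.completeSpace

instance : Module ℂ X.DualCarrier := Module.compHom X.carrier (starRingEnd ℂ)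

instance : Module M X.DualCarrier :=
  Module.compHom X.carrier (starRingEquiv (R := M)).toRingHom

instance : Module Mᵐᵒᵖ X.DualCarrier :=
  Module.compHom X.carrier ((starRingEquiv (R := Mᵐᵒᵖ)).trans
    (RingEquiv.opOp M).symm).toRingHom

variable {X}

/-- The identity map from the dual of `X` to `X`. -/
def out (x : X.DualCarrier) : X.carrier := x

lemma out_csmul (c : ℂ) (x : X.DualCarrier) : out (c • x) = starRingEnd ℂ c • out x := rfl

lemma out_smul (a : M) (x : X.DualCarrier) :
    out (a • x) = MulOpposite.op (star a) • out x := rfl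

lemma out_op_smul (b : Mᵐᵒᵖ) (x : X.DualCarrier) : out (b • x) = star b.unop • out x := rfl

lemma out_add (x y : X.DualCarrier) : out (x + y) = out x + out y := rfl

lemma norm_out (x : X.DualCarrier) : ‖out x‖ = ‖x‖ := rfl

lemma out_injective : Function.Injective (out (X := X)) := fun _ _ h => h

instance : NormedSpace ℂ X.DualCarrier where
  norm_smul_le c x := by
    rw [← norm_out, out_csmul, norm_smul, RCLike.norm_conj, norm_out]

instance : IsScalarTower ℂ M X.DualCarrier := ⟨fun c a x => out_injective (by
  rw [out_smul, out_csmul, out_smul, star_smul, MulOpposite.op_smul, smul_assoc]; rfl)⟩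

instance : IsScalarTower ℂ Mᵐᵒᵖ X.DualCarrier := ⟨fun c a x => out_injective (by
  rw [out_op_smul, out_csmul, out_op_smul, MulOpposite.unop_smul, star_smul, smul_assoc]; rfl)⟩

instance : SMulCommClass M Mᵐᵒᵖ X.DualCarrier := ⟨fun a b x => out_injective (by
  rw [out_smul, out_op_smul, out_op_smul, out_smul]; exact (smul_comm _ _ _).symm)⟩

end DualCarrier

open DualCarrier in
/-- The dual bimodule of `X`: the same set, with scalars acting through their adjoints from the
other side and with the two inner products exchanged. -/
def dual (X : EquivBimodule M) : EquivBimodule M where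
  carrier := X.DualCarrier
  rInner x y := X.lInner (out x) (out y)
  lInner x y := X.rInner (out x) (out y)
  rInner_add x y z := by rw [out_add, X.lInner_add_right]
  rInner_smul x y b := by
    rw [out_op_smul, X.lInner_smul_right, star_star, MulOpposite.unop_op]
  star_rInner x y := X.star_lInner _ _
  rInner_self x := X.lInner_self _
  norm_rInner x := by rw [← norm_out, X.norm_lInner]
  rInner_adjoint a x y := by rw [out_smul, out_smul, X.lInner_adjoint]
  lInner_add x y z := by rw [out_add, X.rInner_add_left]
  lInner_smul a x y := by rw [out_smul, X.rInner_smul_left, star_star]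
  star_lInner x y := X.star_rInner _ _
  lInner_self x := X.rInner_self _
  norm_lInner x := by rw [← norm_out, X.norm_rInner]
  lInner_adjoint x y b := by
    rw [out_op_smul, out_op_smul, X.rInner_adjoint]; rfl
  lInner_smul_eq x y z := out_injective (by
    rw [out_smul, out_op_smul, X.star_rInner, MulOpposite.unop_op, X.star_lInner,
      X.lInner_smul_eq])
  dense_rInner := X.dense_lInner
  dense_lInner := X.dense_rInner
  normal_left x y := by
    have h : UWContMap fun m => star (X.lInner (MulOpposite.op (star m) • out y) (out x)) :=
      uwContMap_star.comp (UWContMap.comp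
        (K := fun m => X.lInner (MulOpposite.op m • out y) (out x))
        (X.normal_right (out y) (out x)) uwContMap_star)
    simp_rw [X.star_lInner] at h
    exact h
  normal_right x y := by
    have h : UWContMap fun m => star (X.rInner (out y) (star m • out x)) :=
      uwContMap_star.comp (UWContMap.comp (K := fun m => X.rInner (out y) (m • out x))
        (X.normal_left (out y) (out x)) uwContMap_star)
    simp_rw [X.star_rInner] at h
    exact h

lemma rInner_self_nonneg (X : EquivBimodule M) (x : X.carrier) : 0 ≤ X.rInner x x :=
  exists_star_mul_self_iff.1 (X.rInner_self x)

lemma lInner_self_nonneg (X : EquivBimodule M) (x : X.carrier) : 0 ≤ X.lInner x x :=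
  exists_star_mul_self_iff.1 (X.lInner_self x)

lemma norm_rInner_le (X : EquivBimodule M) (x y : X.carrier) :
    ‖X.rInner x y‖ ≤ ‖x‖ * ‖y‖ := by
  have h := norm_inner_mul_le X.rInner_add X.rInner_smul X.star_rInner X.rInner_self_nonneg x y
  rw [← X.norm_rInner, ← X.norm_rInner, ← mul_pow] at h
  exact (sq_le_sq₀ (norm_nonneg _) (by positivity)).1 h

lemma continuous_rInner (X : EquivBimodule M) :
    Continuous fun q : X.carrier × X.carrier => X.rInner q.1 q.2 := by
  let B : X.carrier →L⋆[ℂ] X.carrier →L[ℂ] M := LinearMap.mkContinuous₂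
    (LinearMap.mk₂'ₛₗ (starRingEnd ℂ) (RingHom.id ℂ) X.rInner X.rInner_add_left
      (fun c x y => X.rInner_csmul_left x y c) X.rInner_add
      (fun c x y => X.rInner_csmul x y c)) 1
    (fun x y => by rw [one_mul]; exact X.norm_rInner_le x y)
  exact (B.continuous.comp continuous_fst).clm_apply continuous_snd

lemma continuous_lInner (X : EquivBimodule M) :
    Continuous fun q : X.carrier × X.carrier => X.lInner q.1 q.2 :=
  X.dual.continuous_rInner

lemma eq_zero_of_rInner (X : EquivBimodule M) {x : X.carrier} (h : ∀ y, X.rInner y x = 0) :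
    x = 0 := by
  have := X.norm_rInner x
  rw [h x, norm_zero] at this
  simpa using this

lemma eq_of_rInner (X : EquivBimodule M) {x y : X.carrier}
    (h : ∀ z, X.rInner z x = X.rInner z y) : x = y := by
  rw [← sub_eq_zero]
  refine X.eq_zero_of_rInner fun z => ?_
  have := X.rInner_add z (x - y) y
  rw [sub_add_cancel, h z] at this
  simpa using this

lemma eq_of_lInner (X : EquivBimodule M) {x y : X.carrier}
    (h : ∀ z, X.lInner z x = X.lInner z y) : x = y :=
  X.dual.eq_of_rInner h

/-- A bijection preserving both inner products automatically respects both actions. -/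
def Iso.ofInner {X Y : EquivBimodule M} (e : X.carrier ≃ₗ[ℂ] Y.carrier)
    (hl : ∀ x y, Y.lInner (e x) (e y) = X.lInner x y)
    (hr : ∀ x y, Y.rInner (e x) (e y) = X.rInner x y) : Iso X Y where
  toEquiv := e
  map_left a x := Y.eq_of_lInner fun z => by
    obtain ⟨z, rfl⟩ := e.surjective z
    rw [hl, X.lInner_smul_right, Y.lInner_smul_right, hl]
  map_right b x := Y.eq_of_rInner fun z => by
    obtain ⟨z, rfl⟩ := e.surjective z
    rw [hr, X.rInner_smul, Y.rInner_smul, hr]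
  map_lInner := hl
  map_rInner := hr

lemma rInner_linearCombination {X Z : EquivBimodule M} {I : Type*} {α : I → X.carrier}
    {γ : I → Z.carrier} (h : ∀ i j, X.rInner (α i) (α j) = Z.rInner (γ i) (γ j))
    (f g : I →₀ ℂ) : Z.rInner (Finsupp.linearCombination ℂ γ f) (Finsupp.linearCombination ℂ γ g) =
      X.rInner (Finsupp.linearCombination ℂ α f) (Finsupp.linearCombination ℂ α g) := by
  have hz : ∀ (X : EquivBimodule M) (x : X.carrier), X.rInner 0 x = 0 := fun X x => by
    rw [← X.star_rInner, X.rInner_zero, star_zero]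
  induction f using Finsupp.induction_linear with
  | zero => simp [hz]
  | add f f' h1 h2 => rw [map_add, map_add, rInner_add_left, rInner_add_left, h1, h2]
  | single i c =>
    induction g using Finsupp.induction_linear with
    | zero => simp [rInner_zero]
    | add g g' h1 h2 => rw [map_add, map_add, rInner_add, rInner_add, h1, h2]
    | single j d =>
      simp only [Finsupp.linearCombination_single, rInner_csmul, rInner_csmul_left, h]

/-- Two bimodules with total families having the same Gram matrices are isomorphic. -/
theorem nonempty_iso_of_gram {X Z : EquivBimodule M} {I : Type*} {α : I → X.carrier}
    {γ : I → Z.carrier} (hr : ∀ i j, X.rInner (α i) (α j) = Z.rInner (γ i) (γ j))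
    (hl : ∀ i j, X.lInner (α i) (α j) = Z.lInner (γ i) (γ j))
    (hα : Dense (Submodule.span ℂ (Set.range α) : Set X.carrier))
    (hγ : Dense (Submodule.span ℂ (Set.range γ) : Set Z.carrier)) : Nonempty (Iso X Z) := by
  have hα' : DenseRange (Finsupp.linearCombination ℂ α) := by
    rw [← Finsupp.range_linearCombination] at hα; exact hα
  have hγ' : DenseRange (Finsupp.linearCombination ℂ γ) := by
    rw [← Finsupp.range_linearCombination] at hγ; exact hγ
  let e : X.carrier ≃ₗᵢ[ℂ] Z.carrier := (LinearEquiv.refl ℂ (I →₀ ℂ)).extendOfIsometry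
    (Finsupp.linearCombination ℂ α) (Finsupp.linearCombination ℂ γ) hα' hγ' fun f => by
      rw [← sq_eq_sq₀ (norm_nonneg _) (norm_nonneg _), Z.norm_rInner, X.norm_rInner]
      exact congrArg norm (rInner_linearCombination hr f f)
  have he : ∀ f, e (Finsupp.linearCombination ℂ α f) = Finsupp.linearCombination ℂ γ f := fun f =>
    LinearEquiv.extendOfIsometry_eq _ _ _ _ _ _ f
  refine ⟨Iso.ofInner e.toLinearEquiv (fun x y => ?_) (fun x y => ?_)⟩
  · refine hα'.induction_on₂ (p := fun x y => Z.lInner (e x) (e y) = X.lInner x y)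
      (isClosed_eq (Z.continuous_lInner.comp
        ((e.continuous.comp continuous_fst).prodMk (e.continuous.comp continuous_snd)))
        X.continuous_lInner) (fun f g => ?_) x y
    rw [he, he]
    -- the left inner products are the right inner products of the dual bimodules
    have h1 := rInner_linearCombination (X := X.dual) (Z := Z.dual) hl
      (f.mapRange (starRingEnd ℂ) (map_zero _)) (g.mapRange (starRingEnd ℂ) (map_zero _))
    have h2 : ∀ (X : EquivBimodule M) (α : I → X.carrier) (f : I →₀ ℂ),
        Finsupp.linearCombination ℂ (M := X.dual.carrier) α
          (f.mapRange (starRingEnd ℂ) (map_zero _)) = Finsupp.linearCombination ℂ α f := by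
      intro X α f
      induction f using Finsupp.induction_linear with
      | zero => simp; rfl
      | add f g hf hg =>
        rw [Finsupp.mapRange_add (by simp), map_add, map_add, hf, hg]; rfl
      | single i c =>
        rw [Finsupp.mapRange_single]
        refine (Finsupp.linearCombination_single ℂ (M := X.dual.carrier)
          (starRingEnd ℂ c) i).trans ?_
        rw [Finsupp.linearCombination_single]
        change starRingEnd ℂ (starRingEnd ℂ c) • α i = _
        rw [Complex.conj_conj]
    rw [h2, h2, h2, h2] at h1
    exact h1
  · refine hα'.induction_on₂ (p := fun x y => Z.rInner (e x) (e y) = X.rInner x y)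
      (isClosed_eq (Z.continuous_rInner.comp
        ((e.continuous.comp continuous_fst).prodMk (e.continuous.comp continuous_snd)))
        X.continuous_rInner) (fun f g => ?_) x y
    rw [he, he]
    exact rInner_linearCombination hr f g

end EquivBimodule

/-! ### Finite bases -/

namespace EquivBimodule

lemma span_lInner (hfin : IsFiniteVN M) [FiniteDimensional ℂ (linT M)] (X : EquivBimodule M) :
    Submodule.span ℂ (Set.range fun q : X.carrier × X.carrier => X.lInner q.1 q.2) = ⊤ := by
  refine eq_top_of_dense hfin (fun a x hx => ?_) (fun a x hx => ?_) X.dense_lInner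
  · induction hx using Submodule.span_induction with
    | mem x hx =>
      obtain ⟨q, rfl⟩ := hx
      exact Submodule.subset_span ⟨(a • q.1, q.2), X.lInner_smul a _ _⟩
    | zero => rw [mul_zero]; exact zero_mem _
    | add x y _ _ hx hy => rw [mul_add]; exact add_mem hx hy
    | smul c x _ hx => rw [mul_smul_comm]; exact Submodule.smul_mem _ c hx
  · induction hx using Submodule.span_induction with
    | mem x hx =>
      obtain ⟨q, rfl⟩ := hx
      refine Submodule.subset_span ⟨(q.1, star a • q.2), ?_⟩
      exact (X.lInner_smul_right _ _ _).trans (by rw [star_star])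
    | zero => rw [zero_mul]; exact zero_mem _
    | add x y _ _ hx hy => rw [add_mul]; exact add_mem hx hy
    | smul c x _ hx => rw [smul_mul_assoc]; exact Submodule.smul_mem _ c hx

lemma span_rInner (hfin : IsFiniteVN M) [FiniteDimensional ℂ (linT M)] (X : EquivBimodule M) :
    Submodule.span ℂ (Set.range fun q : X.carrier × X.carrier => X.rInner q.1 q.2) = ⊤ :=
  X.dual.span_lInner hfin

lemma isRightBasis_of_sum_eq_one {X : EquivBimodule M} {n : ℕ} {ξ : Fin n → X.carrier}
    (h : ∑ i, X.lInner (ξ i) (ξ i) = 1) : X.IsRightBasis ξ := fun x => by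
  simp_rw [← X.lInner_smul_eq]
  rw [← Finset.sum_smul, h, one_smul]

/-- The inner products span a dense, hence improper, ideal, which yields a frame. -/
lemma exists_sum_lInner_eq_one (hfin : IsFiniteVN M) [FiniteDimensional ℂ (linT M)]
    (X : EquivBimodule M) :
    ∃ (n : ℕ) (ξ : Fin n → X.carrier), ∑ i, X.lInner (ξ i) (ξ i) = 1 :=
  exists_frame X.lInner_add X.lInner_smul X.star_lInner X.lInner_self_nonneg
    (by rw [X.span_lInner hfin]; trivial)

lemma hasRightBasis (hfin : IsFiniteVN M) [FiniteDimensional ℂ (linT M)] (X : EquivBimodule M) :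
    X.HasRightBasis := by
  obtain ⟨n, ξ, hξ⟩ := X.exists_sum_lInner_eq_one hfin
  exact ⟨n, ξ, isRightBasis_of_sum_eq_one hξ⟩

lemma R_self : (self M).R = 1 := by
  have h : (self M).IsRightBasis fun _ : Fin 1 => (1 : M) :=
    isRightBasis_of_sum_eq_one (by simp [self])
  refine LinearMap.ext fun φ => Subtype.ext (LinearMap.ext fun a => ?_)
  rw [R_apply _ h, Fin.sum_univ_one]
  change φ.1 (star 1 * (a * 1)) = φ.1 a
  rw [star_one, one_mul, mul_one]

/-! ### Internal tensor products -/

lemma norm_smul_carrier_le (X : EquivBimodule M) (a : M) (x : X.carrier) :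
    ‖a • x‖ ≤ ‖a‖ * ‖x‖ := by
  refine (sq_le_sq₀ (norm_nonneg _) (by positivity)).1 ?_
  rw [X.norm_lInner, X.lInner_smul, X.lInner_smul_right, mul_pow, X.norm_lInner]
  calc ‖a * (X.lInner x x * star a)‖ ≤ ‖a‖ * (‖X.lInner x x‖ * ‖star a‖) :=
        (norm_mul_le _ _).trans (by gcongr; exact norm_mul_le _ _)
    _ = _ := by rw [norm_star]; ring

namespace IsInternalTensor

variable {X Y Z W V U : EquivBimodule M} {t : X.carrier → Y.carrier → Z.carrier}

lemma norm_le (h : IsInternalTensor X Y Z t) (x : X.carrier) (y : Y.carrier) :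
    ‖t x y‖ ≤ ‖x‖ * ‖y‖ := by
  refine (sq_le_sq₀ (norm_nonneg _) (by positivity)).1 ?_
  rw [Z.norm_rInner, h.rInner_eq]
  calc _ ≤ ‖y‖ * ‖X.rInner x x • y‖ := Y.norm_rInner_le _ _
    _ ≤ ‖y‖ * (‖X.rInner x x‖ * ‖y‖) := by gcongr; exact Y.norm_smul_carrier_le _ _
    _ = _ := by rw [← X.norm_rInner]; ring

/-- The elementary tensors as a bounded bilinear map. -/
def bilin (h : IsInternalTensor X Y Z t) : X.carrier →L[ℂ] Y.carrier →L[ℂ] Z.carrier :=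
  LinearMap.mkContinuous₂ (LinearMap.mk₂ ℂ t h.add_left
    (fun c x y => by rw [csmul_eq_smul, h.smul_left, ← csmul_eq_smul]) h.add_right
    (fun c x y => by rw [csmul_eq_op_smul, h.smul_right, ← csmul_eq_op_smul])) 1
    (fun x y => by rw [one_mul]; exact h.norm_le x y)

/-- Total families in the factors give a total family in the tensor product. -/
lemma dense_of_dense (h : IsInternalTensor X Y Z t) {I J : Type*} {α : I → X.carrier}
    {β : J → Y.carrier} (hα : Dense (Submodule.span ℂ (Set.range α) : Set X.carrier))
    (hβ : Dense (Submodule.span ℂ (Set.range β) : Set Y.carrier)) :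
    Dense (Submodule.span ℂ (Set.range fun q : I × J => t (α q.1) (β q.2)) : Set Z.carrier) := by
  obtain ⟨S, hS⟩ : ∃ S, S = (Submodule.span ℂ
    (Set.range fun q : I × J => t (α q.1) (β q.2))).topologicalClosure := ⟨_, rfl⟩
  have hcl : IsClosed (S : Set Z.carrier) := by
    rw [hS]; exact Submodule.isClosed_topologicalClosure _
  have h1 : ∀ i y, t (α i) y ∈ S := by
    intro i y
    have hle : Submodule.span ℂ (Set.range β) ≤ S.comap (h.bilin (α i)).toLinearMap :=
      Submodule.span_le.2 (by
        rintro _ ⟨j, rfl⟩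
        change t (α i) (β j) ∈ S
        rw [hS]
        exact Submodule.le_topologicalClosure _ (Submodule.subset_span ⟨(i, j), rfl⟩))
    exact (hcl.preimage (h.bilin (α i)).continuous).closure_subset_iff.2 hle (hβ y)
  have h2 : ∀ x y, t x y ∈ S := by
    intro x y
    have hle : Submodule.span ℂ (Set.range α) ≤ S.comap (h.bilin.flip y).toLinearMap :=
      Submodule.span_le.2 (by
        rintro _ ⟨i, rfl⟩
        exact h1 i y)
    exact (hcl.preimage (h.bilin.flip y).continuous).closure_subset_iff.2 hle (hα x)
  intro z
  have h3 : Submodule.span ℂ (Set.range fun q : X.carrier × Y.carrier => t q.1 q.2) ≤ S :=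
    Submodule.span_le.2 (by rintro _ ⟨q, rfl⟩; exact h2 _ _)
  have h4 : z ∈ S := hcl.closure_subset_iff.2 h3 (h.dense z)
  rw [hS] at h4
  exact h4

lemma dense_of_surjective {X : EquivBimodule M} {I : Type*} {α : I → X.carrier}
    (h : Function.Surjective α) : Dense (Submodule.span ℂ (Set.range α) : Set X.carrier) := by
  rw [h.range_eq, Submodule.span_univ]
  exact dense_univ

/-- The internal tensor product is unique, and depends only on the classes of its factors. -/
lemma nonempty_iso {X' Y' Z' : EquivBimodule M} {t' : X'.carrier → Y'.carrier → Z'.carrier}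
    (h : IsInternalTensor X Y Z t) (h' : IsInternalTensor X' Y' Z' t') (e : Iso X X')
    (f : Iso Y Y') : Nonempty (Iso Z Z') := by
  refine nonempty_iso_of_gram (I := X.carrier × Y.carrier) (α := fun q => t q.1 q.2)
    (γ := fun q => t' (e.toEquiv q.1) (f.toEquiv q.2)) (fun p q => ?_) (fun p q => ?_) h.dense
    (h'.dense_of_dense (dense_of_surjective e.toEquiv.surjective)
      (dense_of_surjective f.toEquiv.surjective))
  · rw [h.rInner_eq, h'.rInner_eq, e.map_rInner, ← f.map_left, f.map_rInner]
  · rw [h.lInner_eq, h'.lInner_eq, f.map_lInner, ← e.map_right, e.map_lInner]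

/-- The internal tensor product is associative: both sides have the total family `x ⊗ y ⊗ w`, with
the same Gram matrices. -/
lemma nonempty_assoc {t₁ : X.carrier → Y.carrier → Z.carrier}
    {t₂ : Z.carrier → W.carrier → V.carrier} {V' : EquivBimodule M}
    {t₃ : Y.carrier → W.carrier → U.carrier} {t₄ : X.carrier → U.carrier → V'.carrier}
    (h₁ : IsInternalTensor X Y Z t₁) (h₂ : IsInternalTensor Z W V t₂)
    (h₃ : IsInternalTensor Y W U t₃) (h₄ : IsInternalTensor X U V' t₄) :
    Nonempty (Iso V V') := by
  have hid : ∀ X : EquivBimodule M,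
      Dense (Submodule.span ℂ (Set.range fun x : X.carrier => x) : Set X.carrier) :=
    fun X => dense_of_surjective Function.surjective_id
  have hα := h₂.dense_of_dense (I := X.carrier × Y.carrier) (J := W.carrier)
    (α := fun q => t₁ q.1 q.2) (β := fun w => w) h₁.dense (hid W)
  have hγ := h₄.dense_of_dense (I := X.carrier) (J := Y.carrier × W.carrier)
    (α := fun x => x) (β := fun q => t₃ q.1 q.2) (hid X) h₃.dense
  refine nonempty_iso_of_gram (α := fun q : (X.carrier × Y.carrier) × W.carrier =>
    t₂ (t₁ q.1.1 q.1.2) q.2) (γ := fun q => t₄ q.1.1 (t₃ q.1.2 q.2))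
    (fun p q => ?_) (fun p q => ?_) hα ?_
  · rw [h₂.rInner_eq, h₁.rInner_eq, h₄.rInner_eq, ← h₃.smul_left, h₃.rInner_eq]
  · rw [h₂.lInner_eq, ← h₁.smul_right, h₁.lInner_eq, h₄.lInner_eq, h₃.lInner_eq]
  · have hrange : Set.range (fun q : (X.carrier × Y.carrier) × W.carrier =>
        t₄ q.1.1 (t₃ q.1.2 q.2)) =
        Set.range fun q : X.carrier × Y.carrier × W.carrier => t₄ q.1 (t₃ q.2.1 q.2.2) :=
      (Equiv.prodAssoc X.carrier Y.carrier W.carrier).surjective.range_comp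
        (fun q => t₄ q.1 (t₃ q.2.1 q.2.2))
    rw [hrange]
    exact hγ

/-- `M ⊗ X = X`. -/
lemma self_left (X : EquivBimodule M) :
    IsInternalTensor (self M) X X (fun (a : M) x => a • x) where
  add_left := fun (a b : M) x => add_smul a b x
  add_right := fun (a : M) x y => smul_add a x y
  balanced := fun (a b : M) x => mul_smul a b x
  smul_left := fun (a b : M) x => mul_smul a b x
  smul_right := fun (a b : M) x => smul_comm a (MulOpposite.op b) x
  rInner_eq := fun (a a' : M) x x' => by
    change X.rInner (a • x) (a' • x') = X.rInner x ((star a * a') • x')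
    rw [X.rInner_adjoint, ← mul_smul]
  lInner_eq := fun (a a' : M) x x' => by
    change X.lInner (a • x) (a' • x') = a * X.lInner x x' * star a'
    rw [X.lInner_smul, X.lInner_smul_right, ← mul_assoc]
  dense := by
    refine dense_of_surjective fun x => ⟨((1 : M), x), one_smul M x⟩

open DualCarrier in
/-- The dual of `X` is a left inverse of `X`: the elementary tensor of `x` and `y` is `⟨x, y⟩`. -/
lemma dual_left (hfin : IsFiniteVN M) [FiniteDimensional ℂ (linT M)] (X : EquivBimodule M) :
    IsInternalTensor X.dual X (self M) (fun x y => X.rInner (out x) y) where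
  add_left x x' y := X.rInner_add_left _ _ _
  add_right x y y' := X.rInner_add _ _ _
  balanced x a y := (X.rInner_adjoint (star a) x y).trans (by rw [star_star]; rfl)
  smul_left a x y := (X.rInner_smul_left x y (star a)).trans (by rw [star_star]; rfl)
  smul_right x b y := X.rInner_smul _ _ _
  rInner_eq := fun (x x' : X.carrier) y y' => by
    change star (X.rInner x y) * X.rInner x' y' = X.rInner y (X.lInner x x' • y')
    rw [X.lInner_smul_eq, X.rInner_smul, X.star_rInner]
  lInner_eq := fun (x x' : X.carrier) y y' => by
    change X.rInner x y * star (X.rInner x' y') = X.rInner (star (X.lInner y y') • x) x'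
    rw [X.rInner_adjoint, star_star, X.lInner_smul_eq, X.rInner_smul, X.star_rInner]
  dense := by
    have h := X.span_rInner hfin
    change Dense (Submodule.span ℂ
      (Set.range fun q : X.carrier × X.carrier => X.rInner q.1 q.2) : Set M)
    rw [h]
    exact dense_univ

/-- If `ξ` and `η` are bases of `X` and `Y`, then the vectors `ξ i ⊗ η j` are a basis of
`X ⊗ Y`. -/
lemma R_eq_mul (hfin : IsFiniteVN M) [FiniteDimensional ℂ (linT M)]
    (h : IsInternalTensor X Y Z t) : Z.R = X.R * Y.R := by
  obtain ⟨m, ξ, hξ⟩ := X.exists_sum_lInner_eq_one hfin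
  obtain ⟨n, η, hη⟩ := Y.exists_sum_lInner_eq_one hfin
  have hl0 : ∀ x, X.lInner 0 x = 0 := fun x => by simpa using X.lInner_add 0 0 x
  have hζ : Z.IsRightBasis fun q : Fin (m * n) =>
      t (ξ (finProdFinEquiv.symm q).1) (η (finProdFinEquiv.symm q).2) := by
    refine isRightBasis_of_sum_eq_one ?_
    rw [← finProdFinEquiv.sum_comp]
    simp only [Equiv.symm_apply_apply, h.lInner_eq]
    rw [Fintype.sum_prod_type]
    simp only
    rw [← hξ]
    refine Finset.sum_congr rfl fun i _ => ?_
    have hs : ∀ s : Finset (Fin n),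
        ∑ j ∈ s, X.lInner (MulOpposite.op (Y.lInner (η j) (η j)) • ξ i) (ξ i) =
          X.lInner (MulOpposite.op (∑ j ∈ s, Y.lInner (η j) (η j)) • ξ i) (ξ i) := by
      intro s
      classical
      induction s using Finset.induction_on with
      | empty => simp [hl0]
      | insert j s hj ih =>
        rw [Finset.sum_insert hj, Finset.sum_insert hj, ih, MulOpposite.op_add, add_smul,
          X.lInner_add]
    rw [hs, hη, MulOpposite.op_one, one_smul]
  refine LinearMap.ext fun φ => Subtype.ext (LinearMap.ext fun a => ?_)
  rw [Z.R_apply hζ, ← finProdFinEquiv.sum_comp, Module.End.mul_apply,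
    X.R_apply (isRightBasis_of_sum_eq_one hξ), Fintype.sum_prod_type]
  refine Finset.sum_congr rfl fun i _ => ?_
  rw [Y.R_apply (isRightBasis_of_sum_eq_one hη)]
  refine Finset.sum_congr rfl fun j _ => ?_
  simp only [Equiv.symm_apply_apply]
  rw [← h.smul_left, h.rInner_eq]

end IsInternalTensor

end EquivBimodule

/-! ### Columns with entries in a bimodule -/

open scoped Matrix.Module

namespace EquivBimodule

variable (Y : EquivBimodule M) {k : ℕ}

lemma lInner_zero_left (y : Y.carrier) : Y.lInner 0 y = 0 := by
  simpa using Y.lInner_add 0 0 y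

lemma lInner_sum_left {ι : Type*} (s : Finset ι) (x : ι → Y.carrier) (y : Y.carrier) :
    Y.lInner (∑ i ∈ s, x i) y = ∑ i ∈ s, Y.lInner (x i) y :=
  map_sum (AddMonoidHom.mk' (Y.lInner · y) fun a b => Y.lInner_add a b y) x s

lemma rInner_sum_left {ι : Type*} (s : Finset ι) (x : ι → Y.carrier) (y : Y.carrier) :
    Y.rInner (∑ i ∈ s, x i) y = ∑ i ∈ s, Y.rInner (x i) y :=
  map_sum (AddMonoidHom.mk' (Y.rInner · y) fun a b => Y.rInner_add_left a b y) x s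

lemma continuous_smul_left (a : M) : Continuous fun y : Y.carrier => a • y :=
  AddMonoidHomClass.continuous_of_bound (DistribSMul.toAddMonoidHom Y.carrier a) ‖a‖
    (Y.norm_smul_carrier_le a)

/-- The right inner product `∑ i, ⟨y i, z i⟩` of columns. -/
def colR (y z : Fin k → Y.carrier) : M := ∑ i, Y.rInner (y i) (z i)

/-- The matrix of the left inner products of the entries of two columns. -/
def gram (y z : Fin k → Y.carrier) : Matrix (Fin k) (Fin k) M :=
  Matrix.of fun i j => Y.lInner (y i) (z j)

variable {Y}

lemma colR_add (x y z : Fin k → Y.carrier) : Y.colR x (y + z) = Y.colR x y + Y.colR x z := by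
  simp [colR, Y.rInner_add, Finset.sum_add_distrib]

lemma colR_op_smul (x y : Fin k → Y.carrier) (b : M) :
    Y.colR x (MulOpposite.op b • y) = Y.colR x y * b := by
  simp [colR, Y.rInner_smul, Finset.sum_mul]

lemma star_colR (x y : Fin k → Y.carrier) : star (Y.colR x y) = Y.colR y x := by
  simp [colR, Y.star_rInner]

lemma colR_self_nonneg (x : Fin k → Y.carrier) : 0 ≤ Y.colR x x :=
  Finset.sum_nonneg fun i _ => Y.rInner_self_nonneg (x i)

lemma norm_rInner_apply_le (x : Fin k → Y.carrier) (i : Fin k) :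
    ‖Y.rInner (x i) (x i)‖ ≤ ‖Y.colR x x‖ :=
  CStarAlgebra.norm_le_norm_of_nonneg_of_le (ha := Y.rInner_self_nonneg (x i))
    (Finset.single_le_sum (f := fun i => Y.rInner (x i) (x i))
      (fun i _ => Y.rInner_self_nonneg (x i)) (Finset.mem_univ i))

lemma eq_zero_of_colR_self {x : Fin k → Y.carrier} (h : Y.colR x x = 0) : x = 0 := by
  funext i
  have h1 := norm_rInner_apply_le x i
  rw [h, norm_zero, ← Y.norm_rInner] at h1
  exact norm_eq_zero.1 (pow_eq_zero_iff two_ne_zero |>.1 (h1.antisymm (by positivity)))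

lemma colR_smul_left (A : Matrix (Fin k) (Fin k) M) (y z : Fin k → Y.carrier) :
    Y.colR (A • y) z = Y.colR y (star A • z) := by
  simp only [colR, Matrix.Module.smul_apply, rInner_sum_left, rInner_sum, Y.rInner_adjoint,
    Matrix.star_apply]
  exact Finset.sum_comm

lemma gram_add_left (x y z : Fin k → Y.carrier) : Y.gram (x + y) z = Y.gram x z + Y.gram y z := by
  ext1 i j
  exact Y.lInner_add _ _ _

lemma star_gram (y z : Fin k → Y.carrier) : star (Y.gram y z) = Y.gram z y := by
  ext1 i j
  exact Y.star_lInner _ _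

lemma gram_smul_left (A : Matrix (Fin k) (Fin k) M) (y z : Fin k → Y.carrier) :
    Y.gram (A • y) z = A * Y.gram y z := by
  ext1 i j
  simp only [gram, Matrix.of_apply, Matrix.Module.smul_apply, lInner_sum_left, Matrix.mul_apply,
    Y.lInner_smul]

lemma gram_smul_right (A : Matrix (Fin k) (Fin k) M) (y z : Fin k → Y.carrier) :
    Y.gram y (A • z) = Y.gram y z * star A := by
  rw [← star_gram, gram_smul_left, star_mul, star_gram]

lemma gram_op_smul (x y : Fin k → Y.carrier) (b : M) :
    Y.gram (MulOpposite.op b • x) y = Y.gram x (MulOpposite.op (star b) • y) := by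
  ext1 i j
  exact Y.lInner_adjoint _ _ _

lemma gram_smul (x y z : Fin k → Y.carrier) :
    Y.gram x y • z = MulOpposite.op (Y.colR y z) • x := by
  funext i
  simp only [gram, Matrix.Module.smul_apply, Matrix.of_apply, Y.lInner_smul_eq, Pi.smul_apply,
    colR]
  rw [← Finset.sum_smul, Finset.op_sum]

lemma matrix_smul_op_smul (A : Matrix (Fin k) (Fin k) M) (b : Mᵐᵒᵖ) (y : Fin k → Y.carrier) :
    A • b • y = b • A • y := by
  funext i
  simp only [Matrix.Module.smul_apply, Pi.smul_apply, Finset.smul_sum]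
  exact Finset.sum_congr rfl fun j _ => smul_comm _ _ _

lemma matrix_csmul_smul (c : ℂ) (A : Matrix (Fin k) (Fin k) M) (y : Fin k → Y.carrier) :
    (c • A) • y = c • A • y := by
  funext i
  simp only [Matrix.Module.smul_apply, Pi.smul_apply, Finset.smul_sum, Matrix.smul_apply,
    smul_assoc]

lemma colR_single (y : Fin k → Y.carrier) (i : Fin k) (m : Y.carrier) :
    Y.colR (Pi.single i m) y = Y.rInner m (y i) := by
  have hz : ∀ x, Y.rInner 0 x = 0 := fun x => by rw [← Y.star_rInner, Y.rInner_zero, star_zero]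
  rw [colR, Fintype.sum_eq_single i fun j hj => by rw [Pi.single_eq_of_ne hj, hz],
    Pi.single_eq_same]

lemma gram_single (i j : Fin k) (m m' : Y.carrier) :
    Y.gram (Pi.single i m) (Pi.single j m') = Matrix.single i j (Y.lInner m m') := by
  have hz : ∀ x, Y.lInner x 0 = 0 := fun x => by
    rw [← Y.star_lInner, Y.lInner_zero_left, star_zero]
  ext1 a b
  rw [gram, Matrix.of_apply, Matrix.single_apply]
  split_ifs with h
  · obtain ⟨rfl, rfl⟩ := h
    rw [Pi.single_eq_same, Pi.single_eq_same]
  · rcases eq_or_ne a i with rfl | ha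
    · rw [Pi.single_eq_of_ne (M := fun _ => Y.carrier) (fun hb : b = j => h ⟨rfl, hb.symm⟩) m', hz]
    · rw [Pi.single_eq_of_ne ha, Y.lInner_zero_left]

end EquivBimodule

namespace SelfSimilarTriple

variable (t : SelfSimilarTriple M) (Y : EquivBimodule M)

lemma inv_mul (a : M) (x : Matrix (Fin t.k) (Fin t.k) M) : t.inv (t.Φ a * x) = a * t.inv x :=
  t.injective (by
    rw [t.Φ_inv, map_mul, t.Φ_inv, ← mul_assoc, t.p_mul_Φ, ← mul_assoc, ← mul_assoc, t.Φ_mul_p])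

lemma inv_star (x : Matrix (Fin t.k) (Fin t.k) M) : t.inv (star x) = star (t.inv x) :=
  t.injective (by
    rw [t.Φ_inv, map_star, t.Φ_inv, star_mul, star_mul,
      t.isStarProjection.isSelfAdjoint.star_eq, mul_assoc])

/-- The columns with entries in `Y` which are fixed by `p`. -/
def cornerSubmodule : Submodule Mᵐᵒᵖ (Fin t.k → Y.carrier) where
  carrier := {y | t.p • y = y}
  add_mem' {x y} hx hy := by
    change t.p • (x + y) = x + y
    rw [smul_add]
    exact congrArg₂ _ hx hy
  zero_mem' := smul_zero t.p
  smul_mem' b y hy := (EquivBimodule.matrix_smul_op_smul _ _ _).trans (congrArg (b • ·) hy)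

/-- The columns with entries in `Y` which are fixed by `p`, as a type which carries the norm of a
Hilbert module instead of the supremum norm. -/
def Corner : Type u := t.cornerSubmodule Y

namespace Corner

instance : AddCommGroup (t.Corner Y) := inferInstanceAs (AddCommGroup (t.cornerSubmodule Y))

instance : Module ℂ (t.Corner Y) := inferInstanceAs (Module ℂ (t.cornerSubmodule Y))

instance : Module Mᵐᵒᵖ (t.Corner Y) := inferInstanceAs (Module Mᵐᵒᵖ (t.cornerSubmodule Y))

instance : IsScalarTower ℂ Mᵐᵒᵖ (t.Corner Y) :=
  inferInstanceAs (IsScalarTower ℂ Mᵐᵒᵖ (t.cornerSubmodule Y))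

variable {t Y}

/-- The entries of an element of the corner. -/
def val (y : t.Corner Y) : Fin t.k → Y.carrier := Subtype.val y

/-- A column fixed by `p` as an element of the corner. -/
def mk (y : Fin t.k → Y.carrier) (hy : t.p • y = y) : t.Corner Y := ⟨y, hy⟩

lemma val_mk (y : Fin t.k → Y.carrier) (hy : t.p • y = y) : (mk y hy).val = y := rfl

lemma p_smul_val (y : t.Corner Y) : t.p • y.val = y.val := y.2

lemma val_injective : Function.Injective (val (t := t) (Y := Y)) := Subtype.val_injective

lemma val_add (x y : t.Corner Y) : (x + y).val = x.val + y.val := rfl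

lemma val_zero : (0 : t.Corner Y).val = 0 := rfl

lemma val_op_smul (b : Mᵐᵒᵖ) (y : t.Corner Y) : (b • y).val = b • y.val := rfl

lemma val_csmul (c : ℂ) (y : t.Corner Y) : (c • y).val = c • y.val := rfl

lemma p_smul_Φ_smul (a : M) (y : Fin t.k → Y.carrier) : t.p • t.Φ a • y = t.Φ a • y := by
  rw [← mul_smul, t.p_mul_Φ]

instance : Module M (t.Corner Y) where
  smul a y := mk (t.Φ a • y.val) (p_smul_Φ_smul a _)
  one_smul y := val_injective (by
    change t.Φ 1 • y.val = _
    rw [t.Φ_one, y.p_smul_val])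
  mul_smul a b y := val_injective (by
    change t.Φ (a * b) • y.val = t.Φ a • t.Φ b • y.val
    rw [map_mul, mul_smul])
  smul_zero a := val_injective (smul_zero (t.Φ a))
  smul_add a x y := val_injective (smul_add (t.Φ a) x.val y.val)
  add_smul a b y := val_injective (by
    change t.Φ (a + b) • y.val = t.Φ a • y.val + t.Φ b • y.val
    rw [map_add, add_smul])
  zero_smul y := val_injective (by
    change t.Φ 0 • y.val = 0
    rw [map_zero, zero_smul])

lemma val_smul (a : M) (y : t.Corner Y) : (a • y).val = t.Φ a • y.val := rfl

instance : IsScalarTower ℂ M (t.Corner Y) := ⟨fun c a y => val_injective (by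
  rw [val_smul, val_csmul, val_smul, map_smul, EquivBimodule.matrix_csmul_smul])⟩

instance : SMulCommClass M Mᵐᵒᵖ (t.Corner Y) := ⟨fun a b y => val_injective (by
  rw [val_smul, val_op_smul, val_op_smul, val_smul, EquivBimodule.matrix_smul_op_smul])⟩

/-! ### The norm of a corner module -/

instance : Norm (t.Corner Y) := ⟨fun y => √‖Y.colR y.val y.val‖⟩

lemma norm_sq (y : t.Corner Y) : ‖y‖ ^ 2 = ‖Y.colR y.val y.val‖ := Real.sq_sqrt (norm_nonneg _)

lemma norm_nonneg' (y : t.Corner Y) : 0 ≤ ‖y‖ := Real.sqrt_nonneg _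

lemma norm_colR_le (x y : t.Corner Y) : ‖Y.colR x.val y.val‖ ≤ ‖x‖ * ‖y‖ := by
  refine (sq_le_sq₀ (norm_nonneg _) (mul_nonneg x.norm_nonneg' y.norm_nonneg')).1 ?_
  rw [mul_pow, norm_sq, norm_sq]
  exact norm_inner_mul_le (r := Y.colR) EquivBimodule.colR_add EquivBimodule.colR_op_smul
    EquivBimodule.star_colR EquivBimodule.colR_self_nonneg x.val y.val

lemma core : NormedSpace.Core ℂ (t.Corner Y) where
  norm_nonneg := norm_nonneg'
  norm_smul c y := by
    refine (sq_eq_sq₀ (norm_nonneg' _) (mul_nonneg (norm_nonneg _) y.norm_nonneg')).1 ?_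
    rw [mul_pow, norm_sq, norm_sq, val_csmul]
    have h : Y.colR (c • y.val) (c • y.val) = c • starRingEnd ℂ c • Y.colR y.val y.val := by
      simp only [EquivBimodule.colR, Pi.smul_apply, Y.rInner_csmul, Y.rInner_csmul_left,
        Finset.smul_sum]
    rw [h, norm_smul, norm_smul, RCLike.norm_conj]
    ring
  norm_triangle x y := by
    refine (sq_le_sq₀ (norm_nonneg' _) (add_nonneg x.norm_nonneg' y.norm_nonneg')).1 ?_
    have h : Y.colR (x + y).val (x + y).val = Y.colR x.val x.val + Y.colR x.val y.val +
        (Y.colR y.val x.val + Y.colR y.val y.val) := by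
      rw [val_add, EquivBimodule.colR_add, ← EquivBimodule.star_colR,
        ← EquivBimodule.star_colR y.val (x.val + y.val), EquivBimodule.colR_add,
        EquivBimodule.colR_add, star_add, star_add]
      simp only [EquivBimodule.star_colR]
      abel
    rw [norm_sq, h]
    calc _ ≤ ‖Y.colR x.val x.val‖ + ‖Y.colR x.val y.val‖ +
          (‖Y.colR y.val x.val‖ + ‖Y.colR y.val y.val‖) :=
          (norm_add_le _ _).trans (add_le_add (norm_add_le _ _) (norm_add_le _ _))
      _ ≤ ‖x‖ ^ 2 + ‖x‖ * ‖y‖ + (‖y‖ * ‖x‖ + ‖y‖ ^ 2) := by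
        rw [norm_sq, norm_sq]
        gcongr <;> exact norm_colR_le _ _
      _ = _ := by ring
  norm_eq_zero_iff y := by
    rw [← pow_eq_zero_iff two_ne_zero, norm_sq, norm_eq_zero]
    refine ⟨fun h => val_injective (EquivBimodule.eq_zero_of_colR_self h), fun h => ?_⟩
    rw [h, val_zero]
    simp [EquivBimodule.colR, EquivBimodule.rInner_zero]

instance : NormedAddCommGroup (t.Corner Y) := NormedAddCommGroup.ofCore core

instance : NormedSpace ℂ (t.Corner Y) := NormedSpace.ofCore core

/-- The norm of the corner is equivalent to the supremum norm on columns. -/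
instance : CompleteSpace (t.Corner Y) := by
  let S : Submodule ℂ (Fin t.k → Y.carrier) := (t.cornerSubmodule Y).restrictScalars ℂ
  have hS : IsClosed (S : Set (Fin t.k → Y.carrier)) := by
    refine isClosed_eq (continuous_pi fun i => continuous_finsetSum _ fun j _ => ?_) continuous_id
    exact (Y.continuous_smul_left _).comp (continuous_apply j)
  have : CompleteSpace S := hS.completeSpace_coe
  let e : t.Corner Y ≃ₗ[ℂ] S :=
    { toFun := fun y => ⟨y.val, y.p_smul_val⟩
      invFun := fun y => mk y.1 y.2
      map_add' := fun _ _ => rfl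
      map_smul' := fun _ _ => rfl
      left_inv := fun _ => rfl
      right_inv := fun _ => rfl }
  let f : t.Corner Y ≃L[ℂ] S := e.toContinuousLinearEquivOfBounds 1 (t.k + 1)
    (fun y => by
      rw [one_mul]
      change ‖y.val‖ ≤ ‖y‖
      refine (pi_norm_le_iff_of_nonneg (norm_nonneg _)).2 fun i => ?_
      refine (sq_le_sq₀ (norm_nonneg _) (norm_nonneg _)).1 ?_
      rw [norm_sq, Y.norm_rInner]
      exact EquivBimodule.norm_rInner_apply_le _ _)
    (fun y => by
      change ‖mk y.1 y.2‖ ≤ (t.k + 1) * ‖y.1‖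
      refine (sq_le_sq₀ (norm_nonneg _) (by positivity)).1 ?_
      rw [norm_sq]
      change ‖Y.colR y.1 y.1‖ ≤ _
      calc ‖Y.colR y.1 y.1‖ ≤ ∑ i : Fin t.k, ‖y.1‖ ^ 2 := by
            refine (norm_sum_le _ _).trans (Finset.sum_le_sum fun i _ => ?_)
            rw [← Y.norm_rInner]
            exact pow_le_pow_left₀ (norm_nonneg _) (norm_le_pi_norm y.1 i) 2
        _ = t.k * ‖y.1‖ ^ 2 := by simp
        _ ≤ (t.k + 1) ^ 2 * ‖y.1‖ ^ 2 := by
          gcongr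
          have : (0 : ℝ) ≤ t.k := Nat.cast_nonneg _
          nlinarith
        _ = _ := by ring)
  exact (completeSpace_congr (e := f.toEquiv) f.isUniformEmbedding).2 this

end Corner

end SelfSimilarTriple

/-! ### The bimodule of a self-similar triple with coefficients in a bimodule -/

open EquivBimodule

/-- If `x` and `s` are the two inner products of one vector, then `x * x ≤ ‖s‖ • x`, and so
`‖x‖ ≤ ‖s‖`. -/
lemma norm_le_of_mul_self_le {x s : M} (hx : 0 ≤ x) (h : x * x ≤ ‖s‖ • x) : ‖x‖ ≤ ‖s‖ := by
  have h0 : 0 ≤ x * x := hx.isSelfAdjoint.mul_self_nonneg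
  have h1 := CStarAlgebra.norm_le_norm_of_nonneg_of_le (ha := h0) h
  rw [hx.isSelfAdjoint.norm_mul_self, norm_smul, norm_norm, sq] at h1
  rcases (norm_nonneg x).eq_or_lt with h2 | h2
  · rw [← h2]; exact norm_nonneg _
  · exact le_of_mul_le_mul_right h1 h2

namespace SelfSimilarTriple

variable {t : SelfSimilarTriple M} {Y : EquivBimodule M}

namespace Corner

/-- The left inner product of the corner: the matrix of left inner products lies in the corner
`p M_k(M) p`, and so comes from an element of `M`. -/
def left (x y : t.Corner Y) : M := t.inv (Y.gram x.val y.val)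

lemma Φ_left (x y : t.Corner Y) : t.Φ (left x y) = Y.gram x.val y.val := by
  rw [left, t.Φ_inv, ← gram_smul_left, x.p_smul_val]
  nth_rewrite 1 [← t.isStarProjection.isSelfAdjoint.star_eq]
  rw [← gram_smul_right, y.p_smul_val]

lemma left_add (x y z : t.Corner Y) : left (x + y) z = left x z + left y z := by
  rw [left, val_add, gram_add_left, map_add]; rfl

lemma left_smul (a : M) (x y : t.Corner Y) : left (a • x) y = a * left x y := by
  rw [left, val_smul, gram_smul_left, t.inv_mul]; rfl

lemma star_left (x y : t.Corner Y) : star (left x y) = left y x := by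
  rw [left, ← t.inv_star, star_gram]; rfl

lemma left_smul_right (a : M) (x y : t.Corner Y) : left x (a • y) = left x y * star a := by
  rw [← star_left, left_smul, star_mul, star_left]

lemma left_op_smul (x y : t.Corner Y) (b : M) :
    left (MulOpposite.op b • x) y = left x (MulOpposite.op (star b) • y) := by
  rw [left, val_op_smul, gram_op_smul]; rfl

lemma left_smul_eq (x y z : t.Corner Y) :
    left x y • z = MulOpposite.op (Y.colR y.val z.val) • x := val_injective (by
  rw [val_smul, val_op_smul, Φ_left, gram_smul])

/-- A positive element of `M` has positive diagonal entries under `Φ`. -/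
lemma Φ_apply_self_nonneg {a : M} (ha : 0 ≤ a) (i : Fin t.k) : 0 ≤ t.Φ a i i := by
  obtain ⟨b, rfl⟩ := exists_star_mul_self_iff.2 ha
  rw [map_mul, map_star, Matrix.mul_apply]
  exact Finset.sum_nonneg fun j _ => star_mul_self_nonneg _

/-- With `g` the negative part of `h = left y y`, the diagonal of `Φ (left (g y) (g y))` is
positive, while that of `Φ (g h g) = - Φ (g ^ 3)` is negative; hence `g y = 0` and `g = 0`. -/
lemma left_self_nonneg (y : t.Corner Y) : 0 ≤ left y y := by
  have hsa : IsSelfAdjoint (left y y) := star_left y y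
  obtain ⟨g, hg⟩ : ∃ g, g = (left y y)⁻ := ⟨_, rfl⟩
  have hg0 : 0 ≤ g := hg ▸ CFC.negPart_nonneg _
  have hgh : g * left y y = - (g * g) := by
    rw [← CFC.posPart_sub_negPart (left y y) hsa, mul_sub, ← hg]
    rw [hg, CFC.negPart_mul_posPart, zero_sub]
  have h1 : left (g • y) (g • y) = - (star g * g * g) := by
    rw [left_smul, left_smul_right, hg0.isSelfAdjoint.star_eq, ← mul_assoc, hgh, neg_mul]
  have h2 : g • y = 0 := by
    refine val_injective (funext fun i => ?_)
    have h3 : Y.lInner ((g • y).val i) ((g • y).val i) = - t.Φ (star g * g * g) i i := by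
      have := congrFun (congrFun (Φ_left (g • y) (g • y)) i) i
      rw [h1, map_neg] at this
      exact this.symm
    have h4 : Y.lInner ((g • y).val i) ((g • y).val i) = 0 := by
      refine le_antisymm ?_ (Y.lInner_self_nonneg _)
      rw [h3, neg_nonpos]
      exact Φ_apply_self_nonneg (star_left_conjugate_nonneg hg0 g) i
    have h5 := Y.norm_lInner ((g • y).val i)
    rw [h4, norm_zero] at h5
    exact norm_eq_zero.1 ((pow_eq_zero_iff two_ne_zero).1 h5)
  have h6 : g * g = 0 := by
    have h7 : left (g • y) y = 0 := by
      rw [left, h2]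
      have : Y.gram (0 : t.Corner Y).val y.val = 0 := by
        ext1 i j
        exact Y.lInner_zero_left _
      rw [this, map_zero]
    rwa [left_smul, hgh, neg_eq_zero] at h7
  have h8 : g = 0 := by
    have := CStarRing.norm_star_mul_self (x := g)
    rw [hg0.isSelfAdjoint.star_eq, h6, norm_zero] at this
    exact norm_eq_zero.1 (mul_self_eq_zero.1 this.symm)
  rw [← CFC.posPart_sub_negPart (left y y) hsa, ← hg, h8, sub_zero]
  exact CFC.posPart_nonneg _

lemma colR_smul_left' (a : M) (x y : t.Corner Y) :
    Y.colR (a • x).val y.val = Y.colR x.val (star a • y).val := by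
  rw [val_smul, colR_smul_left, ← map_star]; rfl

lemma colR_op_smul' (b : M) (x y : t.Corner Y) :
    Y.colR x.val (MulOpposite.op b • y).val = Y.colR x.val y.val * b := by
  rw [val_op_smul, colR_op_smul]

/-- `‖s‖ - s = c* c` for `0 ≤ s`. -/
lemma exists_norm_smul_one_sub {s : M} (hs : 0 ≤ s) : ∃ c : M, ‖s‖ • (1 : M) - s = star c * c := by
  rw [exists_star_mul_self_iff, sub_nonneg, ← Algebra.algebraMap_eq_smul_one]
  exact IsSelfAdjoint.le_algebraMap_norm_self hs.isSelfAdjoint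

lemma real_smul_one_smul (c : ℝ) (y : t.Corner Y) :
    (c • (1 : M)) • y = MulOpposite.op (c • (1 : M)) • y := by
  rw [← Complex.coe_smul, smul_assoc, one_smul, MulOpposite.op_smul, smul_assoc,
    MulOpposite.op_one, one_smul]

/-- Both inner products of `y` have the same norm, because `left y y` acts on `y` as the right inner
product does. -/
lemma norm_left_self (y : t.Corner Y) : ‖left y y‖ = ‖Y.colR y.val y.val‖ := by
  obtain ⟨l, hl⟩ : ∃ l, l = left y y := ⟨_, rfl⟩
  obtain ⟨r, hr⟩ : ∃ r, r = Y.colR y.val y.val := ⟨_, rfl⟩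
  have hl0 : 0 ≤ l := hl ▸ left_self_nonneg y
  have hr0 : 0 ≤ r := hr ▸ colR_self_nonneg _
  have hlr : l • y = MulOpposite.op r • y := by rw [hl, hr]; exact left_smul_eq y y y
  rw [← hl, ← hr]
  refine le_antisymm (norm_le_of_mul_self_le hl0 ?_) (norm_le_of_mul_self_le hr0 ?_)
  · obtain ⟨c, hc⟩ := exists_norm_smul_one_sub hr0
    have h1 : 0 ≤ left (MulOpposite.op (star c) • y) (MulOpposite.op (star c) • y) :=
      left_self_nonneg _
    have h2 : MulOpposite.op (star c * c) • y = (‖r‖ • (1 : M) - l) • y := by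
      rw [← hc, MulOpposite.op_sub, sub_smul, sub_smul, hlr, real_smul_one_smul]
    rw [← star_left, left_op_smul, star_star, ← mul_smul, ← MulOpposite.op_mul, star_left, h2,
      left_smul, ← hl, sub_mul, smul_mul_assoc, one_mul, sub_nonneg] at h1
    exact h1
  · obtain ⟨c, hc⟩ := exists_norm_smul_one_sub hl0
    have h1 : 0 ≤ Y.colR (c • y).val (c • y).val := colR_self_nonneg _
    have h2 : (star c * c) • y = MulOpposite.op (‖l‖ • (1 : M) - r) • y := by
      rw [← hc, MulOpposite.op_sub, sub_smul, sub_smul, hlr, real_smul_one_smul]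
    rw [colR_smul_left', ← mul_smul, h2, colR_op_smul', ← hr, mul_sub, mul_smul_comm, mul_one,
      sub_nonneg] at h1
    exact h1

/-- The column `p e_i ⊗ m` of the corner. -/
def col (i : Fin t.k) (m : Y.carrier) : t.Corner Y :=
  mk (t.p • Pi.single i m) (by rw [← mul_smul, t.isStarProjection.isIdempotentElem.eq])

lemma colR_col (i j : Fin t.k) (m m' : Y.carrier) :
    Y.colR (col (t := t) i m).val (col j m').val = Y.rInner m (t.p i j • m') := by
  rw [col, col, val_mk, val_mk, colR_smul_left, t.isStarProjection.isSelfAdjoint.star_eq,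
    ← mul_smul, t.isStarProjection.isIdempotentElem.eq, colR_single, Matrix.Module.smul_apply,
    Fintype.sum_eq_single j fun l hl => by rw [Pi.single_eq_of_ne hl, smul_zero],
    Pi.single_eq_same]

lemma left_col (i j : Fin t.k) (m m' : Y.carrier) :
    left (col (t := t) i m) (col j m') = t.inv (Matrix.single i j (Y.lInner m m')) :=
  t.injective (by
    rw [Φ_left, col, col, val_mk, val_mk, gram_smul_left, gram_smul_right,
      t.isStarProjection.isSelfAdjoint.star_eq, gram_single, t.Φ_inv, mul_assoc])

/-- Fullness on the right: the coefficients of `p` generate `M` as an ideal. -/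
lemma span_colR (hfin : IsFiniteVN M) [FiniteDimensional ℂ (linT M)] :
    Submodule.span ℂ (Set.range fun q : t.Corner Y × t.Corner Y =>
      Y.colR q.1.val q.2.val) = ⊤ := by
  obtain ⟨J, hJ⟩ : ∃ J, J = Submodule.span ℂ (Set.range fun q : t.Corner Y × t.Corner Y =>
      Y.colR q.1.val q.2.val) := ⟨_, rfl⟩
  -- the coefficients `x` for which all `⟨m, x m'⟩` lie in the span form an ideal
  let K : Submodule ℂ M :=
    { carrier := {x | ∀ m m' : Y.carrier, Y.rInner m (x • m') ∈ J}
      add_mem' := fun {x y} hx hy m m' => by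
        rw [add_smul, Y.rInner_add]; exact add_mem (hx m m') (hy m m')
      zero_mem' := fun m m' => by rw [zero_smul, Y.rInner_zero]; exact zero_mem _
      smul_mem' := fun c x hx m m' => by
        rw [smul_assoc, Y.rInner_csmul]; exact Submodule.smul_mem _ c (hx m m') }
  have hK : K = ⊤ := by
    refine t.entries_full hfin (fun a x hx m m' => ?_) (fun a x hx m m' => ?_)
      fun i j m m' => ?_
    · have := hx (star a • m) m'
      rwa [Y.rInner_adjoint, star_star, ← mul_smul] at this
    · rw [mul_smul]; exact hx m (a • m')
    · rw [hJ, ← colR_col]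
      exact Submodule.subset_span ⟨(col i m, col j m'), rfl⟩
  rw [← hJ, eq_top_iff, ← Y.span_rInner hfin, Submodule.span_le]
  rintro _ ⟨q, rfl⟩
  have h1 : (1 : M) ∈ K := hK ▸ Submodule.mem_top
  have h2 := h1 q.1 q.2
  rwa [one_smul] at h2

/-- Fullness on the left: `left` takes the values `Φ⁻¹ (p (x e_ij) p)` with `x` an inner product of
`Y`. -/
lemma span_left (hfin : IsFiniteVN M) [FiniteDimensional ℂ (linT M)] :
    Submodule.span ℂ (Set.range fun q : t.Corner Y × t.Corner Y => left q.1 q.2) = ⊤ := by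
  obtain ⟨J, hJ⟩ : ∃ J, J = Submodule.span ℂ
      (Set.range fun q : t.Corner Y × t.Corner Y => left q.1 q.2) := ⟨_, rfl⟩
  have h1 : ∀ (i j : Fin t.k) (x : M), t.inv (Matrix.single i j x) ∈ J := by
    intro i j x
    have hle : Submodule.span ℂ (Set.range fun q : Y.carrier × Y.carrier => Y.lInner q.1 q.2) ≤
        J.comap (t.inv ∘ₗ Matrix.singleLinearMap ℂ i j) := Submodule.span_le.2 (by
      rintro _ ⟨q, rfl⟩
      change t.inv (Matrix.single i j (Y.lInner q.1 q.2)) ∈ J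
      rw [hJ, ← left_col]
      exact Submodule.subset_span ⟨(col i q.1, col j q.2), rfl⟩)
    rw [Y.span_lInner hfin] at hle
    exact hle Submodule.mem_top
  rw [← hJ, eq_top_iff]
  intro a _
  rw [← t.inv_Φ a, Matrix.matrix_eq_sum_single (t.Φ a), map_sum]
  refine Submodule.sum_mem _ fun i _ => ?_
  rw [map_sum]
  exact Submodule.sum_mem _ fun j _ => h1 i j _

lemma uwContMap_colR (hfin : IsFiniteVN M) [FiniteDimensional ℂ (linT M)] (x y : t.Corner Y) :
    UWContMap fun m => Y.colR x.val (m • y).val := by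
  have h : UWContMap fun m => ∑ i, ∑ j, Y.rInner (x.val i) (t.Φ m i j • y.val j) :=
    UWContMap.sum fun i => UWContMap.sum fun j =>
      UWContMap.comp (K := fun m => Y.rInner (x.val i) (m • y.val j)) (Y.normal_left _ _)
        (t.uwContMap_Φ hfin i j)
  simp_rw [← rInner_sum] at h
  exact h

lemma uwContMap_left (hfin : IsFiniteVN M) [FiniteDimensional ℂ (linT M)] (x y : t.Corner Y) :
    UWContMap fun m => left (MulOpposite.op m • x) y := by
  have h : UWContMap fun m => ∑ i, ∑ j,
      t.inv (Matrix.single i j (Y.lInner (MulOpposite.op m • x.val i) (y.val j))) :=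
    UWContMap.sum fun i => UWContMap.sum fun j =>
      (t.uwContMap_inv_single hfin i j).comp (Y.normal_right _ _)
  simp_rw [← map_sum] at h
  refine cast (congrArg UWContMap (funext fun m => ?_)) h
  rw [left, Matrix.matrix_eq_sum_single (Y.gram _ _)]
  rfl

end Corner

open Corner in
/-- The tensor product of the bimodule of the triple `t` with `Y`. -/
def tensor (hfin : IsFiniteVN M) [FiniteDimensional ℂ (linT M)] (t : SelfSimilarTriple M)
    (Y : EquivBimodule M) : EquivBimodule M where
  carrier := t.Corner Y
  rInner x y := Y.colR x.val y.val
  lInner := left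
  rInner_add x y z := colR_add _ _ _
  rInner_smul x y b := colR_op_smul _ _ _
  star_rInner x y := star_colR _ _
  rInner_self x := exists_star_mul_self_iff.2 (colR_self_nonneg _)
  norm_rInner := norm_sq
  rInner_adjoint := colR_smul_left'
  lInner_add := left_add
  lInner_smul := left_smul
  star_lInner := star_left
  lInner_self x := exists_star_mul_self_iff.2 (left_self_nonneg x)
  norm_lInner x := by rw [norm_left_self, norm_sq]
  lInner_adjoint := left_op_smul
  lInner_smul_eq := left_smul_eq
  dense_rInner := by
    rw [span_colR hfin]
    exact @dense_univ M (ultraweak M)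
  dense_lInner := by
    rw [span_left hfin]
    exact @dense_univ M (ultraweak M)
  normal_left := uwContMap_colR hfin
  normal_right := uwContMap_left hfin

end SelfSimilarTriple

/-! ### Self-similar triples and equivalence bimodules -/

namespace EquivBimodule

variable {X : EquivBimodule M} {n : ℕ} {ξ : Fin n → X.carrier}

lemma IsRightBasis.sum_mul (hξ : X.IsRightBasis ξ) (x y : X.carrier) :
    ∑ i, X.rInner x (ξ i) * X.rInner (ξ i) y = X.rInner x y := by
  conv_rhs => rw [hξ y, rInner_sum]
  simp_rw [X.rInner_smul]

/-- `a ↦ (⟨ξ i, a ξ j⟩)` for a right basis `ξ`. -/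
def IsRightBasis.matrixHom (hξ : X.IsRightBasis ξ) : M →⋆ₙₐ[ℂ] Matrix (Fin n) (Fin n) M where
  toFun a := Matrix.of fun i j => X.rInner (ξ i) (a • ξ j)
  map_smul' c a := by
    ext1 i j
    change X.rInner (ξ i) ((c • a) • ξ j) = c • X.rInner (ξ i) (a • ξ j)
    rw [smul_assoc, X.rInner_csmul]
  map_zero' := by
    ext1 i j
    change X.rInner (ξ i) ((0 : M) • ξ j) = 0
    rw [zero_smul, X.rInner_zero]
  map_add' a b := by
    ext1 i j
    change X.rInner (ξ i) ((a + b) • ξ j) = X.rInner (ξ i) (a • ξ j) + X.rInner (ξ i) (b • ξ j)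
    rw [add_smul, X.rInner_add]
  map_mul' a b := by
    ext1 i j
    rw [Matrix.mul_apply]
    change X.rInner (ξ i) ((a * b) • ξ j) =
      ∑ l, X.rInner (ξ i) (a • ξ l) * X.rInner (ξ l) (b • ξ j)
    rw [mul_smul, ← star_star a, ← X.rInner_adjoint, ← hξ.sum_mul]
    simp_rw [X.rInner_adjoint]
  map_star' a := by
    ext1 i j
    rw [Matrix.star_apply]
    change X.rInner (ξ i) (star a • ξ j) = star (X.rInner (ξ j) (a • ξ i))
    rw [X.star_rInner, X.rInner_adjoint]

lemma IsRightBasis.matrixHom_apply (hξ : X.IsRightBasis ξ) (a : M) (i j : Fin n) :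
    hξ.matrixHom a i j = X.rInner (ξ i) (a • ξ j) := rfl

/-- The self-similar triple of a family `ξ` with `∑ i, ⟨ξ i, ξ i⟩ = 1` for the left inner
product. -/
def toTriple (h : ∑ i, X.lInner (ξ i) (ξ i) = 1) : SelfSimilarTriple M where
  k := n
  p := (isRightBasis_of_sum_eq_one h).matrixHom 1
  isStarProjection := by
    refine ⟨?_, ?_⟩
    · rw [IsIdempotentElem, ← map_mul, one_mul]
    · rw [IsSelfAdjoint, ← map_star, star_one]
  Φ := (isRightBasis_of_sum_eq_one h).matrixHom
  injective := by
    rw [injective_iff_map_eq_zero]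
    intro a ha
    have h1 : ∀ j, a • ξ j = 0 := fun j => by
      rw [isRightBasis_of_sum_eq_one h (a • ξ j)]
      refine Finset.sum_eq_zero fun i _ => ?_
      rw [← IsRightBasis.matrixHom_apply (isRightBasis_of_sum_eq_one h), ha, Matrix.zero_apply,
        MulOpposite.op_zero, zero_smul]
    rw [← mul_one a, ← h, Finset.mul_sum]
    refine Finset.sum_eq_zero fun i _ => ?_
    rw [← X.lInner_smul, h1, X.lInner_zero_left]
  range_eq := by
    obtain ⟨Ψ, hΨ⟩ : ∃ Ψ, Ψ = (isRightBasis_of_sum_eq_one h).matrixHom := ⟨_, rfl⟩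
    have hΨ' : ∀ a i j, Ψ a i j = X.rInner (ξ i) (a • ξ j) := fun a i j => by rw [hΨ]; rfl
    rw [← hΨ]
    refine Set.Subset.antisymm ?_ ?_
    · rintro _ ⟨a, rfl⟩
      exact ⟨Ψ a, by simp only [← map_mul, one_mul, mul_one]⟩
    · rintro _ ⟨x, rfl⟩
      -- the operator with matrix `x` in the frame `ξ`
      refine ⟨∑ i, ∑ j, X.lInner (MulOpposite.op (x i j) • ξ i) (ξ j), ?_⟩
      ext1 a b
      simp only [hΨ', Finset.sum_smul, rInner_sum, X.lInner_smul_eq, X.rInner_smul,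
        Matrix.mul_apply, one_smul, Finset.sum_mul]
      exact Finset.sum_comm

lemma toTriple_T (h : ∑ i, X.lInner (ξ i) (ξ i) = 1) : (toTriple h).T = X.R := by
  refine LinearMap.ext fun φ => Subtype.ext (LinearMap.ext fun a => ?_)
  rw [SelfSimilarTriple.T_apply, X.R_apply (isRightBasis_of_sum_eq_one h)]
  rfl

open SelfSimilarTriple.Corner in
/-- `X ⊗ Y` is realised by the triple of `X` with coefficients in `Y`; the elementary tensor
`x ⊗ y` is the column with entries `⟨ξ i, x⟩ y`. -/
theorem exists_isInternalTensor (hfin : IsFiniteVN M) [FiniteDimensional ℂ (linT M)]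
    (X Y : EquivBimodule M) :
    ∃ (Z : EquivBimodule M) (t : X.carrier → Y.carrier → Z.carrier), IsInternalTensor X Y Z t := by
  obtain ⟨n, ξ, h⟩ := X.exists_sum_lInner_eq_one hfin
  have hξ := isRightBasis_of_sum_eq_one h
  obtain ⟨s, hs⟩ : ∃ s, s = toTriple h := ⟨_, rfl⟩
  subst hs
  have hΦ : ∀ (a : M) (x : X.carrier) (y : Y.carrier),
      (toTriple h).Φ a • (fun i => X.rInner (ξ i) x • y : Fin (toTriple h).k → Y.carrier) =
        fun i => X.rInner (ξ i) (a • x) • y := by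
    intro a x y
    funext i
    change ∑ j, X.rInner (ξ i) (a • ξ j) • X.rInner (ξ j) x • y = _
    simp_rw [← mul_smul]
    rw [← Finset.sum_smul, ← star_star a]
    simp_rw [← X.rInner_adjoint]
    rw [hξ.sum_mul]
  let τ : X.carrier → Y.carrier → (toTriple h).Corner Y := fun x y =>
    SelfSimilarTriple.Corner.mk (fun i => X.rInner (ξ i) x • y)
      ((hΦ 1 x y).trans (by simp_rw [one_smul]; rfl))
  refine ⟨(toTriple h).tensor hfin Y, τ, ?_, ?_, ?_, ?_, ?_, ?_, ?_, ?_⟩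
  · intro x x' y
    refine val_injective (funext fun i => ?_)
    exact (congrArg (· • y) (X.rInner_add _ _ _)).trans (add_smul _ _ _)
  · intro x y y'
    exact val_injective (funext fun i => smul_add _ _ _)
  · intro x a y
    refine val_injective (funext fun i => ?_)
    exact (congrArg (· • y) (X.rInner_smul _ _ _)).trans (mul_smul _ _ _)
  · intro a x y
    exact val_injective (hΦ a x y).symm
  · intro x b y
    exact val_injective (funext fun i => smul_comm _ _ _)
  · intro x x' y y'
    change ∑ i, Y.rInner (X.rInner (ξ i) x • y) (X.rInner (ξ i) x' • y') = _
    simp_rw [Y.rInner_adjoint, ← mul_smul, X.star_rInner]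
    rw [← rInner_sum, ← Finset.sum_smul, hξ.sum_mul]
  · intro x x' y y'
    refine (toTriple h).injective ((Φ_left _ _).trans ?_)
    ext1 i j
    change Y.lInner (X.rInner (ξ i) x • y) (X.rInner (ξ j) x' • y') = X.rInner (ξ i)
      (X.lInner (MulOpposite.op (Y.lInner y y') • x) x' • ξ j)
    rw [Y.lInner_smul, Y.lInner_smul_right, X.lInner_smul_eq, X.rInner_smul, X.rInner_smul,
      X.star_rInner, mul_assoc]
  · -- already the linear span is everything: `z` is the sum of the `ξ j ⊗ z j`
    intro z
    refine subset_closure ?_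
    have hz : z = ∑ j : Fin n, τ (ξ j) (val z j) := by
      refine val_injective ?_
      have hsum : ∀ v : Fin n → (toTriple h).Corner Y, (∑ j, v j).val = ∑ j, (v j).val :=
        fun v => map_sum (AddMonoidHom.mk' (val (t := toTriple h) (Y := Y)) val_add) v _
      rw [hsum]
      funext i
      rw [Finset.sum_apply]
      refine (congrFun (p_smul_val z) i).symm.trans ?_
      change ∑ j, X.rInner (ξ i) ((1 : M) • ξ j) • val z j =
        ∑ j, X.rInner (ξ i) (ξ j) • val z j
      simp_rw [one_smul]
    rw [hz]
    exact Submodule.sum_mem _ fun j _ => Submodule.subset_span ⟨(ξ j, val z j), rfl⟩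

end EquivBimodule

namespace SelfSimilarTriple

variable (t : SelfSimilarTriple M)

open EquivBimodule Corner

lemma sum_left_col {Y : EquivBimodule M} {e : Y.carrier} (he : Y.lInner e e = 1) :
    ∑ i, left (t := t) (col i e) (col i e) = 1 := by
  simp_rw [left_col, he]
  rw [← map_sum, Matrix.sum_single_one]
  refine t.injective ?_
  rw [t.Φ_inv, mul_one, t.isStarProjection.isIdempotentElem.eq, t.Φ_one]

lemma colR_col_smul {Y : EquivBimodule M} (e : Y.carrier) (a : M) (i : Fin t.k) :
    Y.colR (col (t := t) i e).val (a • col (t := t) i e).val = Y.rInner e (t.Φ a i i • e) := by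
  rw [val_smul, col, val_mk, colR_smul_left, t.isStarProjection.isSelfAdjoint.star_eq, ← mul_smul,
    ← mul_smul, t.p_mul_Φ, t.Φ_mul_p, colR_single, Matrix.Module.smul_apply,
    Fintype.sum_eq_single i fun l hl => by rw [Pi.single_eq_of_ne hl, smul_zero],
    Pi.single_eq_same]

/-- If `Y` has a one-element basis `e`, the columns `p e_i ⊗ e` form a basis of the bimodule of the
triple. -/
lemma tensor_R_apply (hfin : IsFiniteVN M) [FiniteDimensional ℂ (linT M)] {Y : EquivBimodule M}
    {e : Y.carrier} (he : Y.lInner e e = 1) (φ : linT M) (a : M) :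
    ((t.tensor hfin Y).R φ).1 a = ∑ i, φ.1 (Y.rInner e (t.Φ a i i • e)) := by
  rw [EquivBimodule.R_apply (t.tensor hfin Y) (ξ := fun i => col i e)
    (isRightBasis_of_sum_eq_one (t.sum_left_col he))]
  exact Finset.sum_congr rfl fun i _ => congrArg φ.1 (t.colR_col_smul e a i)

/-- The class of the bimodule of a triple is sent to the map of the triple. -/
lemma tensor_self_R (hfin : IsFiniteVN M) [FiniteDimensional ℂ (linT M)] :
    (t.tensor hfin (EquivBimodule.self M)).R = t.T := by
  have he : (EquivBimodule.self M).lInner (1 : M) (1 : M) = 1 := by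
    change (1 : M) * star 1 = 1
    rw [star_one, one_mul]
  refine LinearMap.ext fun φ => Subtype.ext (LinearMap.ext fun a => ?_)
  rw [t.tensor_R_apply hfin he, t.T_apply]
  refine Finset.sum_congr rfl fun i _ => congrArg φ.1 ?_
  change star (1 : M) * (t.Φ a i i * 1) = t.Φ a i i
  rw [star_one, one_mul, mul_one]

end SelfSimilarTriple

/-- The triples and the bimodules produce the same maps of the trace space. -/
theorem Ftr_eq_range (hfin : IsFiniteVN M) [FiniteDimensional ℂ (linT M)] :
    Ftr M = Set.range (picR M) := by
  refine Set.Subset.antisymm ?_ ?_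
  · rintro _ ⟨t, rfl⟩
    exact ⟨Pic.mk (t.tensor hfin (EquivBimodule.self M)), t.tensor_self_R hfin⟩
  · rintro _ ⟨x, rfl⟩
    induction x using Quotient.inductionOn with
    | h X =>
      obtain ⟨n, ξ, h⟩ := X.exists_sum_lInner_eq_one hfin
      exact ⟨EquivBimodule.toTriple h, EquivBimodule.toTriple_T h⟩

/-! ### The Picard group -/

namespace Pic

variable (hfin : IsFiniteVN M) [FiniteDimensional ℂ (linT M)]

/-- The class of an internal tensor product of representatives. -/
def mul (x y : Pic M) : Pic M :=
  mk (EquivBimodule.exists_isInternalTensor hfin (Quotient.out x) (Quotient.out y)).choose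

lemma mul_mk {X Y Z : EquivBimodule M} {t : X.carrier → Y.carrier → Z.carrier}
    (h : EquivBimodule.IsInternalTensor X Y Z t) : mul hfin (mk X) (mk Y) = mk Z := by
  obtain ⟨s, hs⟩ := (EquivBimodule.exists_isInternalTensor hfin (Quotient.out (mk X))
    (Quotient.out (mk Y))).choose_spec
  obtain ⟨e⟩ : Nonempty (EquivBimodule.Iso (Quotient.out (mk X)) X) := Quotient.mk_out X
  obtain ⟨f⟩ : Nonempty (EquivBimodule.Iso (Quotient.out (mk Y)) Y) := Quotient.mk_out Y
  exact Quotient.sound (hs.nonempty_iso h e f)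

/-- The Picard group; the inverse of `[X]` is the class of the dual bimodule. -/
abbrev group : Group (Pic M) :=
  letI : Mul (Pic M) := ⟨mul hfin⟩
  letI : Inv (Pic M) := ⟨fun x => mk (Quotient.out x).dual⟩
  letI : One (Pic M) := ⟨mk (EquivBimodule.self M)⟩
  Group.ofLeftAxioms
    (by
      rintro ⟨X⟩ ⟨Y⟩ ⟨W⟩
      obtain ⟨Z, t₁, h₁⟩ := EquivBimodule.exists_isInternalTensor hfin X Y
      obtain ⟨V, t₂, h₂⟩ := EquivBimodule.exists_isInternalTensor hfin Z W
      obtain ⟨U, t₃, h₃⟩ := EquivBimodule.exists_isInternalTensor hfin Y W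
      obtain ⟨V', t₄, h₄⟩ := EquivBimodule.exists_isInternalTensor hfin X U
      change mul hfin (mul hfin (mk X) (mk Y)) (mk W) = mul hfin (mk X) (mul hfin (mk Y) (mk W))
      rw [mul_mk hfin h₁, mul_mk hfin h₂, mul_mk hfin h₃, mul_mk hfin h₄]
      exact Quotient.sound (h₁.nonempty_assoc h₂ h₃ h₄))
    (by
      rintro ⟨X⟩
      exact mul_mk hfin (EquivBimodule.IsInternalTensor.self_left X))
    (by
      intro x
      have h := mul_mk hfin (EquivBimodule.IsInternalTensor.dual_left hfin (Quotient.out x))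
      have hx : mk (Quotient.out x) = x := Quotient.out_eq x
      rwa [hx] at h)

end Pic

end VNPicard

end

open VNPicard in
theorem mainTheorem7 {H : Type*} [NormedAddCommGroup H] [InnerProductSpace ℂ H] [CompleteSpace H]
    (M : VonNeumannAlgebra H) (hfin : IsFiniteVN M) (hdim : FiniteDimensional ℂ (linT M)) :
    -- every equivalence bimodule has a finite right basis, and each such basis computes `R_M`
    (∀ X : EquivBimodule M, X.HasRightBasis ∧
      ∀ (n : ℕ) (ξ : Fin n → X.carrier), X.IsRightBasis ξ → ∀ (φ : linT M) (a : M),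
        (picR M (Pic.mk X) φ).1 a = ∑ i, φ.1 (X.rInner (ξ i) (a • ξ i))) ∧
    -- `Pic(M)` is a group under the internal tensor product, and `R_M` is multiplicative
    (∃ _ : Group (Pic M),
      (∀ X Y : EquivBimodule M, ∃ (Z : EquivBimodule M) (t : X.carrier → Y.carrier → Z.carrier),
        EquivBimodule.IsInternalTensor X Y Z t) ∧
      (∀ (X Y Z : EquivBimodule M) (t : X.carrier → Y.carrier → Z.carrier),
        EquivBimodule.IsInternalTensor X Y Z t → Pic.mk X * Pic.mk Y = Pic.mk Z) ∧
      (1 : Pic M) = Pic.mk (EquivBimodule.self M) ∧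
      (∀ x y : Pic M, picR M (x * y) = picR M x * picR M y) ∧
      picR M 1 = 1) ∧
    -- `F^tr(M) = R_M(Pic(M))`
    Ftr M = Set.range (picR M) ∧
    -- `F^tr(M)` is a subgroup of `GL(lin_ℂ T(M))`
    ∃ S : Subgroup (LinearMap.GeneralLinearGroup ℂ (linT M)),
      (fun g : LinearMap.GeneralLinearGroup ℂ (linT M) => (g : Module.End ℂ (linT M))) '' S =
        Ftr M := by
  have hmul : ∀ x y : Pic M, picR M (Pic.mul hfin x y) = picR M x * picR M y := by
    rintro ⟨X⟩ ⟨Y⟩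
    obtain ⟨Z, t, h⟩ := EquivBimodule.exists_isInternalTensor hfin X Y
    exact (congrArg (picR M) (Pic.mul_mk hfin h)).trans (h.R_eq_mul hfin)
  have hone : picR M (Pic.mk (EquivBimodule.self M)) = 1 := EquivBimodule.R_self
  refine ⟨fun X => ⟨X.hasRightBasis hfin, fun n ξ hξ φ a => X.R_apply hξ φ a⟩,
    ⟨Pic.group hfin, EquivBimodule.exists_isInternalTensor hfin,
      fun X Y Z t h => Pic.mul_mk hfin h, rfl, hmul, hone⟩, Ftr_eq_range hfin, ?_⟩
  let := Pic.group hfin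
  let f : Pic M →* Module.End ℂ (linT M) := { toFun := picR M, map_one' := hone, map_mul' := hmul }
  refine ⟨f.toHomUnits.range, ?_⟩
  rw [Ftr_eq_range hfin]
  ext T
  constructor
  · rintro ⟨_, ⟨x, rfl⟩, rfl⟩
    exact ⟨x, rfl⟩
  · rintro ⟨x, rfl⟩
    exact ⟨f.toHomUnits x, ⟨x, rfl⟩, rfl⟩
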